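/- Let $\mathbb K=\mathbb R$ or $\mathbb C$, let $G$ be an abelian group and let $\rho\colon G\times G\to\mathbb K$ be a commutation factor: $\rho(i,j)\rho(j,i)=1$ and $\rho(i+j,k)=\rho(i,k)\rho(j,k)$. Call $i\in G$ even if $\rho(i,i)=1$ and odd if $\rho(i,i)=-1$. Let $M$ be a connected $n$-dimensional manifold (Hausdorff, second countable) that is smooth, real analytic or holomorphic, and let $\mathscr O$ be its sheaf of $\mathbb K$-valued smooth, real analytic or holomorphic functions ($\mathbb K=\mathbb C$ in the holomorphic case). The real category is the case $\mathbb K=\mathbb R$. A $\rho$-manifold structure on $M$ with graded coordinates of degrees $d_1,\dots,d_m\in G$ is a sheaf $\mathscr O_\rho$ of $G$-graded algebras on $M$ (gluing being required for homogeneous sections) with $fg=\rho(|f|,|g|)gf$, such that every point has a coordinate system $x=(x^1,\dots,x^{n+m})$ on an open neighbourhood $U_x$: a chart $(x^1,\dots,x^n)$ of $M$ on $U_x$ together with an isomorphism, over $U_x$, of sheaves of graded algebras between $\mathscr O_\rho$ and the algebra of formal power series (finite sums of homogeneous ones) in $x^{n+1},\dots,x^{n+m}$ with $|x^{n+b}|=d_b$,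 $x^ax^b=\rho(|x^a|,|x^b|)x^bx^a$, and coefficients in $\mathscr O$ (of degree $0$). The partial derivatives $\partial/\partial x^a$ are the derivations of degree $-|x^a|$ with $\partial x^b/\partial x^a=\delta_{ab}$. A vector field $X$ of degree $|X|$ is a derivation of the sheaf $\mathscr O_\rho$: it raises degrees by $|X|$ and $X(fg)=X(f)g+\rho(|X|,|f|)fX(g)$; locally $X^a:=X(x^a)$. A $\rho$-Q-manifold is such an $M$ with a vector field $Q$ satisfying $\rho(|Q|,|Q|)=-1$ and $[Q,Q]_\rho=0$, i.e. $Q\circ Q=0$. Put $$H^1_Q(M)=\ker\bigl(Q\colon\mathscr O_\rho(M)_{|Q|}\to\mathscr O_\rho(M)_{2|Q|}\bigr)\big/Q\bigl(\mathscr O_\rho(M)_0\bigr).$$ For a square matrix $F$ whose entries $F_{kl}$ have degree $i_k-i_l$, split its positions into those with $i_k$ even and those with $i_k$ odd, and put $\rho\mathrm{Ber}(F)=\rho\det(F_{00}-F_{01}F_{11}^{-1}F_{10})\,\rho\det(F_{11})^{-1}$ if $F_{00}$ and $F_{11}$ are invertible, and $\rho\mathrm{Ber}(F)=0$ otherwise.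 Here, if all $i_k$ have the same parity, $\rho\det(F)$ is the coefficient of $t_1\cdots t_N$ in $\sum_\sigma F_{1\sigma(1)}t_{\sigma(1)}\cdots F_{N\sigma(N)}t_{\sigma(N)}$, where $|t_k|=i_k$, $t_kf=\rho(i_k,|f|)ft_k$, and $t_kt_l=\mp\rho(i_k,i_l)t_lt_k$ for $k\neq l$ with $-$ for even and $+$ for odd degrees. The Berezinian line bundle has, for each coordinate system $x$, a frame $D(x)$ of degree $0$ on $U_x$, with $D(y)=D(x)\,\rho\mathrm{Ber}(\partial y/\partial x)$, where $\partial y/\partial x$ has the entry $\partial y^a/\partial x^b$ in row $b$ and column $a$ (so that $i_k=-|x^k|$). A volume form is a global section $\mathrm{vol}$ of it that in every coordinate system has the form $D(x)s(x)$ with $s(x)$ invertible of degree $0$; $M$ is orientable if one exists. Two volume forms are equivalent if $\mathrm{vol}_2=\mathrm{vol}_1\cdot\exp h$ for some $h\in\mathscr O_\rho(M)_0$. The Lie derivative of a section along $X$ is $$L_X(D(x)s(x))=D(x)\sum_a\rho(|x^a|,|x^a|+|X|)\,\frac{\partial}{\partial x^a}(X^as(x)),$$ and the divergence $\mathrm{Div}_{\mathrm{vol}}X\in\mathscr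 O_\rho(M)_{|X|}$ is the function with $\mathrm{vol}\cdot\mathrm{Div}_{\mathrm{vol}}X=L_X\mathrm{vol}$. **Lemma.** Let $(M,Q)$ be an orientable $\rho$-Q-manifold. For every volume form $\mathrm{vol}$, the divergence $\mathrm{Div}_{\mathrm{vol}}Q$ exists and satisfies $Q(\mathrm{Div}_{\mathrm{vol}}Q)=0$, so it has a well-defined class $\mathrm{Mod}_Q(M;\mathrm{vol})=[\mathrm{Div}_{\mathrm{vol}}Q]\in H^1_Q(M)$, the modular class. If $\mathrm{vol}_1$ and $\mathrm{vol}_2$ are equivalent, then $\mathrm{Mod}_Q(M;\mathrm{vol}_1)=\mathrm{Mod}_Q(M;\mathrm{vol}_2)$. In the real category there is a unique class $\mathrm{Mod}_Q(M)\in H^1_Q(M)$ with $\mathrm{Mod}_Q(M;\mathrm{vol})=\mathrm{Mod}_Q(M)$ for all volume forms $\mathrm{vol}$. -/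

import Mathlib

open scoped Manifold ContDiff Topology
open TopologicalSpace

noncomputable section

namespace RhoGeometry

universe u v w

/-- A commutation factor on the abelian group `G` with values in `K`. -/
structure CommutationFactor (K : Type*) (G : Type*) [Field K] [AddCommGroup G] where
  toFun : G → G → K
  mul_swap : ∀ i j, toFun i j * toFun j i = 1
  add_left : ∀ i j k, toFun (i + j) k = toFun i k * toFun j k

instance {K G : Type*} [Field K] [AddCommGroup G] :
    CoeFun (CommutationFactor K G) (fun _ => G → G → K) := ⟨CommutationFactor.toFun⟩

/-! ### The graded determinant and the graded Berezinian -/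

section Berezinian

variable {K : Type*} {G : Type*} [Field K] [AddCommGroup G] {A : Type*} [Ring A] [Algebra K A]

/-- The graded determinant of a degree-zero matrix `F` (entries `F k l` of degree `I k - I l`),
all `I k` even or all `I k` odd.  It is the coefficient of `t_1 ⋯ t_N` in
`∑ σ, F 1 (σ 1) t_(σ 1) ⋯ F N (σ N) t_(σ N)`, where `t_k` has degree `I k` and
`t_k f = ρ (I k) |f| f t_k`, `t_k t_l = ε ρ (I k) (I l) t_l t_k` with `ε = -1` for even and
`ε = 1` for odd `I`, that is `ε = - ρ (I k) (I k)`.  The first factor below comes from moving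
the `t`'s to the right of the entries, the second one from sorting the `t`'s. -/
def rhoDet (ρ : CommutationFactor K G) {ι : Type*} [Fintype ι] [LinearOrder ι]
    (I : ι → G) (F : Matrix ι ι A) : A :=
  ∑ σ : Equiv.Perm ι,
    (∏ k : ι, ∏ l : ι, if k < l then ρ (I (σ k)) (I l - I (σ l)) else 1) •
    (∏ k : ι, ∏ l : ι, if k < l ∧ σ l < σ k then
      -ρ (I (σ k)) (I (σ k)) * ρ (I (σ k)) (I (σ l)) else 1) •
    ((Finset.univ.sort (fun a b : ι => a ≤ b)).map (fun k => F k (σ k))).prod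

/-- Positions of even degree. -/
abbrev EvenIdx (ρ : CommutationFactor K G) {ι : Type*} (I : ι → G) : Type _ :=
  {k : ι // ρ (I k) (I k) = 1}

/-- Positions of odd degree. -/
abbrev OddIdx (ρ : CommutationFactor K G) {ι : Type*} (I : ι → G) : Type _ :=
  {k : ι // ¬ ρ (I k) (I k) = 1}

open Classical in
/-- The graded Berezinian of a degree-zero matrix, written in blocks after collecting the even
and the odd positions. -/
def rhoBer (ρ : CommutationFactor K G) {ι : Type*} [Fintype ι] [LinearOrder ι]
    (I : ι → G) (F : Matrix ι ι A) : A :=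
  let F00 : Matrix (EvenIdx ρ I) (EvenIdx ρ I) A := F.submatrix Subtype.val Subtype.val
  let F01 : Matrix (EvenIdx ρ I) (OddIdx ρ I) A := F.submatrix Subtype.val Subtype.val
  let F10 : Matrix (OddIdx ρ I) (EvenIdx ρ I) A := F.submatrix Subtype.val Subtype.val
  let F11 : Matrix (OddIdx ρ I) (OddIdx ρ I) A := F.submatrix Subtype.val Subtype.val
  if IsUnit F00 ∧ IsUnit F11 then
    rhoDet ρ (fun k : EvenIdx ρ I => I k) (F00 - F01 * Ring.inverse F11 * F10) *
      Ring.inverse (rhoDet ρ (fun k : OddIdx ρ I => I k) F11)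
  else 0

end Berezinian

/-! ### Functions on the underlying manifold -/

/-- Smooth or analytic.  The categories are: real smooth `(𝕜, K) = (ℝ, ℝ)`, complex-valued smooth
`(ℝ, ℂ)`, real analytic `(ℝ, ℝ)`, holomorphic `(ℂ, ℂ)`, with `𝕜` the field of the charts and
`K` the field of values. -/
inductive Regularity
  | smooth
  | analytic

/-- The order of differentiability. -/
def Regularity.order : Regularity → WithTop ℕ∞
  | .smooth => ∞
  | .analytic => ω

theorem Regularity.order_add_one (r : Regularity) : r.order + 1 ≤ r.order := by
  cases r <;> simp [Regularity.order]

/-- The real category: the field of values is the real numbers. -/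
def IsRealCategory (K : Type*) [RCLike K] : Prop := (RCLike.I : K) = 0

/-- The model space of an `n`-dimensional manifold. -/
abbrev Model (𝕜 : Type*) (n : ℕ) : Type _ := EuclideanSpace 𝕜 (Fin n)

section Functions

variable (𝕜 : Type*) [RCLike 𝕜] (K : Type*) [RCLike K] [NormedAlgebra 𝕜 K] (n : ℕ)
  (r : Regularity) {M : Type*} [TopologicalSpace M] [ChartedSpace (Model 𝕜 n) M]

/-- The algebra of `K`-valued smooth (analytic) functions on the open set `V`. -/
def Fun (V : Opens M) : Subalgebra K (V → K) where
  carrier := {f | ContMDiff 𝓘(𝕜, Model 𝕜 n) 𝓘(𝕜, K) r.order f}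
  mul_mem' hf hg :=
    (contDiff_mul (𝕜 := 𝕜) (𝔸 := K)).contMDiff.comp (hf.prodMk_space hg)
  add_mem' hf hg :=
    (contDiff_add (𝕜 := 𝕜) (F := K)).contMDiff.comp (hf.prodMk_space hg)
  algebraMap_mem' _ := contMDiff_const

variable {𝕜 K n r}

/-- Restriction of functions. -/
def Fun.res {U V : Opens M} (h : V ≤ U) (f : Fun 𝕜 K n r U) : Fun 𝕜 K n r V :=
  ⟨fun p => f.1 ⟨p.1, h p.2⟩, f.2.comp (contMDiff_inclusion h)⟩

/-- The exponential of a function on the manifold. -/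
def Fun.exp {V : Opens M} (f : Fun 𝕜 K n r V) : Fun 𝕜 K n r V :=
  ⟨fun p => NormedSpace.exp (f.1 p), by
    have h : ContDiff 𝕜 r.order (NormedSpace.exp : K → K) :=
      (AnalyticOnNhd.contDiff fun x _ => NormedSpace.exp_analytic x)
    exact h.contMDiff.comp f.2⟩

/-- Extension of a function by zero. -/
def extendZero {V : Opens M} (f : V → K) : M → K :=
  Function.extend (Subtype.val : V → M) f 0

/-- The `a`-th coordinate of a chart as a `K`-valued function. -/
def chartCoord [IsManifold 𝓘(𝕜, Model 𝕜 n) r.order M]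
    (φ : OpenPartialHomeomorph M (Model 𝕜 n))
    (hφ : φ ∈ IsManifold.maximalAtlas 𝓘(𝕜, Model 𝕜 n) r.order M)
    (V : Opens M) (hV : ∀ p ∈ V, p ∈ φ.source) (a : Fin n) : Fun 𝕜 K n r V :=
  ⟨fun p => algebraMap 𝕜 K (φ p.1 a), by
    intro p
    have h1 : ContMDiffAt 𝓘(𝕜, Model 𝕜 n) 𝓘(𝕜, Model 𝕜 n) r.order φ p.1 :=
      contMDiffAt_of_mem_maximalAtlas hφ (hV _ p.2)
    have h2 : ContDiff 𝕜 r.order (fun e : Model 𝕜 n => algebraMap 𝕜 K (e a)) :=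
      ((Algebra.linearMap 𝕜 K).toContinuousLinearMap.comp
        (EuclideanSpace.proj a : Model 𝕜 n →L[𝕜] 𝕜)).contDiff
    exact contMDiffAt_subtype_iff.2 ((h2.contMDiff.contMDiffAt).comp p.1 h1)⟩

theorem extendZero_contDiffAt [IsManifold 𝓘(𝕜, Model 𝕜 n) r.order M]
    (φ : OpenPartialHomeomorph M (Model 𝕜 n))
    (hφ : φ ∈ IsManifold.maximalAtlas 𝓘(𝕜, Model 𝕜 n) r.order M)
    (V : Opens M) (hV : ∀ p ∈ V, p ∈ φ.source) (f : Fun 𝕜 K n r V) (p : V) :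
    ContDiffAt 𝕜 r.order (extendZero f.1 ∘ φ.symm) (φ p.1) := by
  have hf : ContMDiffAt 𝓘(𝕜, Model 𝕜 n) 𝓘(𝕜, K) r.order (extendZero f.1) p.1 := by
    rw [← contMDiffAt_subtype_iff]
    have : (fun x : V => extendZero f.1 x.1) = f.1 := by
      funext x
      exact Subtype.val_injective.extend_apply _ _ _
    rw [this]
    exact f.2 p
  have hp := hV _ p.2
  have hs : ContMDiffAt 𝓘(𝕜, Model 𝕜 n) 𝓘(𝕜, Model 𝕜 n) r.order φ.symm (φ p.1) :=
    contMDiffAt_symm_of_mem_maximalAtlas hφ (φ.map_source hp)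
  rw [← contMDiffAt_iff_contDiffAt]
  refine ContMDiffAt.comp (φ p.1) ?_ hs
  rwa [φ.left_inv hp]

/-- The partial derivative `∂ / ∂ x^a` in a chart, on functions of the manifold. -/
def chartPartial [IsManifold 𝓘(𝕜, Model 𝕜 n) r.order M]
    (φ : OpenPartialHomeomorph M (Model 𝕜 n))
    (hφ : φ ∈ IsManifold.maximalAtlas 𝓘(𝕜, Model 𝕜 n) r.order M)
    (V : Opens M) (hV : ∀ p ∈ V, p ∈ φ.source) (a : Fin n) :
    Fun 𝕜 K n r V →ₗ[K] Fun 𝕜 K n r V where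
  toFun f := ⟨fun p => fderiv 𝕜 (extendZero f.1 ∘ φ.symm) (φ p.1) (EuclideanSpace.single a 1), by
    intro p
    have h1 := (extendZero_contDiffAt φ hφ V hV f p).fderiv_right r.order_add_one
    have h2 : ContDiffAt 𝕜 r.order (fun e => fderiv 𝕜 (extendZero f.1 ∘ φ.symm) e
        (EuclideanSpace.single a 1)) (φ p.1) := h1.clm_apply contDiffAt_const
    exact contMDiffAt_subtype_iff.2
      (h2.contMDiffAt.comp p.1 (contMDiffAt_of_mem_maximalAtlas hφ (hV _ p.2)))⟩
  map_add' f g := by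
    ext p
    have hne : r.order ≠ 0 := by cases r <;> simp [Regularity.order]
    have hf := (extendZero_contDiffAt φ hφ V hV f p).differentiableAt hne
    have hg := (extendZero_contDiffAt φ hφ V hV g p).differentiableAt hne
    have : extendZero (f + g).1 ∘ φ.symm = extendZero f.1 ∘ φ.symm + extendZero g.1 ∘ φ.symm := by
      funext e
      by_cases h : φ.symm e ∈ V
      · have := fun k : V → K => Subtype.val_injective.extend_apply k 0 ⟨φ.symm e, h⟩
        simp only [extendZero, Function.comp, Pi.add_apply]
        erw [this, this, this]; rfl
      · have h' : ¬ ∃ a : V, a.1 = φ.symm e := fun ⟨a, ha⟩ => h (ha ▸ a.2)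
        simp [extendZero, Function.extend_apply' _ _ _ h']
    simp only [this]
    rw [fderiv_add hf hg]; rfl
  map_smul' c f := by
    ext p
    have hne : r.order ≠ 0 := by cases r <;> simp [Regularity.order]
    have hf := (extendZero_contDiffAt φ hφ V hV f p).differentiableAt hne
    have : extendZero (c • f).1 ∘ φ.symm = c • (extendZero f.1 ∘ φ.symm) := by
      funext e
      by_cases h : φ.symm e ∈ V
      · have := fun k : V → K => Subtype.val_injective.extend_apply k 0 ⟨φ.symm e, h⟩
        simp only [extendZero, Function.comp, Pi.smul_apply]
        erw [this, this]; rfl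
      · have h' : ¬ ∃ a : V, a.1 = φ.symm e := fun ⟨a, ha⟩ => h (ha ▸ a.2)
        simp [extendZero, Function.extend_apply' _ _ _ h']
    simp only [this]
    rw [fderiv_const_smul hf]; rfl

end Functions

/-! ### Formal power series in graded indeterminates -/

section Series

variable {𝕜 : Type*} [RCLike 𝕜] {K : Type*} [RCLike K] [NormedAlgebra 𝕜 K] {n : ℕ}
  {r : Regularity} {M : Type*} [TopologicalSpace M] [ChartedSpace (Model 𝕜 n) M]
  {G : Type*} [AddCommGroup G] (ρ : CommutationFactor K G) {m : ℕ} (d : Fin m → G)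

/-- Families of coefficients `c w` of formal sums `∑ c w x^w` over the multi-indices `w` in the
`m` graded indeterminates (which come after the `n` coordinates of the manifold). -/
abbrev Series (𝕜 : Type*) [RCLike 𝕜] (K : Type*) [RCLike K] [NormedAlgebra 𝕜 K] (n m : ℕ)
    (r : Regularity) {M : Type*} [TopologicalSpace M] [ChartedSpace (Model 𝕜 n) M]
    (V : Opens M) : Type _ :=
  (Fin m →₀ ℕ) → Fun 𝕜 K n r V

/-- The degree of the monomial `x^w`. -/
def monDeg (w : Fin m →₀ ℕ) : G := ∑ b, w b • d b

/-- An odd indeterminate (degree `i` with `ρ i i = -1`) squares to zero, so it occurs at most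
once in a monomial. -/
def Admissible (w : Fin m →₀ ℕ) : Prop := ∀ b, ρ (d b) (d b) = -1 → w b ≤ 1

/-- The factor in `x^u x^v = reorder u v • x^(u+v)`. -/
def reorder (u v : Fin m →₀ ℕ) : K :=
  ∏ b, ∏ b', if b' < b then ρ (d b) (d b') ^ (u b * v b') else 1

open Classical in
/-- The product of formal sums determined by `x^b x^b' = ρ (d b) (d b') x^b' x^b`. -/
def seriesMul {V : Opens M} (f g : Series 𝕜 K n m r V) : Series 𝕜 K n m r V := fun w =>
  if Admissible ρ d w then
    ∑ q ∈ Finset.HasAntidiagonal.antidiagonal w, reorder ρ d q.1 q.2 • (f q.1 * g q.2)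
  else 0

/-- The formal sums that are homogeneous of degree `i`. -/
def homog (V : Opens M) (i : G) : Submodule K (Series 𝕜 K n m r V) where
  carrier := {c | ∀ w, c w ≠ 0 → Admissible ρ d w ∧ monDeg d w = i}
  add_mem' {c c'} hc hc' w hw := by
    by_cases h : c w = 0
    · exact hc' w (by simpa [h] using hw)
    · exact hc w h
  zero_mem' w hw := (hw rfl).elim
  smul_mem' a c hc w hw := hc w (by rintro h; exact hw (by simp [h]))

/-- The degrees of all the coordinates `x^1, …, x^(n+m)`. -/
def coordDeg (n : ℕ) (d : Fin m → G) : Fin (n + m) → G :=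
  Fin.append (fun _ : Fin n => 0) d

/-- The derivative with respect to the `b`-th indeterminate, determined by
`∂_b (x^b') = δ` and the graded Leibniz rule for the degree `-d b`. -/
def formalPartial (V : Opens M) (b : Fin m) : Series 𝕜 K n m r V →ₗ[K] Series 𝕜 K n m r V where
  toFun c w := (((w b : K) + 1) * ρ (-d b) (∑ b' ∈ Finset.univ.filter (· < b), w b' • d b')) •
    c (w + Finsupp.single b 1)
  map_add' c c' := by funext w; simp
  map_smul' a c := by
    funext w
    simp only [Pi.smul_apply, RingHom.id_apply]
    rw [smul_comm]

theorem formalPartial_mem {V : Opens M} (b : Fin m) {i : G} {c : Series 𝕜 K n m r V}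
    (hc : c ∈ homog ρ d V i) : formalPartial ρ d V b c ∈ homog ρ d V (i - d b) := by
  intro w hw
  have h : c (w + Finsupp.single b 1) ≠ 0 := by
    intro h
    exact hw (by simp [formalPartial, h])
  obtain ⟨h1, h2⟩ := hc _ h
  refine ⟨fun b' hb' => le_trans (by simp) (h1 b' hb'), ?_⟩
  rw [← h2]
  simp [monDeg, add_smul, Finset.sum_add_distrib, Finsupp.single_apply, ite_smul]

theorem single_zero_mem {V : Opens M} (f : Fun 𝕜 K n r V) :
    (Pi.single 0 f : Series 𝕜 K n m r V) ∈ homog ρ d V 0 := by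
  intro w hw
  have : w = 0 := by
    by_contra h
    exact hw (by simp [h])
  subst this
  exact ⟨fun b _ => by simp, by simp [monDeg]⟩

theorem single_one_mem {V : Opens M} (b : Fin m) :
    (Pi.single (Finsupp.single b 1) 1 : Series 𝕜 K n m r V) ∈ homog ρ d V (d b) := by
  intro w hw
  have : w = Finsupp.single b 1 := by
    by_contra h
    exact hw (by simp [h])
  subst this
  refine ⟨fun b' _ => ?_, by simp [monDeg, Finsupp.single_apply, ite_smul]⟩
  rw [Finsupp.single_apply]
  split_ifs <;> simp

end Series

/-! ### Sheaves of graded algebras -/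

/-- A sheaf of `G`-graded `ρ`-commutative `K`-algebras on `M`.  The algebra of sections is the
direct sum of its homogeneous parts, and gluing holds for homogeneous sections. -/
structure RhoSheaf {K : Type*} [RCLike K] {G : Type*} [AddCommGroup G] [DecidableEq G]
    (ρ : CommutationFactor K G) (M : Type u) [TopologicalSpace M] where
  sec : Opens M → Type w
  [ring : ∀ U, Ring (sec U)]
  [algebra : ∀ U, Algebra K (sec U)]
  deg : ∀ U, G → Submodule K (sec U)
  [graded : ∀ U, GradedAlgebra (deg U)]
  comm : ∀ U i j (f g : sec U), f ∈ deg U i → g ∈ deg U j → f * g = ρ i j • (g * f)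
  res : ∀ {U V : Opens M}, V ≤ U → sec U →ₐ[K] sec V
  res_mem : ∀ {U V : Opens M} (h : V ≤ U) i (f : sec U), f ∈ deg U i → res h f ∈ deg V i
  res_refl : ∀ U (f : sec U), res (le_refl U) f = f
  res_res : ∀ {U V W : Opens M} (h : V ≤ U) (h' : W ≤ V) (f : sec U),
    res h' (res h f) = res (h'.trans h) f
  glue : ∀ (i : G) (W : Opens M) (κ : Type u) (U : κ → Opens M) (hU : ∀ k, U k ≤ W),
    (∀ p ∈ W, ∃ k, p ∈ U k) → ∀ s : (k : κ) → sec (U k), (∀ k, s k ∈ deg (U k) i) →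
    (∀ k l, res (inf_le_left : U k ⊓ U l ≤ U k) (s k) = res (inf_le_right : U k ⊓ U l ≤ U l) (s l)) →
    ∃! f : sec W, f ∈ deg W i ∧ ∀ k, res (hU k) f = s k

attribute [instance] RhoSheaf.ring RhoSheaf.algebra RhoSheaf.graded

/-! ### Coordinate systems -/

section Coordinates

variable {𝕜 : Type*} [RCLike 𝕜] {K : Type*} [RCLike K] [NormedAlgebra 𝕜 K] {n m : ℕ}
  {r : Regularity} {M : Type u} [TopologicalSpace M] [ChartedSpace (Model 𝕜 n) M]
  [IsManifold 𝓘(𝕜, Model 𝕜 n) r.order M]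
  {G : Type*} [AddCommGroup G] [DecidableEq G] {ρ : CommutationFactor K G} {d : Fin m → G}

/-- A coordinate system on an open set: a chart of the manifold together with an isomorphism of
sheaves of graded algebras, over the domain of the chart, from `𝒪` to the formal power series
(with finitely many degrees) in indeterminates of degrees `d` with coefficients in the functions
of the manifold.  The isomorphism is given by the coefficients of a section. -/
structure Coord (𝕜 : Type*) [RCLike 𝕜] {K : Type*} [RCLike K] [NormedAlgebra 𝕜 K] (n : ℕ) {m : ℕ}
    (r : Regularity) {M : Type u} [TopologicalSpace M] [ChartedSpace (Model 𝕜 n) M]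
    [IsManifold 𝓘(𝕜, Model 𝕜 n) r.order M]
    {G : Type*} [AddCommGroup G] [DecidableEq G] {ρ : CommutationFactor K G} (d : Fin m → G)
    (𝒪 : RhoSheaf.{u, w} ρ M) where
  chart : OpenPartialHomeomorph M (Model 𝕜 n)
  chart_mem : chart ∈ IsManifold.maximalAtlas 𝓘(𝕜, Model 𝕜 n) r.order M
  dom : Opens M
  dom_eq : (dom : Set M) = chart.source
  coeff : ∀ V ≤ dom, 𝒪.sec V →ₗ[K] Series 𝕜 K n m r V
  coeff_one : ∀ V hV, coeff V hV 1 = Pi.single 0 1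
  coeff_mul : ∀ V hV f g, coeff V hV (f * g) = seriesMul ρ d (coeff V hV f) (coeff V hV g)
  coeff_res : ∀ U V (hU : U ≤ dom) (h : V ≤ U) f w,
    coeff V (h.trans hU) (𝒪.res h f) w = Fun.res h (coeff U hU f w)
  coeff_bij : ∀ V hV i, Set.BijOn (coeff V hV) (𝒪.deg V i : Set (𝒪.sec V))
    ((homog ρ d V i : Submodule K (Series 𝕜 K n m r V)) : Set (Series 𝕜 K n m r V))

namespace Coord

variable {𝒪 : RhoSheaf.{u, w} ρ M} (x : Coord 𝕜 n r d 𝒪) (V : Opens M) (hV : V ≤ x.dom)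

theorem le_source (x : Coord 𝕜 n r d 𝒪) (V : Opens M) (hV : V ≤ x.dom) : ∀ p ∈ V, p ∈ x.chart.source := fun _ hp => x.dom_eq ▸ hV hp

/-- The section with given coefficients. -/
def lift {i : G} (c : Series 𝕜 K n m r V) (hc : c ∈ homog ρ d V i) : 𝒪.sec V :=
  ((x.coeff_bij V hV i).surjOn hc).choose

theorem lift_mem {i : G} (c : Series 𝕜 K n m r V) (hc : c ∈ homog ρ d V i) :
    x.lift V hV c hc ∈ 𝒪.deg V i :=
  ((x.coeff_bij V hV i).surjOn hc).choose_spec.1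

theorem coeff_lift {i : G} (c : Series 𝕜 K n m r V) (hc : c ∈ homog ρ d V i) :
    x.coeff V hV (x.lift V hV c hc) = c :=
  ((x.coeff_bij V hV i).surjOn hc).choose_spec.2

/-- A function of the manifold as a section, by means of the coordinate system. -/
def const (f : Fun 𝕜 K n r V) : 𝒪.sec V :=
  x.lift V hV (Pi.single 0 f) (single_zero_mem ρ d f)

/-- The coordinate functions `x^1, …, x^(n+m)`. -/
def fn (a : Fin (n + m)) : 𝒪.sec V :=
  Fin.addCases
    (fun a => x.const V hV (chartCoord x.chart x.chart_mem V (x.le_source V hV) a))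
    (fun b => x.lift V hV (Pi.single (Finsupp.single b 1) 1) (single_one_mem ρ d b)) a

/-- `∂ / ∂ x^a` on coefficients. -/
def partialSeries (a : Fin (n + m)) : Series 𝕜 K n m r V →ₗ[K] Series 𝕜 K n m r V :=
  Fin.addCases
    (fun a => LinearMap.pi fun w =>
      (chartPartial x.chart x.chart_mem V (x.le_source V hV) a).comp (LinearMap.proj w))
    (fun b => formalPartial ρ d V b) a

theorem partialSeries_mem (a : Fin (n + m)) {i : G} {c : Series 𝕜 K n m r V}
    (hc : c ∈ homog ρ d V i) :
    x.partialSeries V hV a c ∈ homog ρ d V (i - coordDeg n d a) := by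
  induction a using Fin.addCases with
  | left a =>
    intro w hw
    have h : c w ≠ 0 := by
      intro h
      exact hw (by simp [partialSeries, h])
    simpa [coordDeg] using hc w h
  | right b =>
    simpa [partialSeries, coordDeg] using formalPartial_mem ρ d b hc

theorem exists_partial (a : Fin (n + m)) (f : 𝒪.sec V) :
    ∃ g : 𝒪.sec V, x.coeff V hV g = x.partialSeries V hV a (x.coeff V hV f) := by
  have key : (⊤ : Submodule K (𝒪.sec V)) ≤
      (LinearMap.range (x.coeff V hV)).comap ((x.partialSeries V hV a).comp (x.coeff V hV)) := by
    rw [← (DirectSum.Decomposition.isInternal (𝒪.deg V)).submodule_iSup_eq_top]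
    refine iSup_le fun i f hf => ?_
    have h := x.partialSeries_mem V hV a ((x.coeff_bij V hV i).mapsTo hf)
    exact ⟨x.lift V hV _ h, x.coeff_lift V hV _ h⟩
  exact key trivial

/-- The derivation `∂ / ∂ x^a`, of degree `-|x^a|`. -/
def partialDeriv (a : Fin (n + m)) (f : 𝒪.sec V) : 𝒪.sec V :=
  (x.exists_partial V hV a f).choose

/-- The Jacobian matrix of the coordinates `y` with respect to the coordinates `x` on an open set
`V`; the row index is that of `x` and the column index that of `y`, so that the chain rule
`∂ z^c / ∂ x^b = ∑ a, (∂ y^a / ∂ x^b) (∂ z^c / ∂ y^a)` is the product of matrices. -/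
def jacobian (y : Coord 𝕜 n r d 𝒪) (hV' : V ≤ y.dom) :
    Matrix (Fin (n + m)) (Fin (n + m)) (𝒪.sec V) :=
  Matrix.of fun b a => x.partialDeriv V hV b (y.fn V hV' a)

/-- The coefficients of `exp f = exp f₀ · ∑ k, f₁ ^ k / k!`, where `f = f₀ + f₁` with `f₀` a
function of the manifold and `f₁` without constant term.  Only the `k` up to the order of
the monomial contribute to its coefficient. -/
def expSeries (f : 𝒪.sec V) : Series 𝕜 K n m r V := fun w =>
  Fun.exp (x.coeff V hV f 0) * ∑ k ∈ Finset.range (w.degree + 1),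
    ((k.factorial : K)⁻¹) • x.coeff V hV ((f - x.const V hV (x.coeff V hV f 0)) ^ k) w

theorem expSeries_mem (f : 𝒪.sec V) (hf : f ∈ 𝒪.deg V 0) :
    x.expSeries V hV f ∈ homog ρ d V 0 := by
  intro w hw
  have h : ∃ k, x.coeff V hV ((f - x.const V hV (x.coeff V hV f 0)) ^ k) w ≠ 0 := by
    by_contra! h
    exact hw (by simp [expSeries, h])
  obtain ⟨k, hk⟩ := h
  have h1 : f - x.const V hV (x.coeff V hV f 0) ∈ 𝒪.deg V 0 :=
    Submodule.sub_mem _ hf (x.lift_mem V hV _ _)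
  have h2 := SetLike.pow_mem_graded k h1
  rw [smul_zero] at h2
  exact (x.coeff_bij V hV 0).mapsTo h2 w hk

/-- The exponential of a section of degree zero. -/
def exp (f : 𝒪.sec V) (hf : f ∈ 𝒪.deg V 0) : 𝒪.sec V :=
  x.lift V hV (x.expSeries V hV f) (x.expSeries_mem V hV f hf)

end Coord

/-! ### Manifolds, vector fields, volume forms -/

/-- The structure of a `ρ`-manifold with graded coordinates of degrees `d` on the manifold `M`:
a structure sheaf such that coordinate systems exist around every point. -/
structure RhoManifold (𝕜 : Type*) [RCLike 𝕜] {K : Type*} [RCLike K] [NormedAlgebra 𝕜 K] (n : ℕ)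
    {m : ℕ} (r : Regularity) (M : Type u) [TopologicalSpace M] [ChartedSpace (Model 𝕜 n) M]
    [IsManifold 𝓘(𝕜, Model 𝕜 n) r.order M]
    {G : Type*} [AddCommGroup G] [DecidableEq G] (ρ : CommutationFactor K G) (d : Fin m → G)
    extends RhoSheaf.{u, w} ρ M where
  exists_coord : ∀ p : M, ∃ x : Coord 𝕜 n r d toRhoSheaf, p ∈ x.dom

variable (𝓜 : RhoManifold.{u, w} 𝕜 n r M ρ d)

/-- A (homogeneous) vector field: a `ρ`-derivation of the structure sheaf. -/
structure VectorField {K : Type*} [RCLike K] {M : Type u} [TopologicalSpace M]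
    {G : Type*} [AddCommGroup G] [DecidableEq G] {ρ : CommutationFactor K G}
    (𝒪 : RhoSheaf.{u, w} ρ M) where
  degree : G
  app : ∀ U, 𝒪.sec U →ₗ[K] 𝒪.sec U
  app_mem : ∀ U i f, f ∈ 𝒪.deg U i → app U f ∈ 𝒪.deg U (i + degree)
  leibniz : ∀ U i (f g : 𝒪.sec U), f ∈ 𝒪.deg U i →
    app U (f * g) = app U f * g + ρ degree i • (f * app U g)
  app_res : ∀ {U V : Opens M} (h : V ≤ U) f, app V (𝒪.res h f) = 𝒪.res h (app U f)

/-- Homological vector fields: `ρ(|Q|,|Q|) = -1` and `[Q, Q]_ρ = 0`. -/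
structure VectorField.IsHomological {𝒪 : RhoSheaf.{u, w} ρ M} (Q : VectorField 𝒪) : Prop where
  odd : ρ Q.degree Q.degree = -1
  bracket : ∀ U f, Q.app U (Q.app U f) - ρ Q.degree Q.degree • Q.app U (Q.app U f) = 0

/-- A global section of the Berezinian line bundle: it is `D(x) s(x)` in the coordinates `x`, with
`D(y) = D(x) Ber (∂ y / ∂ x)` for the frames, hence `s(x) = Ber (∂ y / ∂ x) s(y)`.  The entry of
the Jacobian matrix in row `b` and column `a` has degree `(-|x^b|) - (-|x^a|)`. -/
structure BerSection where
  val : ∀ x : Coord 𝕜 n r d 𝓜.toRhoSheaf, 𝓜.sec x.dom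
  transition : ∀ x y : Coord 𝕜 n r d 𝓜.toRhoSheaf,
    𝓜.res (inf_le_left : x.dom ⊓ y.dom ≤ x.dom) (val x) =
      rhoBer ρ (fun k => -coordDeg n d k) (x.jacobian (x.dom ⊓ y.dom) inf_le_left y inf_le_right) *
        𝓜.res (inf_le_right : x.dom ⊓ y.dom ≤ y.dom) (val y)

/-- A Berezin volume form: in all coordinates `s(x)` is invertible of degree zero. -/
structure VolumeForm extends BerSection 𝓜 where
  deg_zero : ∀ x, val x ∈ 𝓜.deg x.dom 0
  isUnit : ∀ x, IsUnit (val x)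

/-- Orientability: there is a volume form. -/
def RhoManifold.Orientable : Prop := Nonempty (VolumeForm 𝓜)

variable {𝓜}

/-- `vol₂ = vol₁ · exp h` for some global function `h` of degree zero. -/
def VolumeForm.Equivalent (vol₁ vol₂ : VolumeForm 𝓜) : Prop :=
  ∃ (h : 𝓜.sec ⊤) (hh : h ∈ 𝓜.deg ⊤ 0), ∀ x : Coord 𝕜 n r d 𝓜.toRhoSheaf,
    vol₂.val x = vol₁.val x *
      x.exp x.dom le_rfl (𝓜.res le_top h) (𝓜.res_mem le_top 0 h hh)

/-- The Lie derivative `L_X (D(x) s(x)) = D(x) ∑ a, ρ(|x^a|,|x^a|+|X|) ∂_a (X^a s(x))` of a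
section of the Berezinian bundle, in the coordinates `x`, where `X^a = X(x^a)`. -/
def lieDeriv (X : VectorField 𝓜.toRhoSheaf) (s : BerSection 𝓜)
    (x : Coord 𝕜 n r d 𝓜.toRhoSheaf) : 𝓜.sec x.dom :=
  ∑ a : Fin (n + m), ρ (coordDeg n d a) (coordDeg n d a + X.degree) •
    x.partialDeriv x.dom le_rfl a (X.app x.dom (x.fn x.dom le_rfl a) * s.val x)

/-- `g` is the divergence of `X` with respect to `vol`: the global function, of degree `|X|`,
with `vol · g = L_X vol`. -/
def IsDivergence (vol : VolumeForm 𝓜) (X : VectorField 𝓜.toRhoSheaf) (g : 𝓜.sec ⊤) : Prop :=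
  g ∈ 𝓜.deg ⊤ X.degree ∧ ∀ x : Coord 𝕜 n r d 𝓜.toRhoSheaf,
    vol.val x * 𝓜.res le_top g = lieDeriv X vol.toBerSection x

/-- The `k`-cocycles of the complex with terms `𝒪(M)_(k|Q|)` and differential `Q`. -/
def cocycles (Q : VectorField 𝓜.toRhoSheaf) (k : ℤ) : Submodule K (𝓜.sec ⊤) :=
  𝓜.deg ⊤ (k • Q.degree) ⊓ LinearMap.ker (Q.app ⊤)

/-- The `k`-coboundaries. -/
def coboundaries (Q : VectorField 𝓜.toRhoSheaf) (k : ℤ) : Submodule K (𝓜.sec ⊤) :=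
  (𝓜.deg ⊤ ((k - 1) • Q.degree)).map (Q.app ⊤)

/-- The cohomology `H^k_Q(M)`. -/
abbrev Cohomology (Q : VectorField 𝓜.toRhoSheaf) (k : ℤ) : Type _ :=
  cocycles Q k ⧸ (coboundaries Q k).submoduleOf (cocycles Q k)

/-- `c` is the modular class of `Q` with respect to `vol`: the divergence of `Q` exists, is a
cocycle, and represents `c`. -/
def IsModularClass (Q : VectorField 𝓜.toRhoSheaf) (vol : VolumeForm 𝓜) (c : Cohomology Q 1) :
    Prop :=
  ∃ z : cocycles Q 1, IsDivergence vol Q z.1 ∧ Submodule.Quotient.mk z = c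

end Coordinates

end RhoGeometry

end

/-!
The Jacobian matrix `J` of a change of coordinates satisfies the twisted Leibniz rule
`X J = J P_y - P_x J`, where `P_x` is the matrix `∂_b X(x^e)` of a vector field `X`.  The graded
Jacobi formula `X (Ber J) = Ber J · tr (J⁻¹ · X J)` (`map_rhoDet`, `map_rhoBer`) and the cyclicity of
the graded trace (`rhoTrace_mul_comm`) turn this into
`X (Ber J) = Ber J · (div_y X - div_x X)` (`Coord.app_rhoBer_jacobian`), where `div_x X = tr P_x`.
In coordinates the divergence with respect to `D(x) s` is `div_x X + s⁻¹ X(s)`, so the transition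
rule of a volume form shows that these local expressions agree on overlaps, and they glue to the
divergence.

For a homological vector field `Q` both terms are closed: `Q (div_x Q)` is, up to sign, the graded
trace of the square of the odd matrix `P_x`, and the graded trace vanishes on graded commutators;
`u = s⁻¹ Q(s)` is odd, so that `Q u = -u² = 0`.  If `vol₂ = vol₁ · t`, the divergences differ by
`t⁻¹ Q(t)`.  For `t = exp h` this is `Q h` (`Coord.app_exp`).  In the real category an invertible `t`
has a local logarithm, that of the absolute value of its constant term plus a formal power series
(`Coord.exists_log`); it does not depend on the coordinates, because the constant term of a section
does not (`Coord.coeff_zero_eq`), so the local logarithms glue to a global `h`.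

The chain rule and the commutation of `X` with the partial derivatives rest on the fact that a
derivation is determined by its values on the coordinates (`Coord.app_eq_zero`).  For functions of the
manifold this follows from the expansion of order one at a point (`exists_chart_slope`), for
sections by induction on the order in the graded indeterminates (`Coord.exists_eq_const_add_sum`).
-/

open scoped Manifold ContDiff Topology
open TopologicalSpace

noncomputable section

namespace RhoGeometry

universe u v w

set_option linter.unusedSectionVars false

/-! ### Commutation factors -/

namespace CommutationFactor

variable {K G : Type*} [Field K] [AddCommGroup G] (ρ : CommutationFactor K G)

theorem ne_zero (i j : G) : ρ i j ≠ 0 := left_ne_zero_of_mul_eq_one (ρ.mul_swap i j)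

theorem swap (i j : G) : ρ j i = (ρ i j)⁻¹ := eq_inv_of_mul_eq_one_right (ρ.mul_swap i j)

theorem add_right (i j k : G) : ρ k (i + j) = ρ k i * ρ k j := by
  rw [ρ.swap (i + j) k, ρ.add_left, mul_inv, ← ρ.swap, ← ρ.swap]

@[simp] theorem zero_left (j : G) : ρ 0 j = 1 := by
  have h := ρ.add_left 0 0 j
  rw [add_zero] at h
  exact (mul_eq_left₀ (ρ.ne_zero 0 j)).1 h.symm

@[simp] theorem zero_right (j : G) : ρ j 0 = 1 := by rw [ρ.swap 0 j]; simp

theorem neg_left (i j : G) : ρ (-i) j = (ρ i j)⁻¹ :=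
  eq_inv_of_mul_eq_one_left (by rw [← ρ.add_left]; simp)

theorem neg_right (i j : G) : ρ i (-j) = (ρ i j)⁻¹ :=
  eq_inv_of_mul_eq_one_left (by rw [← ρ.add_right]; simp)

theorem sub_left (i j k : G) : ρ (i - j) k = ρ i k * (ρ j k)⁻¹ := by
  rw [sub_eq_add_neg, ρ.add_left, ρ.neg_left]

theorem sub_right (i j k : G) : ρ k (i - j) = ρ k i * (ρ k j)⁻¹ := by
  rw [sub_eq_add_neg, ρ.add_right, ρ.neg_right]

theorem sum_left {ι : Type*} (s : Finset ι) (f : ι → G) (j : G) :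
    ρ (∑ i ∈ s, f i) j = ∏ i ∈ s, ρ (f i) j := by
  classical
  induction s using Finset.induction_on with
  | empty => simp
  | insert a s ha ih => rw [Finset.sum_insert ha, Finset.prod_insert ha, ρ.add_left, ih]

theorem sum_right {ι : Type*} (s : Finset ι) (f : ι → G) (j : G) :
    ρ j (∑ i ∈ s, f i) = ∏ i ∈ s, ρ j (f i) := by
  rw [ρ.swap, sum_left, ← Finset.prod_inv_distrib]
  exact Finset.prod_congr rfl fun i _ => (ρ.swap _ _).symm

theorem nsmul_left (k : ℕ) (i j : G) : ρ (k • i) j = ρ i j ^ k := by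
  induction k with
  | zero => simp
  | succ k ih => rw [succ_nsmul, ρ.add_left, ih, pow_succ]

theorem nsmul_right (k : ℕ) (i j : G) : ρ j (k • i) = ρ j i ^ k := by
  rw [ρ.swap, nsmul_left, ρ.swap i j, inv_pow]

theorem self_mul_self (i : G) : ρ i i * ρ i i = 1 := ρ.mul_swap i i

theorem self_eq (i : G) : ρ i i = 1 ∨ ρ i i = -1 := mul_self_eq_one_iff.1 (ρ.self_mul_self i)

theorem inv_self (i : G) : (ρ i i)⁻¹ = ρ i i := (ρ.swap i i).symm

end CommutationFactor

/-! ### Products over a list and derivations -/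

section GradedAlgebra

variable {K G A : Type*} [Field K] [AddCommGroup G] [DecidableEq G] [Ring A] [Algebra K A]
  (ρ : CommutationFactor K G) (𝒜 : G → Submodule K A) [GradedAlgebra 𝒜]

/-- `ρ`-commutativity of a graded algebra. -/
def IsRhoComm : Prop := ∀ i j (f g : A), f ∈ 𝒜 i → g ∈ 𝒜 j → f * g = ρ i j • (g * f)

/-- The graded Leibniz rule for an operator of degree `q`. -/
def IsRhoLeibniz (q : G) (D : A →ₗ[K] A) : Prop :=
  ∀ i (f g : A), f ∈ 𝒜 i → D (f * g) = D f * g + ρ q i • (f * D g)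

variable {ρ 𝒜}

theorem IsRhoComm.zero_comm (hc : IsRhoComm ρ 𝒜) {j : G} {f g : A} (hf : f ∈ 𝒜 0)
    (hg : g ∈ 𝒜 j) : f * g = g * f := by
  rw [hc 0 j f g hf hg]; simp

theorem IsRhoLeibniz.map_one {q : G} {D : A →ₗ[K] A} (hD : IsRhoLeibniz ρ 𝒜 q D) : D 1 = 0 := by
  have h := hD 0 1 1 SetLike.GradedOne.one_mem
  simpa using h

variable {ι : Type*} [LinearOrder ι]

theorem list_prod_mem {g : ι → G} {f : ι → A} (hf : ∀ k, f k ∈ 𝒜 (g k)) (l : List ι)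
    (hl : l.Nodup) : (l.map f).prod ∈ 𝒜 (∑ p ∈ l.toFinset, g p) := by
  induction l with
  | nil => simpa using SetLike.GradedOne.one_mem (A := 𝒜)
  | cons a t ih =>
    rw [List.nodup_cons] at hl
    rw [List.map_cons, List.prod_cons, List.toFinset_cons, Finset.sum_insert (by simpa using hl.1)]
    exact SetLike.GradedMul.mul_mem (hf a) (ih hl.2)

theorem map_update_of_notMem [DecidableEq ι] {α : Type*} (f : ι → α) {k : ι} (x : α) {l : List ι}
    (hk : k ∉ l) : l.map (Function.update f k x) = l.map f :=
  List.map_congr_left fun p hp => Function.update_of_ne (by rintro rfl; exact hk hp) _ _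

/-- The graded Leibniz rule for an ordered product. -/
theorem leibniz_list_prod {q : G} {D : A →ₗ[K] A} (hD : IsRhoLeibniz ρ 𝒜 q D) {g : ι → G}
    {f : ι → A} (hf : ∀ k, f k ∈ 𝒜 (g k)) (l : List ι) (hl : l.Pairwise (· < ·)) :
    D (l.map f).prod = ∑ k ∈ l.toFinset, ρ q (∑ p ∈ l.toFinset with p < k, g p) •
      (l.map (Function.update f k (D (f k)))).prod := by
  induction l with
  | nil => simpa using hD.map_one
  | cons a t ih =>
    rw [List.pairwise_cons] at hl
    have ha : a ∉ t := fun h => lt_irrefl _ (hl.1 a h)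
    have ha' : a ∉ t.toFinset := by simpa using ha
    rw [List.map_cons, List.prod_cons, hD (g a) _ _ (hf a), ih hl.2, List.toFinset_cons,
      Finset.sum_insert ha', List.map_cons, List.prod_cons, Function.update_self,
      map_update_of_notMem f _ ha]
    congr 1
    · rw [Finset.filter_false_of_mem]
      · simp
      · intro p hp
        rcases Finset.mem_insert.1 hp with rfl | hp
        · simp
        · exact not_lt.2 (hl.1 p (by simpa using hp)).le
    · rw [Finset.mul_sum, Finset.smul_sum]
      refine Finset.sum_congr rfl fun k hk => ?_
      have hak : a < k := hl.1 k (by simpa using hk)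
      rw [List.map_cons, List.prod_cons, Function.update_of_ne hak.ne, Finset.filter_insert,
        if_pos hak, Finset.sum_insert (by simp [ha]), ρ.add_right, mul_smul_comm, smul_smul]

/-- A homogeneous factor is moved to the right end of an ordered product. -/
theorem list_prod_update_mul (hc : IsRhoComm ρ 𝒜) {g : ι → G} {f : ι → A}
    (hf : ∀ k, f k ∈ 𝒜 (g k)) (l : List ι) (hl : l.Pairwise (· < ·)) {k : ι} (hk : k ∈ l) (x : A)
    {e : G} {y : A} (hy : y ∈ 𝒜 e) :
    (l.map (Function.update f k (x * y))).prod = ρ e (∑ p ∈ l.toFinset with k < p, g p) •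
      ((l.map (Function.update f k x)).prod * y) := by
  induction l with
  | nil => simp at hk
  | cons a t ih =>
    rw [List.pairwise_cons] at hl
    have ha : a ∉ t := fun h => lt_irrefl _ (hl.1 a h)
    rw [List.map_cons, List.prod_cons, List.map_cons, List.prod_cons, List.toFinset_cons,
      Finset.filter_insert]
    rcases List.mem_cons.1 hk with rfl | hk
    · rw [Function.update_self, Function.update_self, map_update_of_notMem f _ ha,
        map_update_of_notMem f _ ha, if_neg (lt_irrefl _), Finset.filter_true_of_mem
          (fun p hp => hl.1 p (by simpa using hp)), mul_assoc, mul_assoc,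
        hc _ _ y _ hy (list_prod_mem hf t (hl.2.imp fun h => h.ne)), mul_smul_comm]
    · have hak : a < k := hl.1 k hk
      rw [Function.update_of_ne hak.ne, Function.update_of_ne hak.ne, if_neg hak.not_gt,
        ih hl.2 hk, mul_smul_comm, mul_assoc]

end GradedAlgebra

/-! ### The derivative of the graded determinant -/

section Det

variable {K G : Type*} [Field K] [AddCommGroup G] {ρ : CommutationFactor K G}
  {ι : Type*} [Fintype ι] [LinearOrder ι]

theorem swap_lt_swap_iff {j k : ι} (hjk : j < k) (p l : ι) :
    (p < l ∧ ¬ Equiv.swap j k p < Equiv.swap j k l) ↔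
      (p = j ∧ j < l ∧ l < k) ∨ (l = k ∧ j < p ∧ p < k) ∨ (p = j ∧ l = k) := by
  simp only [Equiv.swap_apply_def]
  split_ifs <;> grind

/-- The effect of a transposition of two positions on a product over ordered pairs. -/
theorem prod_lt_comp_swap {α : Type*} (v h : α → α → K) (hv : ∀ a b, a ≠ b → v b a = h a b * v a b)
    {f : ι → α} (hf : Function.Injective f) {j k : ι} (hjk : j < k) :
    (∏ p, ∏ l, if p < l then v (f (Equiv.swap j k p)) (f (Equiv.swap j k l)) else 1) =
      (h (f j) (f k) * ∏ p with j < p ∧ p < k, h (f j) (f p) * h (f p) (f k)) *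
      ∏ p, ∏ l, if p < l then v (f p) (f l) else 1 := by
  set s := Equiv.swap j k with hs
  have hss : ∀ p, s (s p) = p := fun p => Equiv.swap_apply_self _ _ _
  have e1 : (∏ p, ∏ l, if p < l then v (f (s p)) (f (s l)) else 1) =
      ∏ p, ∏ l, if s p < s l then v (f p) (f l) else 1 := by
    rw [← Equiv.prod_comp s]
    refine Finset.prod_congr rfl fun p _ => ?_
    rw [← Equiv.prod_comp s]
    refine Finset.prod_congr rfl fun l _ => ?_
    rw [hss, hss]
  have e2 : (∏ p, ∏ l, if s p < s l then v (f p) (f l) else 1) =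
      (∏ p, ∏ l, if p < l ∧ s p < s l then v (f p) (f l) else 1) *
      ∏ p, ∏ l, if p < l ∧ ¬ s p < s l then v (f l) (f p) else 1 := by
    rw [Finset.prod_comm (f := fun p l => if p < l ∧ ¬ s p < s l then v (f l) (f p) else 1),
      ← Finset.prod_mul_distrib]
    refine Finset.prod_congr rfl fun p _ => ?_
    rw [← Finset.prod_mul_distrib]
    refine Finset.prod_congr rfl fun l _ => ?_
    have hne : s p = s l ↔ p = l := s.injective.eq_iff
    rcases lt_trichotomy p l with h1 | h1 | h1
    · simp [h1, h1.not_gt]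
    · simp [h1]
    · rcases lt_trichotomy (s p) (s l) with h2 | h2 | h2
      · simp [h1, h2, h1.not_gt, h2.not_gt]
      · exact absurd (hne.1 h2) h1.ne'
      · simp [h1, h2, h1.not_gt, h2.not_gt]
  have e3 : (∏ p, ∏ l, if p < l ∧ ¬ s p < s l then v (f l) (f p) else 1) =
      (∏ p, ∏ l, if p < l ∧ ¬ s p < s l then h (f p) (f l) else 1) *
      ∏ p, ∏ l, if p < l ∧ ¬ s p < s l then v (f p) (f l) else 1 := by
    rw [← Finset.prod_mul_distrib]
    refine Finset.prod_congr rfl fun p _ => ?_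
    rw [← Finset.prod_mul_distrib]
    refine Finset.prod_congr rfl fun l _ => ?_
    by_cases h1 : p < l ∧ ¬ s p < s l
    · simp only [if_pos h1]
      exact hv _ _ fun h => h1.1.ne (hf h)
    · rw [if_neg h1, if_neg h1, if_neg h1, one_mul]
  have e4 : (∏ p, ∏ l, if p < l then v (f p) (f l) else 1) =
      (∏ p, ∏ l, if p < l ∧ s p < s l then v (f p) (f l) else 1) *
      ∏ p, ∏ l, if p < l ∧ ¬ s p < s l then v (f p) (f l) else 1 := by
    rw [← Finset.prod_mul_distrib]
    refine Finset.prod_congr rfl fun p _ => ?_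
    rw [← Finset.prod_mul_distrib]
    refine Finset.prod_congr rfl fun l _ => ?_
    by_cases h1 : p < l <;> by_cases h2 : s p < s l <;> simp [h1, h2]
  have e5 : (∏ p, ∏ l, if p < l ∧ ¬ s p < s l then h (f p) (f l) else 1) =
      h (f j) (f k) * ∏ p with j < p ∧ p < k, h (f j) (f p) * h (f p) (f k) := by
    have h1 : ∀ p l, (if p < l ∧ ¬ s p < s l then h (f p) (f l) else 1) =
        (if p = j then if j < l ∧ l < k then h (f j) (f l) else 1 else 1) *
        (if l = k then if j < p ∧ p < k then h (f p) (f k) else 1 else 1) *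
        (if p = j then if l = k then h (f j) (f k) else 1 else 1) := by
      intro p l
      simp only [swap_lt_swap_iff hjk, hs]
      by_cases hp : p = j <;> by_cases hl : l = k
      · subst hp hl; simp [hjk]
      · subst hp; simp [hl]
      · subst hl; simp [hp]
      · simp [hp, hl]
    simp only [h1, Finset.prod_mul_distrib]
    rw [Finset.prod_comm (f := fun p l => if l = k then if j < p ∧ p < k then h (f p) (f k) else 1 else 1)]
    simp only [Finset.prod_ite_eq', Finset.mem_univ, if_true, Finset.prod_ite_irrel,
      Finset.prod_const_one, Finset.prod_filter]
    ring
  rw [e1, e2, e3, e4, e5]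
  ring

/-- The scalar in front of the ordered product of the entries `F k (σ k)` in the graded
determinant. -/
def detCoeff (ρ : CommutationFactor K G) (I : ι → G) (σ : Equiv.Perm ι) : K :=
  (∏ k : ι, ∏ l : ι, if k < l then ρ (I (σ k)) (I l - I (σ l)) else 1) *
    ∏ k : ι, ∏ l : ι, if k < l ∧ σ l < σ k then
      -ρ (I (σ k)) (I (σ k)) * ρ (I (σ k)) (I (σ l)) else 1

theorem detCoeff_eq {I : ι → G} {ε : K} (hε : ∀ k, ρ (I k) (I k) = ε) (σ : Equiv.Perm ι) :
    detCoeff ρ I σ = (∏ p, ∏ l, if p < l then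
      (ρ (I (σ p)) (I (σ l)))⁻¹ * (if σ l < σ p then -ε * ρ (I (σ p)) (I (σ l)) else 1) else 1) *
      ∏ p, ρ (I (σ p)) (∑ l with p < l, I l) := by
  unfold detCoeff
  simp only [ρ.sum_right, Finset.prod_filter, ← Finset.prod_mul_distrib]
  refine Finset.prod_congr rfl fun p _ => Finset.prod_congr rfl fun l _ => ?_
  by_cases h : p < l
  · by_cases h' : σ l < σ p
    · simp only [h, h', if_true, and_self, ρ.sub_right, hε]; ring
    · simp only [h, h', if_true, and_false, if_false, ρ.sub_right]; ring
  · simp [h]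

/-- The scalars of `σ` and `σ * swap j k` differ by the sign `-1` and by a commutation factor. -/
theorem detCoeff_mul_swap {I : ι → G} {ε : K} (hε : ∀ k, ρ (I k) (I k) = ε) (σ : Equiv.Perm ι)
    {j k : ι} (hjk : j < k) :
    detCoeff ρ I (σ * Equiv.swap j k) * ρ (I (σ j) - I (σ k))
        (∑ p with j < p, (I p - I ((σ * Equiv.swap j k) p))) =
      -(detCoeff ρ I σ * ρ (I (σ j) - I (σ k)) (∑ p with k < p, (I p - I (σ p)))) := by
  have hε2 : ε * ε = 1 := by rw [← hε j]; exact ρ.self_mul_self _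
  have hε0 : ε ≠ 0 := left_ne_zero_of_mul_eq_one hε2
  have hv : ∀ a b : ι, a ≠ b →
      (ρ (I b) (I a))⁻¹ * (if a < b then -ε * ρ (I b) (I a) else 1) =
      (-ε * ρ (I a) (I b)) *
        ((ρ (I a) (I b))⁻¹ * (if b < a then -ε * ρ (I a) (I b) else 1)) := by
    intro a b hab
    have h1 := ρ.ne_zero (I a) (I b)
    rw [ρ.swap (I a) (I b)]
    rcases hab.lt_or_gt with h | h
    · simp only [h, h.not_gt, if_true, if_false]; field_simp
    · simp only [h, h.not_gt, if_true, if_false]; field_simp; rw [sq, hε2]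
  have key := prod_lt_comp_swap (fun a b => (ρ (I a) (I b))⁻¹ *
    (if b < a then -ε * ρ (I a) (I b) else 1)) (fun a b => -ε * ρ (I a) (I b)) hv σ.injective hjk
  have hT : (∏ p, ρ (I (σ (Equiv.swap j k p))) (∑ l with p < l, I l)) =
      (ρ (I (σ j) - I (σ k)) (∑ l with j < l, I l))⁻¹ *
        ρ (I (σ j) - I (σ k)) (∑ l with k < l, I l) *
        ∏ p, ρ (I (σ p)) (∑ l with p < l, I l) := by
    rw [← Equiv.prod_comp (Equiv.swap j k)]
    simp only [Equiv.swap_apply_self]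
    rw [← div_eq_iff (Finset.prod_ne_zero_iff.2 fun p _ => ρ.ne_zero _ _),
      ← Finset.prod_div_distrib, Fintype.prod_eq_mul j k hjk.ne]
    · simp only [Equiv.swap_apply_left, Equiv.swap_apply_right, ρ.sub_left, div_eq_mul_inv, mul_inv,
        inv_inv]
      ring
    · intro p hp
      rw [Equiv.swap_apply_of_ne_of_ne hp.1 hp.2, div_self (ρ.ne_zero _ _)]
  have hU : (∑ p with j < p, I (σ (Equiv.swap j k p))) =
      (∑ p with j < p ∧ p < k, I (σ p)) + I (σ j) + ∑ p with k < p, I (σ p) := by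
    have h1 : ∀ p, (if j < p then I (σ (Equiv.swap j k p)) else 0) =
        (if j < p ∧ p < k then I (σ p) else 0) + (if p = k then I (σ j) else 0) +
          if k < p then I (σ p) else 0 := by
      intro p
      rcases lt_trichotomy p k with h | h | h
      · by_cases h' : j < p
        · rw [Equiv.swap_apply_of_ne_of_ne h'.ne' h.ne]; simp [h, h', h.ne, h.not_gt]
        · simp [h', h.ne, h.not_gt]
      · subst h; simp [hjk]
      · rw [Equiv.swap_apply_of_ne_of_ne (hjk.trans h).ne' h.ne']
        simp [hjk.trans h, h, h.not_gt, h.ne']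
    simp only [Finset.sum_filter, h1, Finset.sum_add_distrib]
    simp
  have hP : (∏ p with j < p ∧ p < k,
      (-ε * ρ (I (σ j)) (I (σ p))) * (-ε * ρ (I (σ p)) (I (σ k)))) =
      ρ (I (σ j) - I (σ k)) (∑ p with j < p ∧ p < k, I (σ p)) := by
    rw [ρ.sum_right]
    refine Finset.prod_congr rfl fun p _ => ?_
    rw [ρ.sub_left, ← ρ.swap]
    linear_combination (ρ (I (σ j)) (I (σ p)) * ρ (I (σ p)) (I (σ k))) * hε2
  have hσ : detCoeff ρ I (σ * Equiv.swap j k) = _ :=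
    (detCoeff_eq hε _).trans (congrArg₂ (· * ·) key hT)
  rw [hσ, detCoeff_eq hε]
  simp only [Equiv.Perm.mul_apply]
  rw [hP, Finset.sum_sub_distrib, Finset.sum_sub_distrib, hU]
  set a := I (σ j)
  set b := I (σ k)
  set S := ∑ p with j < p ∧ p < k, I (σ p)
  have ha : ρ a a = ε := hε _
  simp only [ρ.sub_right, ρ.add_right]
  have h1 := ρ.ne_zero (a - b) S
  have h2 := ρ.ne_zero (a - b) (∑ p with j < p, I p)
  have h3 := ρ.ne_zero (a - b) (∑ p with k < p, I p)
  have h4 := ρ.ne_zero (a - b) (∑ p with k < p, I (σ p))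
  have h5 : ρ (a - b) a = ε * ρ a b := by rw [ρ.sub_left, ha, ρ.swap a b, inv_inv]
  have h6 := ρ.ne_zero a b
  rw [h5]
  generalize (∏ p, ∏ l, if p < l then (ρ (I (σ p)) (I (σ l)))⁻¹ *
    (if σ l < σ p then -ε * ρ (I (σ p)) (I (σ l)) else 1) else 1) = Z
  field_simp

variable {A : Type*} [Ring A] [Algebra K A] [DecidableEq G] {𝒜 : G → Submodule K A}
  [GradedAlgebra 𝒜]

theorem rhoDet_eq (I : ι → G) (F : Matrix ι ι A) :
    rhoDet ρ I F = ∑ σ : Equiv.Perm ι,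
      detCoeff ρ I σ • ((Finset.univ.sort (fun a b : ι => a ≤ b)).map fun k => F k (σ k)).prod := by
  simp only [rhoDet, detCoeff, mul_smul]

theorem rhoDet_mem {I : ι → G} {F : Matrix ι ι A} (hF : ∀ k l, F k l ∈ 𝒜 (I k - I l)) :
    rhoDet ρ I F ∈ 𝒜 0 := by
  rw [rhoDet_eq]
  refine Submodule.sum_mem _ fun σ _ => Submodule.smul_mem _ _ ?_
  have h := list_prod_mem (𝒜 := 𝒜) (g := fun k => I k - I (σ k)) (fun k => hF k (σ k))
    (Finset.univ.sort (fun a b : ι => a ≤ b)) (Finset.sort_nodup _ _)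
  rwa [Finset.sort_toFinset, Finset.sum_sub_distrib, Equiv.sum_comp σ, sub_self] at h

/-- Jacobi's formula for the graded determinant.  After the graded Leibniz rule, the terms in
which the inserted entry is not diagonal cancel in pairs, under `σ ↦ σ * swap j k`; no product of
entries has to be reordered for this. -/
theorem map_rhoDet (hc : IsRhoComm ρ 𝒜) {q : G} {D : A →ₗ[K] A} (hD : IsRhoLeibniz ρ 𝒜 q D)
    {I : ι → G} {ε : K} (hε : ∀ k, ρ (I k) (I k) = ε) {F Y : Matrix ι ι A}
    (hF : ∀ k l, F k l ∈ 𝒜 (I k - I l)) (hY : ∀ k l, Y k l ∈ 𝒜 (I k - I l + q))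
    (hFY : ∀ k l, D (F k l) = ρ q (I k) • (F * Y) k l) :
    D (rhoDet ρ I F) = rhoDet ρ I F * ∑ k, ρ q (I k) • Y k k := by
  set L : List ι := Finset.univ.sort (fun a b : ι => a ≤ b) with hL
  have hLp : L.Pairwise (· < ·) := (Finset.sortedLT_sort _).pairwise
  have hLt : L.toFinset = Finset.univ := Finset.sort_toFinset _ _
  -- `P σ k j` is the ordered product of the entries `F p (σ p)` with `F k (σ j)` at the place `k`;
  -- the factor `Y (σ j) (σ k)` that comes with it is moved to the right end, which gives `W σ k j`.
  set W : Equiv.Perm ι → ι → ι → K := fun σ k j => detCoeff ρ I σ * (ρ q (I (σ k)) *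
    ρ (I (σ j) - I (σ k)) (∑ p with k < p, (I p - I (σ p)))) with hW
  set P : Equiv.Perm ι → ι → ι → A := fun σ k j =>
    (L.map (Function.update (fun p => F p (σ p)) k (F k (σ j)))).prod with hP
  have hsum : ∀ (σ : Equiv.Perm ι) (k : ι), I k + (∑ p with p < k, (I p - I (σ p)) +
      ∑ p with k < p, (I p - I (σ p))) = I (σ k) := by
    intro σ k
    have h0 : ∑ p, (I p - I (σ p)) = 0 := by
      rw [Finset.sum_sub_distrib, Equiv.sum_comp σ, sub_self]
    have h1 : ∀ p, I p - I (σ p) = (if p < k then I p - I (σ p) else 0) +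
        (if k < p then I p - I (σ p) else 0) + if p = k then I k - I (σ k) else 0 := by
      intro p
      rcases lt_trichotomy p k with h | h | h
      · simp [h, h.not_gt, h.ne]
      · subst h; simp
      · simp [h, h.not_gt, h.ne']
    rw [Finset.sum_congr rfl fun p _ => h1 p, Finset.sum_add_distrib, Finset.sum_add_distrib,
      Finset.sum_ite_eq' Finset.univ k] at h0
    simp only [Finset.sum_filter, Finset.mem_univ, if_true] at h0 ⊢
    rw [eq_neg_of_add_eq_zero_left h0]; abel
  have hexp : D (rhoDet ρ I F) = ∑ σ, ∑ k, ∑ j, W σ k j • (P σ k j * Y (σ j) (σ k)) := by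
    rw [rhoDet_eq, map_sum]
    refine Finset.sum_congr rfl fun σ _ => ?_
    rw [map_smul, leibniz_list_prod hD (g := fun k => I k - I (σ k)) (fun k => hF k (σ k)) L hLp,
      hLt, Finset.smul_sum]
    refine Finset.sum_congr rfl fun k _ => ?_
    have hlin : (L.map (Function.update (fun p => F p (σ p)) k (D (F k (σ k))))).prod =
        ρ q (I k) • ∑ j, (L.map (Function.update (fun p => F p (σ p)) k
          (F k (σ j) * Y (σ j) (σ k)))).prod := by
      obtain ⟨l₁, l₂, hl⟩ := List.append_of_mem (a := k) (l := L) (by simp [hL])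
      have hn : L.Nodup := Finset.sort_nodup _ _
      have hu : ∀ x, (L.map (Function.update (fun p => F p (σ p)) k x)).prod =
          (l₁.map fun p => F p (σ p)).prod * x * (l₂.map fun p => F p (σ p)).prod := by
        intro x
        rw [hl, List.nodup_middle, List.nodup_cons, List.mem_append, not_or] at hn
        rw [hl, List.map_append, List.map_cons, List.prod_append, List.prod_cons,
          map_update_of_notMem _ _ hn.1.1, map_update_of_notMem _ _ hn.1.2, Function.update_self,
          mul_assoc]
      simp only [hu]
      rw [hFY, Matrix.mul_apply, ← Finset.sum_mul, ← Finset.mul_sum,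
        Equiv.sum_comp σ (fun m => F k m * Y m (σ k)), mul_smul_comm, smul_mul_assoc]
    rw [hlin, Finset.smul_sum, Finset.smul_sum, Finset.smul_sum]
    refine Finset.sum_congr rfl fun j _ => ?_
    rw [list_prod_update_mul hc (g := fun k => I k - I (σ k)) (fun k => hF k (σ k)) L hLp
      (by simp [hL]) (F k (σ j)) (hY (σ j) (σ k)), hLt]
    simp only [smul_smul]
    congr 1
    have h := congrArg (ρ q) (hsum σ k)
    rw [ρ.add_right, ρ.add_right] at h
    simp only [hW, ρ.add_left]
    linear_combination (detCoeff ρ I σ *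
      ρ (I (σ j) - I (σ k)) (∑ p with k < p, (I p - I (σ p)))) * h
  have hoff : ∑ x ∈ (Finset.univ : Finset (Equiv.Perm ι × ι × ι)) with x.2.1 ≠ x.2.2,
      W x.1 x.2.1 x.2.2 • (P x.1 x.2.1 x.2.2 * Y (x.1 x.2.2) (x.1 x.2.1)) = 0 := by
    refine Finset.sum_involution
      (fun x _ => (x.1 * Equiv.swap x.2.1 x.2.2, x.2.2, x.2.1)) ?_ ?_ ?_ ?_
    · rintro ⟨σ, k, j⟩ hx
      have hkj : k ≠ j := (Finset.mem_filter.1 hx).2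
      have hP' : P (σ * Equiv.swap k j) j k = P σ k j := by
        simp only [hP]
        congr 1
        refine List.map_congr_left fun p _ => ?_
        simp only [Function.update_apply, Equiv.Perm.mul_apply]
        by_cases h1 : p = j
        · subst h1; simp [hkj.symm]
        · by_cases h2 : p = k
          · subst h2; simp [h1]
          · simp [h1, h2, Equiv.swap_apply_of_ne_of_ne]
      have hW' : W (σ * Equiv.swap k j) j k = -W σ k j := by
        have h1 : (σ * Equiv.swap k j) j = σ k := by simp
        have h2 : (σ * Equiv.swap k j) k = σ j := by simp
        simp only [hW]
        rw [h1, h2]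
        rcases hkj.lt_or_gt with h | h
        · have := detCoeff_mul_swap hε (σ * Equiv.swap k j) h
          rw [mul_assoc, Equiv.swap_mul_self, mul_one, h1, h2] at this
          linear_combination (ρ q (I (σ k))) * this
        · have := detCoeff_mul_swap hε σ h
          rw [Equiv.swap_comm] at this
          linear_combination (ρ q (I (σ k))) * this
      simp only [hW', hP']
      simp
    · rintro ⟨σ, k, j⟩ hx _ h
      exact (Finset.mem_filter.1 hx).2 (congrArg (fun y => y.2.2) h)
    · rintro ⟨σ, k, j⟩ hx
      exact Finset.mem_filter.2 ⟨Finset.mem_univ _, (Finset.mem_filter.1 hx).2.symm⟩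
    · rintro ⟨σ, k, j⟩ hx
      simp [mul_assoc, Equiv.swap_comm j k]
  have hdiag : ∀ σ k, W σ k k • (P σ k k * Y (σ k) (σ k)) =
      (detCoeff ρ I σ • (L.map fun p => F p (σ p)).prod) * (ρ q (I (σ k)) • Y (σ k) (σ k)) := by
    intro σ k
    simp [hW, hP, smul_smul, mul_comm]
  have hsplit : ∀ σ k, (∑ j, W σ k j • (P σ k j * Y (σ j) (σ k))) =
      (∑ j, if k ≠ j then W σ k j • (P σ k j * Y (σ j) (σ k)) else 0) +
        W σ k k • (P σ k k * Y (σ k) (σ k)) := by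
    intro σ k
    rw [← Finset.sum_filter_add_sum_filter_not Finset.univ (fun j => k ≠ j), Finset.sum_filter]
    congr 1
    simp [Finset.filter_eq]
  rw [hexp]
  simp only [hsplit, Finset.sum_add_distrib]
  rw [Finset.sum_filter, Fintype.sum_prod_type] at hoff
  simp only [Fintype.sum_prod_type] at hoff
  rw [hoff, zero_add, rhoDet_eq, Finset.sum_mul]
  refine Finset.sum_congr rfl fun σ _ => ?_
  rw [← Equiv.sum_comp σ (fun k => ρ q (I k) • Y k k), Finset.mul_sum]
  exact Finset.sum_congr rfl fun k _ => hdiag σ k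

end Det

/-! ### The graded trace and the derivative of the Berezinian -/

section Berezinian

variable {K G A : Type*} [Field K] [AddCommGroup G] [DecidableEq G] [Ring A] [Algebra K A]
  {ρ : CommutationFactor K G} {𝒜 : G → Submodule K A} [GradedAlgebra 𝒜]

theorem IsRhoComm.zero_comm_all (hc : IsRhoComm ρ 𝒜) {f : A} (hf : f ∈ 𝒜 0) (g : A) :
    f * g = g * f := by
  induction g using DirectSum.Decomposition.inductionOn 𝒜 with
  | zero => simp
  | homogeneous g => exact hc.zero_comm hf g.2
  | add g g' h h' => rw [mul_add, add_mul, h, h']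

/-- The component of degree zero of a right inverse is a right inverse. -/
theorem inverse_mem_zero {f g : A} (hf : f ∈ 𝒜 0) (hfg : f * g = 1) (hgf : g * f = 1) :
    g ∈ 𝒜 0 := by
  have h2 : f * (DirectSum.decompose 𝒜 g 0 : A) = 1 := by
    rw [← DirectSum.coe_decompose_mul_of_left_mem_zero 𝒜 hf, hfg]
    exact DirectSum.decompose_of_mem_same 𝒜 SetLike.GradedOne.one_mem
  rw [left_inv_eq_right_inv hgf h2]
  exact SetLike.coe_mem _

variable {α β : Type*} [Fintype α] [Fintype β]

/-- The inverse of a matrix of degree zero has degree zero. -/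
theorem matrix_inverse_mem [DecidableEq β] {I : β → G} {F H : Matrix β β A}
    (hF : ∀ k l, F k l ∈ 𝒜 (I k - I l)) (hFH : F * H = 1) (hHF : H * F = 1) (k l : β) :
    H k l ∈ 𝒜 (I k - I l) := by
  have h : F * Matrix.of (fun k l => (DirectSum.decompose 𝒜 (H k l) (I k - I l) : A)) = 1 := by
    ext k l
    have h1 := congrArg (fun M : Matrix β β A => (DirectSum.decompose 𝒜 (M k l) (I k - I l) : A)) hFH
    simp only [Matrix.mul_apply, DirectSum.decompose_sum] at h1
    erw [DFinsupp.finsetSum_apply] at h1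
    rw [AddSubmonoidClass.coe_finsetSum] at h1
    rw [Matrix.mul_apply]
    refine Eq.trans (Finset.sum_congr rfl fun m _ => ?_) (h1.trans ?_)
    · have h2 := DirectSum.coe_decompose_mul_add_of_left_mem 𝒜 (i := I k - I m) (j := I m - I l)
        (b := H m l) (hF k m)
      rw [sub_add_sub_cancel] at h2
      exact h2.symm
    · by_cases hkl : k = l
      · subst hkl
        rw [Matrix.one_apply_eq, sub_self]
        exact DirectSum.decompose_of_mem_same 𝒜 SetLike.GradedOne.one_mem
      · rw [Matrix.one_apply_ne hkl]; simp
  rw [left_inv_eq_right_inv hHF h]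
  exact SetLike.coe_mem _

theorem matrix_mul_mem {γ : Type*} {I : α → G} {J : β → G} {L : γ → G} {a b : G}
    {F : Matrix α β A} {H : Matrix β γ A} (hF : ∀ k l, F k l ∈ 𝒜 (I k - J l + a))
    (hH : ∀ k l, H k l ∈ 𝒜 (J k - L l + b)) (k : α) (l : γ) :
    (F * H) k l ∈ 𝒜 (I k - L l + (a + b)) := by
  rw [Matrix.mul_apply]
  refine Submodule.sum_mem _ fun m _ => ?_
  have h := SetLike.GradedMul.mul_mem (hF k m) (hH m l)
  rwa [show I k - J m + a + (J m - L l + b) = I k - L l + (a + b) by abel] at h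

theorem matrix_mul_mem_zero {γ : Type*} {I : α → G} {J : β → G} {L : γ → G}
    {F : Matrix α β A} {H : Matrix β γ A} (hF : ∀ k l, F k l ∈ 𝒜 (I k - J l))
    (hH : ∀ k l, H k l ∈ 𝒜 (J k - L l)) (k : α) (l : γ) : (F * H) k l ∈ 𝒜 (I k - L l) := by
  have h := matrix_mul_mem (𝒜 := 𝒜) (I := I) (J := J) (L := L) (a := 0) (b := 0) (F := F) (H := H)
    (by simpa using hF) (by simpa using hH) k l
  simpa using h

/-- The graded trace, on matrices with entries `M k l` of degree `I k - I l + q`. -/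
def rhoTrace (ρ : CommutationFactor K G) (I : α → G) (q : G) (M : Matrix α α A) : A :=
  ∑ k, (ρ (I k) (I k) * ρ q (I k)) • M k k

theorem rhoTrace_add (I : α → G) (q : G) (M N : Matrix α α A) :
    rhoTrace ρ I q (M + N) = rhoTrace ρ I q M + rhoTrace ρ I q N := by
  simp [rhoTrace, Finset.sum_add_distrib]

theorem rhoTrace_sub (I : α → G) (q : G) (M N : Matrix α α A) :
    rhoTrace ρ I q (M - N) = rhoTrace ρ I q M - rhoTrace ρ I q N := by
  simp [rhoTrace, smul_sub]

/-- The graded trace vanishes on graded commutators. -/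
theorem rhoTrace_mul_comm (hc : IsRhoComm ρ 𝒜) {I : α → G} {J : β → G} {a b : G}
    {M : Matrix α β A} {N : Matrix β α A} (hM : ∀ k l, M k l ∈ 𝒜 (I k - J l + a))
    (hN : ∀ k l, N k l ∈ 𝒜 (J k - I l + b)) :
    rhoTrace ρ I (a + b) (M * N) = ρ a b • rhoTrace ρ J (a + b) (N * M) := by
  simp only [rhoTrace, Matrix.mul_apply, Finset.smul_sum]
  rw [Finset.sum_comm]
  refine Finset.sum_congr rfl fun l _ => Finset.sum_congr rfl fun k _ => ?_
  rw [hc _ _ _ _ (hM k l) (hN l k), smul_smul, smul_smul]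
  congr 1
  simp only [ρ.add_left, ρ.add_right, ρ.sub_left, ρ.sub_right]
  have h1 := ρ.self_mul_self (I k)
  have h2 := ρ.self_mul_self (J l)
  rw [ρ.swap (I k) (J l), ρ.inv_self, ρ.swap (I k) b, ρ.swap b (J l)]
  have := ρ.ne_zero (I k) (J l)
  have := ρ.ne_zero (I k) b
  have := ρ.ne_zero a (J l)
  have := ρ.ne_zero a (I k)
  have := ρ.ne_zero b (J l)
  have := ρ.ne_zero (J l) (J l)
  field_simp
  linear_combination ρ a b * (h1 - h2)

/-- `F'` is the twisted derivative of the matrix `F` by the operator `D` of degree `q`.  The twist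
makes the derivative of a product of matrices obey the ungraded Leibniz rule. -/
def HasMatrixDeriv (ρ : CommutationFactor K G) (q : G) (D : A →ₗ[K] A) (I : α → G)
    (F F' : Matrix α β A) : Prop :=
  ∀ k l, D (F k l) = ρ q (I k) • F' k l

theorem HasMatrixDeriv.mul {γ : Type*} {q : G} {D : A →ₗ[K] A} (hD : IsRhoLeibniz ρ 𝒜 q D)
    {I : α → G} {J : β → G} {F F' : Matrix α β A} {H H' : Matrix β γ A}
    (hF : ∀ k l, F k l ∈ 𝒜 (I k - J l)) (h : HasMatrixDeriv ρ q D I F F')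
    (h' : HasMatrixDeriv ρ q D J H H') : HasMatrixDeriv ρ q D I (F * H) (F' * H + F * H') := by
  intro k l
  simp only [Matrix.mul_apply, Matrix.add_apply, map_sum, Finset.smul_sum, smul_add,
    ← Finset.sum_add_distrib]
  refine Finset.sum_congr rfl fun m _ => ?_
  rw [hD _ _ _ (hF k m), h k m, h' m l, smul_mul_assoc, mul_smul_comm, smul_smul, ← ρ.add_right,
    sub_add_cancel]

theorem HasMatrixDeriv.sub {q : G} {D : A →ₗ[K] A} {I : α → G} {F F' H H' : Matrix α β A}
    (h : HasMatrixDeriv ρ q D I F F') (h' : HasMatrixDeriv ρ q D I H H') :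
    HasMatrixDeriv ρ q D I (F - H) (F' - H') := by
  intro k l
  rw [Matrix.sub_apply, map_sub, h k l, h' k l, Matrix.sub_apply, smul_sub]

theorem HasMatrixDeriv.inverse [DecidableEq β] {q : G} {D : A →ₗ[K] A}
    (hD : IsRhoLeibniz ρ 𝒜 q D) {I : β → G} {F F' H : Matrix β β A}
    (hF : ∀ k l, F k l ∈ 𝒜 (I k - I l)) (h : HasMatrixDeriv ρ q D I F F')
    (hFH : F * H = 1) (hHF : H * F = 1) : HasMatrixDeriv ρ q D I H (-(H * F' * H)) := by
  set H' : Matrix β β A := Matrix.of fun k l => (ρ q (I k))⁻¹ • D (H k l) with hH'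
  have h' : HasMatrixDeriv ρ q D I H H' := fun k l => by
    rw [hH', Matrix.of_apply, smul_inv_smul₀ (ρ.ne_zero _ _)]
  have h1 : F' * H + F * H' = 0 := by
    ext k l
    have h2 := (h.mul hD hF h') k l
    rw [hFH] at h2
    have h3 : D ((1 : Matrix β β A) k l) = 0 := by
      by_cases hkl : k = l
      · rw [hkl, Matrix.one_apply_eq, hD.map_one]
      · rw [Matrix.one_apply_ne hkl, map_zero]
    rw [h3] at h2
    exact ((smul_eq_zero_iff_right (ρ.ne_zero _ _)).1 h2.symm)
  have h2 : H' = -(H * F' * H) := by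
    rw [Matrix.mul_assoc, ← Matrix.mul_neg, eq_neg_of_add_eq_zero_left h1, neg_neg,
      ← Matrix.mul_assoc, hHF, Matrix.one_mul]
  rwa [← h2]

/-- If the logarithmic derivative of a block matrix is `Y`, the one of its Schur complement is
`Y₀₀ - Y₀₁ F₁₁⁻¹ F₁₀`. -/
theorem HasMatrixDeriv.schur [DecidableEq β] {q : G} {D : A →ₗ[K] A}
    (hD : IsRhoLeibniz ρ 𝒜 q D) {I : α → G} {J : β → G}
    {F₀₀ Y₀₀ : Matrix α α A} {F₀₁ Y₀₁ : Matrix α β A} {F₁₀ Y₁₀ : Matrix β α A}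
    {F₁₁ Y₁₁ H : Matrix β β A}
    (hF₀₁ : ∀ k l, F₀₁ k l ∈ 𝒜 (I k - J l)) (hF₁₁ : ∀ k l, F₁₁ k l ∈ 𝒜 (J k - J l))
    (hFH : F₁₁ * H = 1) (hHF : H * F₁₁ = 1)
    (h₀₀ : HasMatrixDeriv ρ q D I F₀₀ (F₀₀ * Y₀₀ + F₀₁ * Y₁₀))
    (h₀₁ : HasMatrixDeriv ρ q D I F₀₁ (F₀₀ * Y₀₁ + F₀₁ * Y₁₁))
    (h₁₀ : HasMatrixDeriv ρ q D J F₁₀ (F₁₀ * Y₀₀ + F₁₁ * Y₁₀))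
    (h₁₁ : HasMatrixDeriv ρ q D J F₁₁ (F₁₀ * Y₀₁ + F₁₁ * Y₁₁)) :
    HasMatrixDeriv ρ q D I (F₀₀ - F₀₁ * H * F₁₀)
      ((F₀₀ - F₀₁ * H * F₁₀) * (Y₀₀ - Y₀₁ * (H * F₁₀))) := by
  have hH := h₁₁.inverse hD hF₁₁ hFH hHF
  have hHm := matrix_inverse_mem hF₁₁ hFH hHF
  have h1 := matrix_mul_mem_zero hF₀₁ hHm
  have key := h₀₀.sub ((h₀₁.mul hD hF₀₁ hH).mul hD h1 h₁₀)
  convert key using 1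
  have e1 : ∀ X : Matrix β α A, H * (F₁₁ * X) = X := fun X => by
    rw [← Matrix.mul_assoc, hHF, Matrix.one_mul]
  have e2 : ∀ X : Matrix β β A, H * (F₁₁ * X) = X := fun X => by
    rw [← Matrix.mul_assoc, hHF, Matrix.one_mul]
  simp only [Matrix.mul_add, Matrix.add_mul, Matrix.mul_sub, Matrix.sub_mul, Matrix.mul_neg,
    Matrix.neg_mul, Matrix.mul_assoc, e1, e2]
  abel

/-- The derivative of the Berezinian: with `Y` the logarithmic derivative of the matrix, the
logarithmic derivative of its Berezinian is the graded trace of `Y`.  The traces of the off-diagonal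
corrections to the logarithmic derivatives of the Schur complement and of `F₁₁` cancel by the
cyclicity of the graded trace. -/
theorem map_berezinian_blocks [LinearOrder α] [LinearOrder β] [inst : DecidableEq β]
    (hc : IsRhoComm ρ 𝒜) {q : G} {D : A →ₗ[K] A}
    (hD : IsRhoLeibniz ρ 𝒜 q D) {I : α → G} {J : β → G}
    (hI : ∀ k, ρ (I k) (I k) = 1) (hJ : ∀ k, ρ (J k) (J k) = -1)
    {F₀₀ Y₀₀ : Matrix α α A} {F₀₁ Y₀₁ : Matrix α β A} {F₁₀ Y₁₀ : Matrix β α A}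
    {F₁₁ Y₁₁ : Matrix β β A}
    (hF₀₀ : ∀ k l, F₀₀ k l ∈ 𝒜 (I k - I l)) (hF₀₁ : ∀ k l, F₀₁ k l ∈ 𝒜 (I k - J l))
    (hF₁₀ : ∀ k l, F₁₀ k l ∈ 𝒜 (J k - I l)) (hF₁₁ : ∀ k l, F₁₁ k l ∈ 𝒜 (J k - J l))
    (hY₀₀ : ∀ k l, Y₀₀ k l ∈ 𝒜 (I k - I l + q)) (hY₀₁ : ∀ k l, Y₀₁ k l ∈ 𝒜 (I k - J l + q))
    (hY₁₁ : ∀ k l, Y₁₁ k l ∈ 𝒜 (J k - J l + q))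
    (hU : IsUnit F₁₁) (hdet : IsUnit (rhoDet ρ J F₁₁))
    (h₀₀ : HasMatrixDeriv ρ q D I F₀₀ (F₀₀ * Y₀₀ + F₀₁ * Y₁₀))
    (h₀₁ : HasMatrixDeriv ρ q D I F₀₁ (F₀₀ * Y₀₁ + F₀₁ * Y₁₁))
    (h₁₀ : HasMatrixDeriv ρ q D J F₁₀ (F₁₀ * Y₀₀ + F₁₁ * Y₁₀))
    (h₁₁ : HasMatrixDeriv ρ q D J F₁₁ (F₁₀ * Y₀₁ + F₁₁ * Y₁₁)) :
    D (rhoDet ρ I (F₀₀ - F₀₁ * Ring.inverse F₁₁ * F₁₀) * Ring.inverse (rhoDet ρ J F₁₁)) =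
      rhoDet ρ I (F₀₀ - F₀₁ * Ring.inverse F₁₁ * F₁₀) * Ring.inverse (rhoDet ρ J F₁₁) *
        (rhoTrace ρ I q Y₀₀ + rhoTrace ρ J q Y₁₁) := by
  set H := Ring.inverse F₁₁
  have hFH : F₁₁ * H = 1 := Ring.mul_inverse_cancel _ hU
  have hHF : H * F₁₁ = 1 := Ring.inverse_mul_cancel _ hU
  have hHm := matrix_inverse_mem hF₁₁ hFH hHF
  have hHFm : ∀ k l, (H * F₁₀) k l ∈ 𝒜 (J k - I l + 0) := fun k l => by
    rw [add_zero]; exact matrix_mul_mem_zero hHm hF₁₀ k l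
  have hSm : ∀ k l, (F₀₀ - F₀₁ * H * F₁₀) k l ∈ 𝒜 (I k - I l) := fun k l =>
    Submodule.sub_mem _ (hF₀₀ k l)
      (matrix_mul_mem_zero (matrix_mul_mem_zero hF₀₁ hHm) hF₁₀ k l)
  have hS := map_rhoDet hc hD hI hSm (Y := Y₀₀ - Y₀₁ * (H * F₁₀)) (fun k l => by
    have := matrix_mul_mem hY₀₁ hHFm k l
    rw [add_zero] at this
    exact Submodule.sub_mem _ (hY₀₀ k l) this)
    (HasMatrixDeriv.schur hD hF₀₁ hF₁₁ hFH hHF h₀₀ h₀₁ h₁₀ h₁₁)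
  have hT := map_rhoDet hc hD hJ hF₁₁ (Y := H * F₁₀ * Y₀₁ + Y₁₁) (fun k l => by
    have := matrix_mul_mem hHFm hY₀₁ k l
    rw [zero_add] at this
    exact Submodule.add_mem _ this (hY₁₁ k l)) (fun k l => by
      rw [h₁₁ k l, Matrix.mul_add, ← Matrix.mul_assoc, ← Matrix.mul_assoc, hFH, Matrix.one_mul])
  set S := rhoDet ρ I (F₀₀ - F₀₁ * H * F₁₀)
  set T := rhoDet ρ J F₁₁
  have hSmem : S ∈ 𝒜 0 := rhoDet_mem hSm
  have hTmem : T ∈ 𝒜 0 := rhoDet_mem hF₁₁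
  have hT1 : T * Ring.inverse T = 1 := Ring.mul_inverse_cancel _ hdet
  have hT2 : Ring.inverse T * T = 1 := Ring.inverse_mul_cancel _ hdet
  have hTi : Ring.inverse T ∈ 𝒜 0 := inverse_mem_zero hTmem hT1 hT2
  have eS : (∑ k, ρ q (I k) • (Y₀₀ - Y₀₁ * (H * F₁₀)) k k) =
      rhoTrace ρ I q (Y₀₀ - Y₀₁ * (H * F₁₀)) := by
    simp only [rhoTrace, hI, one_mul]
  have eT : (∑ k, ρ q (J k) • (H * F₁₀ * Y₀₁ + Y₁₁) k k) =
      -rhoTrace ρ J q (H * F₁₀ * Y₀₁ + Y₁₁) := by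
    simp only [rhoTrace, hJ, neg_mul, one_mul, neg_smul, Finset.sum_neg_distrib, neg_neg]
  rw [eS] at hS
  rw [eT] at hT
  have hcyc := rhoTrace_mul_comm hc hY₀₁ hHFm
  rw [add_zero, ρ.zero_right, one_smul] at hcyc
  rw [rhoTrace_sub, hcyc] at hS
  rw [rhoTrace_add] at hT
  set t := rhoTrace ρ J q (H * F₁₀ * Y₀₁)
  have hDT : D (Ring.inverse T) = Ring.inverse T * (t + rhoTrace ρ J q Y₁₁) := by
    have h1 := hD 0 T (Ring.inverse T) hTmem
    rw [hT1, hD.map_one, ρ.zero_right, one_smul, hT] at h1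
    have h2 : T * D (Ring.inverse T) = T * ((t + rhoTrace ρ J q Y₁₁) * Ring.inverse T) := by
      rw [eq_neg_of_add_eq_zero_right h1.symm, mul_neg, neg_mul, neg_neg, mul_assoc]
    rw [hc.zero_comm_all hTi, ← one_mul (D _), ← hT2, mul_assoc, h2, ← mul_assoc, hT2, one_mul]
  rw [hD 0 S _ hSmem, ρ.zero_right, one_smul, hS, hDT, mul_assoc S, ← hc.zero_comm_all hTi,
    mul_assoc S, ← mul_add S, ← mul_add]
  congr 2
  abel

/-- The derivative of the Berezinian of a matrix of degree zero.  If the Berezinian is a unit, it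
is given by the formula in blocks and the determinant of the odd block is a unit. -/
theorem map_rhoBer {ι : Type*} [Fintype ι] [LinearOrder ι] (hc : IsRhoComm ρ 𝒜) {q : G}
    {D : A →ₗ[K] A} (hD : IsRhoLeibniz ρ 𝒜 q D) {I : ι → G} {F Y : Matrix ι ι A}
    (hF : ∀ k l, F k l ∈ 𝒜 (I k - I l)) (hY : ∀ k l, Y k l ∈ 𝒜 (I k - I l + q))
    (hFY : HasMatrixDeriv ρ q D I F (F * Y)) (hU : IsUnit (rhoBer ρ I F)) :
    D (rhoBer ρ I F) = rhoBer ρ I F * rhoTrace ρ I q Y := by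
  classical
  rcases subsingleton_or_nontrivial A with hA | hA
  · exact Subsingleton.elim _ _
  unfold rhoBer at hU ⊢
  simp only at hU ⊢
  split_ifs at hU ⊢ with hinv
  swap
  · exact absurd hU not_isUnit_zero
  have hdet : IsUnit (rhoDet ρ (fun k : OddIdx ρ I => I k)
      (F.submatrix Subtype.val Subtype.val)) := by
    by_contra h
    rw [Ring.inverse_non_unit _ h, mul_zero] at hU
    exact not_isUnit_zero hU
  have hsum : ∀ {P Q : ι → Prop} (k : Subtype P) (l : Subtype Q),
      (F * Y) k l = (((F.submatrix (Subtype.val : Subtype P → ι) (Subtype.val : EvenIdx ρ I → ι)) *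
          (Y.submatrix Subtype.val (Subtype.val : Subtype Q → ι)) +
        (F.submatrix (Subtype.val : Subtype P → ι) (Subtype.val : OddIdx ρ I → ι)) *
          (Y.submatrix Subtype.val (Subtype.val : Subtype Q → ι)) :
          Matrix (Subtype P) (Subtype Q) A)) k l := by
    intro P Q k l
    simp only [Matrix.mul_apply, Matrix.add_apply]
    exact (Fintype.sum_subtype_add_sum_subtype (fun k => ρ (I k) (I k) = 1)
      (fun m => F k m * Y m l)).symm
  have htr : rhoTrace ρ I q Y =
      rhoTrace ρ (fun k : EvenIdx ρ I => I k) q (Y.submatrix Subtype.val Subtype.val) +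
      rhoTrace ρ (fun k : OddIdx ρ I => I k) q (Y.submatrix Subtype.val Subtype.val) := by
    simp only [rhoTrace, Matrix.submatrix_apply]
    exact (Fintype.sum_subtype_add_sum_subtype (fun k => ρ (I k) (I k) = 1)
      (fun k => (ρ (I k) (I k) * ρ q (I k)) • Y k k)).symm
  rw [htr]
  refine map_berezinian_blocks hc hD (fun k => k.2) (fun k => (ρ.self_eq _).resolve_left k.2)
    (fun k l => hF _ _) (fun k l => hF _ _) (fun k l => hF _ _) (fun k l => hF _ _)
    (fun k l => hY _ _) (Y₀₁ := Y.submatrix Subtype.val Subtype.val) (fun k l => hY _ _)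
    (Y₁₀ := Y.submatrix Subtype.val Subtype.val)
    (fun k l => hY _ _) hinv.2 hdet ?_ ?_ ?_ ?_ <;>
  · intro k l
    exact (hFY _ _).trans (congrArg _ (hsum k l))

end Berezinian

/-! ### Partial derivatives of functions in a chart -/

section Functions

variable {𝕜 : Type*} [RCLike 𝕜] {K : Type*} [RCLike K] [NormedAlgebra 𝕜 K] {n : ℕ}
  {r : Regularity} {M : Type*} [TopologicalSpace M] [ChartedSpace (Model 𝕜 n) M]

theorem extendZero_apply {V : Opens M} (f : V → K) (p : V) : extendZero f p.1 = f p :=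
  Subtype.val_injective.extend_apply f 0 p

variable [IsManifold 𝓘(𝕜, Model 𝕜 n) r.order M]
  (φ : OpenPartialHomeomorph M (Model 𝕜 n))
  (hφ : φ ∈ IsManifold.maximalAtlas 𝓘(𝕜, Model 𝕜 n) r.order M)
  (V : Opens M) (hV : ∀ p ∈ V, p ∈ φ.source)

theorem Regularity.order_ne_zero (r : Regularity) : r.order ≠ 0 := by
  cases r <;> simp [Regularity.order]

theorem eventually_symm_mem (hV : ∀ p ∈ V, p ∈ φ.source) (p : V) :
    ∀ᶠ e in 𝓝 (φ p.1), e ∈ φ.target ∧ φ.symm e ∈ V := by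
  have hp := hV _ p.2
  have h1 : Filter.Tendsto φ.symm (𝓝 (φ p.1)) (𝓝 p.1) := by
    have := φ.continuousAt_symm (φ.map_source hp)
    rwa [ContinuousAt, φ.left_inv hp] at this
  exact (φ.open_target.eventually_mem (φ.map_source hp)).and (h1 (V.2.mem_nhds p.2))

theorem hasFDerivAt_extendZero
    (hφ : φ ∈ IsManifold.maximalAtlas 𝓘(𝕜, Model 𝕜 n) r.order M)
    (hV : ∀ p ∈ V, p ∈ φ.source) (f : Fun 𝕜 K n r V) (p : V) :
    HasFDerivAt (extendZero f.1 ∘ φ.symm) (fderiv 𝕜 (extendZero f.1 ∘ φ.symm) (φ p.1)) (φ p.1) :=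
  ((extendZero_contDiffAt φ hφ V hV f p).differentiableAt r.order_ne_zero).hasFDerivAt

theorem chartPartial_apply (a : Fin n) (f : Fun 𝕜 K n r V) (p : V) :
    (chartPartial φ hφ V hV a f).1 p =
      fderiv 𝕜 (extendZero f.1 ∘ φ.symm) (φ p.1) (EuclideanSpace.single a 1) := rfl

/-- The partial derivative is computed with any function that represents `f` near the point. -/
theorem chartPartial_eq_of_hasFDerivAt {a : Fin n} {f : Fun 𝕜 K n r V} {p : V}
    {F : Model 𝕜 n → K} {F' : Model 𝕜 n →L[𝕜] K} (hF : HasFDerivAt F F' (φ p.1))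
    (h : ∀ e ∈ φ.target, ∀ he : φ.symm e ∈ V, f.1 ⟨φ.symm e, he⟩ = F e) :
    (chartPartial φ hφ V hV a f).1 p = F' (EuclideanSpace.single a 1) := by
  have h1 : extendZero f.1 ∘ φ.symm =ᶠ[𝓝 (φ p.1)] F := by
    filter_upwards [eventually_symm_mem φ V hV p] with e he
    rw [Function.comp_apply, ← h e he.1 he.2]
    exact extendZero_apply f.1 ⟨φ.symm e, he.2⟩
  rw [chartPartial_apply, (hF.congr_of_eventuallyEq h1).fderiv]

theorem extendZero_symm_apply {f : V → K} {e : Model 𝕜 n} (he : φ.symm e ∈ V) :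
    (extendZero f ∘ φ.symm) e = f ⟨φ.symm e, he⟩ := extendZero_apply f ⟨φ.symm e, he⟩

theorem extendZero_comp_apply_point (f : V → K) (p : V) (hp : p.1 ∈ φ.source) :
    (extendZero f ∘ φ.symm) (φ p.1) = f p := by
  rw [Function.comp_apply, φ.left_inv hp, extendZero_apply]

theorem chartPartial_mul (a : Fin n) (f g : Fun 𝕜 K n r V) :
    chartPartial φ hφ V hV a (f * g) =
      chartPartial φ hφ V hV a f * g + f * chartPartial φ hφ V hV a g := by
  ext p
  have h := chartPartial_eq_of_hasFDerivAt φ hφ V hV (a := a) (f := f * g) (p := p)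
    ((hasFDerivAt_extendZero φ V hφ hV f p).mul (hasFDerivAt_extendZero φ V hφ hV g p))
    (fun e _ he => by
      change f.1 _ * g.1 _ = _
      rw [Pi.mul_apply, extendZero_symm_apply φ V he, extendZero_symm_apply φ V he])
  refine h.trans ?_
  rw [extendZero_comp_apply_point φ V _ _ (hV _ p.2), extendZero_comp_apply_point φ V _ _ (hV _ p.2)]
  simp only [_root_.add_apply, _root_.smul_apply, smul_eq_mul]
  change _ = (chartPartial φ hφ V hV a f).1 p * g.1 p + f.1 p * (chartPartial φ hφ V hV a g).1 p
  rw [chartPartial_apply, chartPartial_apply]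
  ring

/-- The chain rule for the composition with a function of the field of values. -/
theorem chartPartial_comp (a : Fin n) (f g f' : Fun 𝕜 K n r V) {θ : K → K}
    (hg : ∀ p, g.1 p = θ (f.1 p)) (hf' : ∀ p, HasDerivAt θ (f'.1 p) (f.1 p)) :
    chartPartial φ hφ V hV a g = f' * chartPartial φ hφ V hV a f := by
  ext p
  have h1 : HasFDerivAt θ ((ContinuousLinearMap.toSpanSingleton K (f'.1 p)).restrictScalars 𝕜)
      ((extendZero f.1 ∘ φ.symm) (φ p.1)) := by
    rw [extendZero_comp_apply_point φ V _ _ (hV _ p.2)]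
    exact (hf' p).hasFDerivAt.restrictScalars 𝕜
  have h := chartPartial_eq_of_hasFDerivAt φ hφ V hV (a := a) (f := g) (p := p)
    (h1.comp _ (hasFDerivAt_extendZero φ V hφ hV f p))
    (fun e _ he => by
      rw [hg, Function.comp_apply, extendZero_symm_apply φ V he])
  refine h.trans ?_
  change _ = f'.1 p * (chartPartial φ hφ V hV a f).1 p
  rw [chartPartial_apply]
  simp [mul_comm]

theorem chartPartial_res {W : Opens M} (hWV : W ≤ V) (a : Fin n) (f : Fun 𝕜 K n r V) :
    chartPartial φ hφ W (fun p hp => hV p (hWV hp)) a (Fun.res hWV f) =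
      Fun.res hWV (chartPartial φ hφ V hV a f) := by
  ext p
  exact chartPartial_eq_of_hasFDerivAt φ hφ W _ (a := a) (f := Fun.res hWV f) (p := p)
    (hasFDerivAt_extendZero φ V hφ hV f ⟨p.1, hWV p.2⟩)
    (fun e _ he => by rw [extendZero_symm_apply φ V (hWV he)]; rfl)

theorem chartPartial_chartCoord (a b : Fin n) :
    chartPartial (K := K) φ hφ V hV a (chartCoord φ hφ V hV b) = if a = b then 1 else 0 := by
  ext p
  have h := chartPartial_eq_of_hasFDerivAt φ hφ V hV (a := a) (p := p)
    (f := chartCoord (K := K) φ hφ V hV b)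
    (((Algebra.linearMap 𝕜 K).toContinuousLinearMap.comp
        (EuclideanSpace.proj b : Model 𝕜 n →L[𝕜] 𝕜)).hasFDerivAt)
    (fun e he hev => by
      change algebraMap 𝕜 K (φ (φ.symm e) b) = algebraMap 𝕜 K (e b)
      rw [φ.right_inv he])
  refine h.trans ?_
  by_cases hab : a = b
  · subst hab; simp
  · simp [hab, Ne.symm hab]

theorem Fun.res_smul {W : Opens M} (h : W ≤ V) (c : K) (f : Fun 𝕜 K n r V) :
    Fun.res h (c • f) = c • Fun.res h f := rfl

@[simp] theorem Fun.res_zero {W : Opens M} (h : W ≤ V) :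
    Fun.res h (0 : Fun 𝕜 K n r V) = 0 := rfl

@[simp] theorem Fun.res_one {W : Opens M} (h : W ≤ V) :
    Fun.res h (1 : Fun 𝕜 K n r V) = 1 := rfl

theorem chartPartial_one (a : Fin n) : chartPartial (K := K) φ hφ V hV a 1 = 0 := by
  have h := chartPartial_mul (K := K) φ hφ V hV a 1 1
  simpa using h

end Functions

/-! ### The algebra of formal series -/

section Series

variable {𝕜 : Type*} [RCLike 𝕜] {K : Type*} [RCLike K] [NormedAlgebra 𝕜 K] {n : ℕ}
  {r : Regularity} {M : Type*} [TopologicalSpace M] [ChartedSpace (Model 𝕜 n) M]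
  {G : Type*} [AddCommGroup G] (ρ : CommutationFactor K G) {m : ℕ} (d : Fin m → G)
  {V : Opens M}

theorem admissible_zero : Admissible ρ d 0 := fun b _ => by simp

theorem Admissible.mono {u w : Fin m →₀ ℕ} (h : Admissible ρ d w) (hu : u ≤ w) :
    Admissible ρ d u := fun b hb => (hu b).trans (h b hb)

theorem monDeg_add (u v : Fin m →₀ ℕ) : monDeg d (u + v) = monDeg d u + monDeg d v := by
  simp [monDeg, add_smul, Finset.sum_add_distrib]

theorem monDeg_single (b : Fin m) : monDeg d (Finsupp.single b 1) = d b := by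
  simp [monDeg, Finsupp.single_apply, ite_smul]

/-- The degree of the part of a monomial that precedes the `b`-th indeterminate. -/
def degBelow (b : Fin m) (w : Fin m →₀ ℕ) : G :=
  ∑ b' ∈ Finset.univ.filter (· < b), w b' • d b'

/-- The degree of the part of a monomial that follows the `b`-th indeterminate. -/
def degAbove (b : Fin m) (w : Fin m →₀ ℕ) : G :=
  ∑ b' ∈ Finset.univ.filter (b < ·), w b' • d b'

theorem degBelow_add (b : Fin m) (u v : Fin m →₀ ℕ) :
    degBelow d b (u + v) = degBelow d b u + degBelow d b v := by
  simp [degBelow, add_smul, Finset.sum_add_distrib]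

theorem monDeg_eq_below_add_above (b : Fin m) (w : Fin m →₀ ℕ) :
    monDeg d w = degBelow d b w + w b • d b + degAbove d b w := by
  have h1 : ∀ b', w b' • d b' = (if b' < b then w b' • d b' else 0) +
      (if b' = b then w b • d b else 0) + if b < b' then w b' • d b' else 0 := by
    intro b'
    rcases lt_trichotomy b' b with h | h | h
    · simp [h, h.ne, h.not_gt]
    · subst h; simp
    · simp [h, h.ne', h.not_gt]
  rw [monDeg, Finset.sum_congr rfl fun b' _ => h1 b', Finset.sum_add_distrib,
    Finset.sum_add_distrib, ← Finset.sum_filter, ← Finset.sum_filter, ← Finset.sum_filter]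
  simp [degBelow, degAbove, Finset.filter_eq']

theorem reorder_add_left (u u' v : Fin m →₀ ℕ) :
    reorder ρ d (u + u') v = reorder ρ d u v * reorder ρ d u' v := by
  simp only [reorder, ← Finset.prod_mul_distrib]
  refine Finset.prod_congr rfl fun b _ => Finset.prod_congr rfl fun b' _ => ?_
  split_ifs <;> simp [add_mul, pow_add]

theorem reorder_add_right (u v v' : Fin m →₀ ℕ) :
    reorder ρ d u (v + v') = reorder ρ d u v * reorder ρ d u v' := by
  simp only [reorder, ← Finset.prod_mul_distrib]
  refine Finset.prod_congr rfl fun b _ => Finset.prod_congr rfl fun b' _ => ?_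
  split_ifs <;> simp [mul_add, pow_add]

theorem reorder_single_left (b : Fin m) (v : Fin m →₀ ℕ) :
    reorder ρ d (Finsupp.single b 1) v = ρ (d b) (degBelow d b v) := by
  rw [reorder, Fintype.prod_eq_single b, degBelow, ρ.sum_right, Finset.prod_filter]
  · simp [ρ.nsmul_right]
  · intro b' hb'
    refine Finset.prod_eq_one fun b'' _ => ?_
    simp [Finsupp.single_eq_of_ne hb']

theorem reorder_single_right (b : Fin m) (u : Fin m →₀ ℕ) :
    reorder ρ d u (Finsupp.single b 1) = ρ (degAbove d b u) (d b) := by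
  rw [reorder, Finset.prod_comm, Fintype.prod_eq_single b, degAbove, ρ.sum_left,
    Finset.prod_filter]
  · simp [ρ.nsmul_left]
  · intro b' hb'
    refine Finset.prod_eq_one fun b'' _ => ?_
    simp [Finsupp.single_eq_of_ne hb']

theorem reorder_zero_left (v : Fin m →₀ ℕ) : reorder ρ d 0 v = 1 := by simp [reorder]

theorem seriesMul_of_admissible {w : Fin m →₀ ℕ} (hw : Admissible ρ d w)
    (f g : Series 𝕜 K n m r V) : seriesMul ρ d f g w =
      ∑ q ∈ Finset.HasAntidiagonal.antidiagonal w, reorder ρ d q.1 q.2 • (f q.1 * g q.2) :=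
  if_pos hw

theorem seriesMul_of_not_admissible {w : Fin m →₀ ℕ} (hw : ¬ Admissible ρ d w)
    (f g : Series 𝕜 K n m r V) : seriesMul ρ d f g w = 0 := if_neg hw

theorem seriesMul_apply_zero (f g : Series 𝕜 K n m r V) :
    seriesMul ρ d f g 0 = f 0 * g 0 := by
  rw [seriesMul_of_admissible ρ d (admissible_zero ρ d)]
  simp [reorder_zero_left]

theorem single_zero_seriesMul (φ : Fun 𝕜 K n r V) (h : Series 𝕜 K n m r V) {w : Fin m →₀ ℕ}
    (hw : Admissible ρ d w) : seriesMul ρ d (Pi.single 0 φ) h w = φ * h w := by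
  rw [seriesMul_of_admissible ρ d hw, Finset.sum_eq_single (0, w)]
  · simp [reorder_zero_left]
  · rintro ⟨u, v⟩ huv hne
    have hu : u ≠ 0 := by
      rintro rfl
      rw [Finset.HasAntidiagonal.mem_antidiagonal, zero_add] at huv
      exact hne (by rw [← huv])
    simp [Pi.single_eq_of_ne hu]
  · intro h0
    exact absurd (by simp) h0

theorem single_one_seriesMul (b : Fin m) (h : Series 𝕜 K n m r V) {w : Fin m →₀ ℕ}
    (hw : Admissible ρ d (w + Finsupp.single b 1)) :
    seriesMul ρ d (Pi.single (Finsupp.single b 1) 1) h (w + Finsupp.single b 1) =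
      ρ (d b) (degBelow d b w) • h w := by
  rw [seriesMul_of_admissible ρ d hw, Finset.sum_eq_single (Finsupp.single b 1, w)]
  · simp [reorder_single_left]
  · rintro ⟨u, v⟩ huv hne
    have hu : u ≠ Finsupp.single b 1 := by
      rintro rfl
      rw [Finset.HasAntidiagonal.mem_antidiagonal, add_comm] at huv
      exact hne (Prod.ext rfl (add_right_cancel huv))
    simp [Pi.single_eq_of_ne hu]
  · intro h0
    exact absurd (by simp [add_comm]) h0

theorem single_one_seriesMul_of_eq_zero (b : Fin m) (h : Series 𝕜 K n m r V) {w : Fin m →₀ ℕ}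
    (hw : w b = 0) : seriesMul ρ d (Pi.single (Finsupp.single b 1) 1) h w = 0 := by
  by_cases hadm : Admissible ρ d w
  · rw [seriesMul_of_admissible ρ d hadm]
    refine Finset.sum_eq_zero ?_
    rintro ⟨u, v⟩ huv
    have hu : u ≠ Finsupp.single b 1 := by
      rintro rfl
      rw [Finset.HasAntidiagonal.mem_antidiagonal] at huv
      rw [← huv] at hw
      simp at hw
    simp [Pi.single_eq_of_ne hu]
  · exact seriesMul_of_not_admissible ρ d hadm _ _

/-- The graded Leibniz rule for the derivative with respect to an indeterminate. -/
theorem formalPartial_seriesMul (b : Fin m) {i : G} {f g : Series 𝕜 K n m r V}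
    (hf : f ∈ homog ρ d V i) (hg : ∀ w, g w ≠ 0 → Admissible ρ d w) :
    formalPartial ρ d V b (seriesMul ρ d f g) =
      seriesMul ρ d (formalPartial ρ d V b f) g +
        ρ (-d b) i • seriesMul ρ d f (formalPartial ρ d V b g) := by
  funext w
  set e : Fin m →₀ ℕ := Finsupp.single b 1 with he
  have hfp : ∀ (c : Series 𝕜 K n m r V) w, formalPartial ρ d V b c w =
      (((w b : K) + 1) * ρ (-d b) (degBelow d b w)) • c (w + e) := fun _ _ => rfl
  rw [hfp, Pi.add_apply, Pi.smul_apply]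
  -- the two kinds of terms, indexed by the pairs that add up to `w + e`
  set T₁ : (Fin m →₀ ℕ) × (Fin m →₀ ℕ) → Fun 𝕜 K n r V := fun q =>
    ((q.1 b : K) * ρ (-d b) (degBelow d b w) * reorder ρ d q.1 q.2) • (f q.1 * g q.2) with hT₁
  set T₂ : (Fin m →₀ ℕ) × (Fin m →₀ ℕ) → Fun 𝕜 K n r V := fun q =>
    ((q.2 b : K) * ρ (-d b) (degBelow d b w) * reorder ρ d q.1 q.2 * ρ (d b) (q.1 b • d b)) •
      (f q.1 * g q.2) with hT₂
  have hshift₁ : ∀ F : (Fin m →₀ ℕ) × (Fin m →₀ ℕ) → Fun 𝕜 K n r V,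
      (∀ q, q.1 b = 0 → F q = 0) → ∑ q ∈ Finset.HasAntidiagonal.antidiagonal (w + e), F q =
        ∑ q ∈ Finset.HasAntidiagonal.antidiagonal w, F (q.1 + e, q.2) := by
    intro F hF
    symm
    refine Finset.sum_of_injOn (fun q => (q.1 + e, q.2)) ?_ ?_ ?_ (fun _ _ => rfl)
    · rintro ⟨u, v⟩ _ ⟨u', v'⟩ _ h
      simpa using h
    · rintro ⟨u, v⟩ h
      simp only [Finset.mem_coe, Finset.HasAntidiagonal.mem_antidiagonal] at h ⊢
      rw [← h]; abel
    · rintro ⟨u, v⟩ h hn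
      refine hF _ (by_contra fun hb => hn ?_)
      rw [Finset.HasAntidiagonal.mem_antidiagonal] at h
      have hle : e ≤ u := by
        rw [he, Finsupp.single_le_iff]; exact Nat.one_le_iff_ne_zero.2 hb
      refine ⟨(u - e, v), ?_, ?_⟩
      · simp only [Finset.mem_coe, Finset.HasAntidiagonal.mem_antidiagonal]
        refine add_right_cancel (b := e) ?_
        rw [← h, add_right_comm, tsub_add_cancel_of_le hle]
      · simp [tsub_add_cancel_of_le hle]
  have hshift₂ : ∀ F : (Fin m →₀ ℕ) × (Fin m →₀ ℕ) → Fun 𝕜 K n r V,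
      (∀ q, q.2 b = 0 → F q = 0) → ∑ q ∈ Finset.HasAntidiagonal.antidiagonal (w + e), F q =
        ∑ q ∈ Finset.HasAntidiagonal.antidiagonal w, F (q.1, q.2 + e) := by
    intro F hF
    symm
    refine Finset.sum_of_injOn (fun q => (q.1, q.2 + e)) ?_ ?_ ?_ (fun _ _ => rfl)
    · rintro ⟨u, v⟩ _ ⟨u', v'⟩ _ h
      simpa using h
    · rintro ⟨u, v⟩ h
      simp only [Finset.mem_coe, Finset.HasAntidiagonal.mem_antidiagonal] at h ⊢
      rw [← h]; abel
    · rintro ⟨u, v⟩ h hn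
      refine hF _ (by_contra fun hb => hn ?_)
      rw [Finset.HasAntidiagonal.mem_antidiagonal] at h
      have hle : e ≤ v := by
        rw [he, Finsupp.single_le_iff]; exact Nat.one_le_iff_ne_zero.2 hb
      refine ⟨(u, v - e), ?_, ?_⟩
      · simp only [Finset.mem_coe, Finset.HasAntidiagonal.mem_antidiagonal]
        refine add_right_cancel (b := e) ?_
        rw [← h, add_assoc, tsub_add_cancel_of_le hle]
      · simp [tsub_add_cancel_of_le hle]
  have hρ0 : ∀ x : G, ρ (-d b) x * ρ (d b) x = 1 := fun x => by
    rw [ρ.neg_left, inv_mul_cancel₀ (ρ.ne_zero _ _)]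
  by_cases hw : Admissible ρ d w
  swap
  · have hwe : ¬ Admissible ρ d (w + e) := fun h => hw (h.mono ρ d (by simp))
    rw [seriesMul_of_not_admissible ρ d hwe, seriesMul_of_not_admissible ρ d hw,
      seriesMul_of_not_admissible ρ d hw]
    simp
  have h₁ : seriesMul ρ d (formalPartial ρ d V b f) g w =
      ∑ q ∈ Finset.HasAntidiagonal.antidiagonal (w + e), T₁ q := by
    rw [seriesMul_of_admissible ρ d hw, hshift₁ _ (fun q hq => by simp [hT₁, hq])]
    refine Finset.sum_congr rfl ?_
    rintro ⟨u, v⟩ huv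
    rw [Finset.HasAntidiagonal.mem_antidiagonal] at huv
    simp only [hT₁, hfp, smul_mul_assoc, smul_smul]
    congr 1
    rw [← huv, degBelow_add, ρ.add_right, reorder_add_left, reorder_single_left]
    simp only [he, Finsupp.add_apply, Finsupp.single_eq_same, Nat.cast_add, Nat.cast_one]
    linear_combination (-((u b : K) + 1) * ρ (-d b) (degBelow d b u) * reorder ρ d u v) *
      hρ0 (degBelow d b v)
  have h₂ : ρ (-d b) i • seriesMul ρ d f (formalPartial ρ d V b g) w =
      ∑ q ∈ Finset.HasAntidiagonal.antidiagonal (w + e), T₂ q := by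
    rw [seriesMul_of_admissible ρ d hw, hshift₂ _ (fun q hq => by simp [hT₂, hq]),
      Finset.smul_sum]
    refine Finset.sum_congr rfl ?_
    rintro ⟨u, v⟩ huv
    rw [Finset.HasAntidiagonal.mem_antidiagonal] at huv
    simp only [hT₂, hfp, mul_smul_comm, smul_smul]
    by_cases hfu : f u = 0
    · simp [hfu]
    congr 1
    have hu := (hf u hfu).2
    rw [← hu, monDeg_eq_below_add_above d b u, ← huv, degBelow_add, reorder_add_right,
      reorder_single_right]
    simp only [he, Finsupp.add_apply, Finsupp.single_eq_same, Nat.cast_add, Nat.cast_one,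
      ρ.add_right]
    have h3 : ρ (-d b) (degAbove d b u) = ρ (degAbove d b u) (d b) := by
      rw [ρ.neg_left, ← ρ.swap]
    have h4 : ρ (-d b) (u b • d b) = ρ (d b) (u b • d b) := by
      rw [ρ.neg_left, ρ.nsmul_right, ← inv_pow, ρ.inv_self]
    rw [h3, h4]
    ring
  rw [h₁, h₂, ← Finset.sum_add_distrib]
  by_cases hwe : Admissible ρ d (w + e)
  · rw [seriesMul_of_admissible ρ d hwe, Finset.smul_sum]
    refine Finset.sum_congr rfl ?_
    rintro ⟨u, v⟩ huv
    rw [Finset.HasAntidiagonal.mem_antidiagonal] at huv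
    have huvb : u b + v b = w b + 1 := by
      have := congrArg (fun x => x b) huv
      simpa [he] using this
    simp only [hT₁, hT₂, smul_smul, ← add_smul]
    congr 1
    have hs : (v b : K) * ρ (d b) (u b • d b) = v b := by
      rw [ρ.nsmul_right]
      rcases ρ.self_eq (d b) with h | h
      · rw [h]; simp
      · have h5 := hwe b h
        rw [Finsupp.add_apply, he, Finsupp.single_eq_same, ← huvb] at h5
        rcases Nat.eq_zero_or_pos (v b) with h6 | h6
        · simp [h6]
        · rw [show u b = 0 by omega]; simp
    have hc : (w b : K) + 1 = u b + v b := by exact_mod_cast huvb.symm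
    rw [hc]
    linear_combination (-(ρ (-d b) (degBelow d b w) * reorder ρ d u v)) * hs
  · rw [seriesMul_of_not_admissible ρ d hwe, smul_zero]
    symm
    refine Finset.sum_eq_zero ?_
    rintro ⟨u, v⟩ huv
    rw [Finset.HasAntidiagonal.mem_antidiagonal] at huv
    by_cases hfu : f u = 0
    · simp [hT₁, hT₂, hfu]
    by_cases hgv : g v = 0
    · simp [hT₁, hT₂, hgv]
    -- `x^b` is odd and `w` contains it already, so both factors contain it exactly once
    have hb : ρ (d b) (d b) = -1 ∧ 1 ≤ w b := by
      unfold Admissible at hwe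
      push Not at hwe
      obtain ⟨b', hb', h1⟩ := hwe
      have h2 := hw b' hb'
      by_cases hbb : b' = b
      · subst hbb
        rw [Finsupp.add_apply, he, Finsupp.single_eq_same] at h1
        exact ⟨hb', by omega⟩
      · rw [Finsupp.add_apply, he, Finsupp.single_eq_of_ne hbb] at h1
        omega
    have huvb : u b + v b = w b + 1 := by
      have := congrArg (fun x => x b) huv
      simpa [he] using this
    have hu := (hf u hfu).1 b hb.1
    have hv := hg v hgv b hb.1
    simp only [hT₁, hT₂, ← add_smul]
    rw [show u b = 1 by omega, show v b = 1 by omega, one_smul, hb.1]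
    convert zero_smul K _ using 2
    push_cast
    ring

end Series

/-! ### Hadamard's lemma -/

section Hadamard

variable {𝕜 : Type*} [RCLike 𝕜] {E : Type u} [NormedAddCommGroup E] [NormedSpace 𝕜 E]

theorem lineMap_mem_closedBall {x₀ x : E} {R : ℝ} (hx : x ∈ Metric.closedBall x₀ R) {t : ℝ}
    (ht : t ∈ Set.Icc (0 : ℝ) 1) : x₀ + (t : 𝕜) • (x - x₀) ∈ Metric.closedBall x₀ R := by
  rw [mem_closedBall_iff_norm] at hx ⊢
  rw [add_sub_cancel_left, norm_smul, RCLike.norm_ofReal, abs_of_nonneg ht.1]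
  exact (mul_le_of_le_one_left (norm_nonneg _) ht.2).trans hx

theorem lineMap_mem_ball {x₀ x : E} {R : ℝ} (hx : x ∈ Metric.ball x₀ R) {t : ℝ}
    (ht : t ∈ Set.Icc (0 : ℝ) 1) : x₀ + (t : 𝕜) • (x - x₀) ∈ Metric.ball x₀ R := by
  rw [mem_ball_iff_norm] at hx ⊢
  rw [add_sub_cancel_left, norm_smul, RCLike.norm_ofReal, abs_of_nonneg ht.1]
  exact (mul_le_of_le_one_left (norm_nonneg _) ht.2).trans_lt hx

variable {F : Type w} [NormedAddCommGroup F] [NormedSpace 𝕜 F]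

theorem continuousOn_segment {x₀ x : E} {R : ℝ} (hx : x ∈ Metric.ball x₀ R) (j : ℕ) {H : E → F}
    (hH : ContinuousOn H (Metric.ball x₀ R)) :
    ContinuousOn (fun t : ℝ => (t : 𝕜) ^ j • H (x₀ + (t : 𝕜) • (x - x₀))) (Set.Icc 0 1) := by
  have h1 : Continuous fun t : ℝ => x₀ + (t : 𝕜) • (x - x₀) := by fun_prop
  have h2 : Continuous fun t : ℝ => (t : 𝕜) ^ j := by fun_prop
  exact h2.continuousOn.smul (hH.comp h1.continuousOn fun t ht => lineMap_mem_ball hx ht)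

variable [NormedSpace ℝ F]

theorem hasFDerivAt_integral_segment [ProperSpace E] {x₀ x : E} {R : ℝ}
    (hx : x ∈ Metric.ball x₀ R) (j : ℕ) {H : E → F} (hH : ContDiffOn 𝕜 1 H (Metric.ball x₀ R)) :
    HasFDerivAt (fun x => ∫ t in (0 : ℝ)..1, (t : 𝕜) ^ j • H (x₀ + (t : 𝕜) • (x - x₀)))
      (∫ t in (0 : ℝ)..1, (t : 𝕜) ^ (j + 1) • fderiv 𝕜 H (x₀ + (t : 𝕜) • (x - x₀))) x := by
  have hd : ContinuousOn (fderiv 𝕜 H) (Metric.ball x₀ R) :=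
    hH.continuousOn_fderiv_of_isOpen Metric.isOpen_ball le_rfl
  obtain ⟨R', hR', hR⟩ := exists_between (Metric.mem_ball.1 hx)
  obtain ⟨C, hC⟩ := (isCompact_closedBall x₀ R').exists_bound_of_continuousOn
    (hd.mono (Metric.closedBall_subset_ball hR))
  have hI : Set.uIoc (0 : ℝ) 1 ⊆ Set.Icc 0 1 := by
    rw [Set.uIoc_of_le zero_le_one]; exact Set.Ioc_subset_Icc_self
  refine intervalIntegral.hasFDerivAt_integral_of_dominated_of_fderiv_le
    (F' := fun x t => (t : 𝕜) ^ (j + 1) • fderiv 𝕜 H (x₀ + (t : 𝕜) • (x - x₀)))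
    (bound := fun _ => C) (Metric.isOpen_ball.mem_nhds (Metric.mem_ball.2 hR')) ?_ ?_ ?_ ?_ ?_ ?_
  · filter_upwards [Metric.isOpen_ball.mem_nhds hx] with y hy
    exact ((continuousOn_segment hy j hH.continuousOn).mono hI).aestronglyMeasurable
      measurableSet_uIoc
  · refine ContinuousOn.intervalIntegrable ?_
    rw [Set.uIcc_of_le zero_le_one]
    exact continuousOn_segment hx j hH.continuousOn
  · exact ((continuousOn_segment hx (j + 1) hd).mono hI).aestronglyMeasurable measurableSet_uIoc
  · refine Filter.Eventually.of_forall fun t ht y hy => ?_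
    rw [norm_smul, norm_pow, RCLike.norm_ofReal, abs_of_nonneg (hI ht).1]
    exact (mul_le_of_le_one_left (norm_nonneg _) (pow_le_one₀ (hI ht).1 (hI ht).2)).trans
      (hC _ (lineMap_mem_closedBall (Metric.ball_subset_closedBall hy) (hI ht)))
  · exact intervalIntegrable_const
  · refine Filter.Eventually.of_forall fun t ht y hy => ?_
    have h1 : HasFDerivAt (fun y : E => x₀ + (t : 𝕜) • (y - x₀))
        ((t : 𝕜) • ContinuousLinearMap.id 𝕜 E) y :=
      (((hasFDerivAt_id y).sub_const x₀).const_smul (t : 𝕜)).const_add x₀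
    have hy' : x₀ + (t : 𝕜) • (y - x₀) ∈ Metric.ball x₀ R :=
      lineMap_mem_ball (Metric.ball_subset_ball hR.le hy) (hI ht)
    have h2 : HasFDerivAt H (fderiv 𝕜 H (x₀ + (t : 𝕜) • (y - x₀))) (x₀ + (t : 𝕜) • (y - x₀)) :=
      ((hH.contDiffAt (Metric.isOpen_ball.mem_nhds hy')).differentiableAt one_ne_zero).hasFDerivAt
    have h3 := (h2.comp y h1).const_smul ((t : 𝕜) ^ j)
    refine h3.congr_fderiv (ContinuousLinearMap.ext fun z => ?_)
    change (t : 𝕜) ^ j • (fderiv 𝕜 H (x₀ + (t : 𝕜) • (y - x₀))) ((t : 𝕜) • z) =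
      (t : 𝕜) ^ (j + 1) • (fderiv 𝕜 H (x₀ + (t : 𝕜) • (y - x₀))) z
    rw [map_smul, smul_smul, pow_succ]

/-- A derivative under the integral sign raises the power of `t` by one and takes values in a space
of linear maps, so the induction runs over all powers and all spaces of values. -/
theorem contDiffOn_integral_segment [ProperSpace E] {x₀ : E} {R : ℝ} (k : ℕ) :
    ∀ {F : Type (max u w)} [NormedAddCommGroup F] [NormedSpace 𝕜 F] [NormedSpace ℝ F] (j : ℕ)
      {H : E → F}, ContDiffOn 𝕜 ∞ H (Metric.ball x₀ R) →
      ContDiffOn 𝕜 k (fun x => ∫ t in (0 : ℝ)..1, (t : 𝕜) ^ j • H (x₀ + (t : 𝕜) • (x - x₀)))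
        (Metric.ball x₀ R) := by
  induction k with
  | zero =>
    intro F _ _ _ j H hH
    refine contDiffOn_zero.2 fun x hx => ?_
    exact (hasFDerivAt_integral_segment hx j (hH.of_le (by simp))).continuousAt.continuousWithinAt
  | succ k ih =>
    intro F _ _ _ j H hH
    have hder := fun x hx => hasFDerivAt_integral_segment (x := x) hx j (hH.of_le (by simp))
    rw [Nat.cast_succ, contDiffOn_succ_iff_fderiv_of_isOpen Metric.isOpen_ball]
    refine ⟨fun x hx => (hder x hx).differentiableAt.differentiableWithinAt, by simp, ?_⟩
    exact (ih (j + 1) ((contDiffOn_infty_iff_fderiv_of_isOpen Metric.isOpen_ball).1 hH).2).congr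
      fun x hx => (hder x hx).fderiv

variable {K : Type w} [RCLike K] [NormedAlgebra 𝕜 K]

theorem hasDerivAt_segment {f : E → K} {x₀ x : E} {t : ℝ}
    (hf : DifferentiableAt 𝕜 f (x₀ + (t : 𝕜) • (x - x₀))) :
    HasDerivAt (fun t : ℝ => f (x₀ + (t : 𝕜) • (x - x₀)))
      (fderiv 𝕜 f (x₀ + (t : 𝕜) • (x - x₀)) (x - x₀)) t := by
  let _ : NormedSpace ℝ E := NormedSpace.restrictScalars ℝ 𝕜 E
  have h3 : HasDerivAt (fun t : ℝ => x₀ + (t : 𝕜) • (x - x₀)) (x - x₀) t := by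
    have h4 : HasDerivAt (fun t : ℝ => (t : 𝕜)) 1 t := by
      simpa using (RCLike.ofRealCLM (K := 𝕜)).hasDerivAt (x := t)
    simpa using (h4.smul_const (x - x₀)).const_add x₀
  exact (hf.hasFDerivAt.restrictScalars ℝ).comp_hasDerivAt t h3

/-- Hadamard's lemma for smooth functions: the coefficients are the mean of the derivative over the
segment from `x₀`. -/
theorem exists_smooth_slope [ProperSpace E] {f : E → K} {x₀ : E} {R : ℝ}
    (hf : ContDiffOn 𝕜 ∞ f (Metric.ball x₀ R)) :
    ∃ g : E → E →L[𝕜] K, ContDiffOn 𝕜 ∞ g (Metric.ball x₀ R) ∧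
      ∀ x ∈ Metric.ball x₀ R, f x = f x₀ + g x (x - x₀) := by
  have hf' : ContDiffOn 𝕜 ∞ (fderiv 𝕜 f) (Metric.ball x₀ R) :=
    ((contDiffOn_infty_iff_fderiv_of_isOpen Metric.isOpen_ball).1 hf).2
  refine ⟨fun x => ∫ t in (0 : ℝ)..1, (t : 𝕜) ^ 0 • fderiv 𝕜 f (x₀ + (t : 𝕜) • (x - x₀)),
    contDiffOn_infty.2 fun k => contDiffOn_integral_segment k 0 hf', fun x hx => ?_⟩
  have hint : ContinuousOn
      (fun t : ℝ => (t : 𝕜) ^ 0 • fderiv 𝕜 f (x₀ + (t : 𝕜) • (x - x₀))) (Set.Icc 0 1) :=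
    continuousOn_segment (H := fderiv 𝕜 f) hx 0 hf'.continuousOn
  have hint' : IntervalIntegrable
      (fun t : ℝ => (t : 𝕜) ^ 0 • fderiv 𝕜 f (x₀ + (t : 𝕜) • (x - x₀))) MeasureTheory.volume 0 1 := by
    refine ContinuousOn.intervalIntegrable ?_
    rwa [Set.uIcc_of_le zero_le_one]
  have h2 := intervalIntegral.integral_eq_sub_of_hasDerivAt
    (f := fun t : ℝ => f (x₀ + (t : 𝕜) • (x - x₀)))
    (f' := fun t : ℝ => fderiv 𝕜 f (x₀ + (t : 𝕜) • (x - x₀)) (x - x₀)) (a := 0) (b := 1)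
    (fun t ht => by
      rw [Set.uIcc_of_le zero_le_one] at ht
      exact hasDerivAt_segment ((hf.contDiffAt
        (Metric.isOpen_ball.mem_nhds (lineMap_mem_ball hx ht))).differentiableAt (by simp)))
    (by
      refine ContinuousOn.intervalIntegrable ?_
      rw [Set.uIcc_of_le zero_le_one]
      have := hint.clm_apply (continuousOn_const (c := x - x₀))
      simpa only [pow_zero, one_smul] using this)
  have h3 := ContinuousLinearMap.intervalIntegral_apply hint' (x - x₀)
  simp only [pow_zero, one_smul] at h3 ⊢
  rw [h3, h2]
  simp

/-- Hadamard's lemma for analytic functions: the coefficients are the sum of the shifted power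
series. -/
theorem exists_analytic_slope {f : E → K} {x₀ : E} (hf : AnalyticAt 𝕜 f x₀) :
    ∃ g : E → E →L[𝕜] K, AnalyticAt 𝕜 g x₀ ∧ ∀ᶠ x in 𝓝 x₀, f x = f x₀ + g x (x - x₀) := by
  have : CompleteSpace (E →L[𝕜] K) := inferInstance
  obtain ⟨p, R, hp⟩ := hf
  have hpos : 0 < p.shift.radius := by
    rw [FormalMultilinearSeries.radius_shift]; exact hp.r_pos.trans_le hp.r_le
  have hs := (p.shift.hasFPowerSeriesOnBall hpos)
  refine ⟨fun x => p.shift.sum (x - x₀), ?_, ?_⟩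
  · have h1 := hs.analyticAt
    have h2 : AnalyticAt 𝕜 (fun x : E => x - x₀) x₀ := analyticAt_id.sub analyticAt_const
    exact AnalyticAt.fun_comp (by simpa using h1) h2
  · have h1 : ∀ᶠ x in 𝓝 x₀, x ∈ Metric.eball x₀ R := Metric.eball_mem_nhds x₀ hp.r_pos
    filter_upwards [h1] with x hx
    have hx' : x - x₀ ∈ Metric.eball (0 : E) R := by
      simpa [edist_eq_enorm_sub] using hx
    have h2 := hp.hasSum hx'
    have h3 : x - x₀ ∈ Metric.eball (0 : E) p.shift.radius := by
      rw [FormalMultilinearSeries.radius_shift]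
      exact Metric.eball_subset_eball hp.r_le hx'
    have h4 := hs.hasSum h3
    rw [zero_add] at h4
    have h5 := h4.mapL (ContinuousLinearMap.apply 𝕜 K (x - x₀))
    rw [add_sub_cancel] at h2
    have h6 := (hasSum_nat_add_iff' 1).2 h2
    have h7 : HasSum (fun k => p (k + 1) fun _ => x - x₀) (p.shift.sum (x - x₀) (x - x₀)) := by
      refine h5.congr_fun fun k => ?_
      symm
      change (p (k + 1)).curryRight (fun _ => x - x₀) (x - x₀) = _
      rw [ContinuousMultilinearMap.curryRight_apply]
      congr 1
      funext i
      refine Fin.lastCases ?_ (fun i => ?_) i <;> simp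
    have h8 := h6.unique h7
    rw [Finset.sum_range_one, hp.coeff_zero] at h8
    rw [← h8]; ring

/-- Hadamard's lemma: near a point, a smooth (analytic) function is its value at the point plus a
linear form in the increment, with smooth (analytic) coefficients. -/
theorem exists_slope [ProperSpace E] {r : Regularity} {f : E → K} {x₀ : E}
    (hf : ∀ᶠ x in 𝓝 x₀, ContDiffAt 𝕜 r.order f x) :
    ∃ g : E → E →L[𝕜] K, (∀ᶠ x in 𝓝 x₀, ContDiffAt 𝕜 r.order g x) ∧
      ∀ᶠ x in 𝓝 x₀, f x = f x₀ + g x (x - x₀) := by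
  cases r with
  | smooth =>
    obtain ⟨R, hR, h⟩ := Metric.eventually_nhds_iff_ball.1 hf
    obtain ⟨g, hg, hfg⟩ := exists_smooth_slope (f := f) (x₀ := x₀) (R := R)
      fun x hx => (h x hx).contDiffWithinAt
    have hball := Metric.isOpen_ball.eventually_mem (Metric.mem_ball_self (x := x₀) hR)
    refine ⟨g, ?_, ?_⟩
    · filter_upwards [hball] with x hx
      exact hg.contDiffAt (Metric.isOpen_ball.mem_nhds hx)
    · filter_upwards [hball] with x hx
      exact hfg x hx
  | analytic =>
    obtain ⟨g, hg, hfg⟩ := exists_analytic_slope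
      (ContDiffAt.analyticAt (hf.self_of_nhds : ContDiffAt 𝕜 ω f x₀))
    refine ⟨g, ?_, hfg⟩
    filter_upwards [hg.eventually_analyticAt] with x hx
    exact hx.contDiffAt

end Hadamard

section Chart

variable {𝕜 : Type*} [RCLike 𝕜] {K : Type*} [RCLike K] [NormedAlgebra 𝕜 K] {n : ℕ}
  {r : Regularity} {M : Type*} [TopologicalSpace M] [ChartedSpace (Model 𝕜 n) M]
  [IsManifold 𝓘(𝕜, Model 𝕜 n) r.order M]

theorem eq_sum_single (v : Model 𝕜 n) : v = ∑ a, v a • EuclideanSpace.single a (1 : 𝕜) := by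
  ext b
  simp [Finset.sum_apply, Pi.single_apply]

/-- Hadamard's lemma in a chart of the manifold. -/
theorem exists_chart_slope (φ : OpenPartialHomeomorph M (Model 𝕜 n))
    (hφ : φ ∈ IsManifold.maximalAtlas 𝓘(𝕜, Model 𝕜 n) r.order M)
    (V : Opens M) (hV : ∀ p ∈ V, p ∈ φ.source) (f : Fun 𝕜 K n r V) (p : V) :
    ∃ (W : Opens M) (hW : W ≤ V), p.1 ∈ W ∧ ∃ g : Fin n → Fun 𝕜 K n r W,
      Fun.res hW f = algebraMap K _ (f.1 p) + ∑ a,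
        (chartCoord φ hφ W (fun q hq => hV q (hW hq)) a -
          algebraMap K _ (algebraMap 𝕜 K (φ p.1 a))) * g a := by
  have hdiff : ∀ᶠ e in 𝓝 (φ p.1), ContDiffAt 𝕜 r.order (extendZero f.1 ∘ φ.symm) e := by
    filter_upwards [eventually_symm_mem φ V hV p] with e he
    have := extendZero_contDiffAt φ hφ V hV f ⟨φ.symm e, he.2⟩
    rwa [φ.right_inv he.1] at this
  obtain ⟨G, hG, hfG⟩ := exists_slope hdiff
  obtain ⟨O, hO, hOo, hpO⟩ := eventually_nhds_iff.1 (hG.and hfG)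
  set W : Opens M := ⟨V ∩ (φ.source ∩ φ ⁻¹' O), V.2.inter (φ.isOpen_inter_preimage hOo)⟩ with hWdef
  have hW : W ≤ V := fun q hq => hq.1
  refine ⟨W, hW, ⟨p.2, hV _ p.2, hpO⟩, fun a => ⟨fun q => G (φ q.1) (EuclideanSpace.single a 1),
    fun q => ?_⟩, ?_⟩
  · have h1 : ContDiffAt 𝕜 r.order (fun e => G e (EuclideanSpace.single a 1)) (φ q.1) :=
      (hO _ q.2.2.2).1.clm_apply contDiffAt_const
    exact contMDiffAt_subtype_iff.2
      (h1.contMDiffAt.comp q.1 (contMDiffAt_of_mem_maximalAtlas hφ (hV _ (hW q.2))))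
  · ext q
    have h1 := (hO _ q.2.2.2).2
    rw [extendZero_comp_apply_point φ V f.1 ⟨q.1, hW q.2⟩ (hV _ (hW q.2)),
      extendZero_comp_apply_point φ V f.1 p (hV _ p.2)] at h1
    refine h1.trans ?_
    have h2 : ∀ v : Model 𝕜 n, G (φ q.1) v =
        ∑ a, algebraMap 𝕜 K (v a) * G (φ q.1) (EuclideanSpace.single a 1) := by
      intro v
      conv_lhs => rw [eq_sum_single v, map_sum]
      exact Finset.sum_congr rfl fun a _ => by rw [map_smul, Algebra.smul_def]
    rw [h2]
    have h3 : ∀ g : Fin n → Fun 𝕜 K n r W, (∑ a, g a).1 q = ∑ a, (g a).1 q := by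
      intro g
      rw [AddSubmonoidClass.coe_finsetSum, Finset.sum_apply]
    refine Eq.trans ?_ (congrArg (fun z => f.1 p + z) (h3 _).symm)
    congr 1
    refine Finset.sum_congr rfl fun a _ => ?_
    rw [PiLp.sub_apply, map_sub]
    rfl

end Chart

/-! ### Sections in coordinates -/

section Coordinates

variable {𝕜 : Type*} [RCLike 𝕜] {K : Type*} [RCLike K] [NormedAlgebra 𝕜 K] {n m : ℕ}
  {r : Regularity} {M : Type u} [TopologicalSpace M] [ChartedSpace (Model 𝕜 n) M]
  [IsManifold 𝓘(𝕜, Model 𝕜 n) r.order M]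
  {G : Type*} [AddCommGroup G] [DecidableEq G] {ρ : CommutationFactor K G} {d : Fin m → G}

theorem RhoSheaf.isRhoComm (𝒪 : RhoSheaf.{u, w} ρ M) (V : Opens M) : IsRhoComm ρ (𝒪.deg V) :=
  𝒪.comm V

namespace Coord

variable {𝒪 : RhoSheaf.{u, w} ρ M} (x : Coord 𝕜 n r d 𝒪) (V : Opens M) (hV : V ≤ x.dom)

theorem coeff_mem {i : G} {f : 𝒪.sec V} (hf : f ∈ 𝒪.deg V i) :
    x.coeff V hV f ∈ homog ρ d V i := (x.coeff_bij V hV i).mapsTo hf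

theorem coeff_decompose (f : 𝒪.sec V) (i : G) (w : Fin m →₀ ℕ) :
    x.coeff V hV (DirectSum.decompose (𝒪.deg V) f i) w =
      if monDeg d w = i then x.coeff V hV f w else 0 := by
  induction f using DirectSum.Decomposition.inductionOn (𝒪.deg V) with
  | zero => simp
  | @homogeneous j f =>
    by_cases hji : j = i
    · subst hji
      rw [DirectSum.decompose_coe, DirectSum.of_eq_same]
      split_ifs with h
      · rfl
      · by_contra hne
        exact h ((x.coeff_mem V hV f.2 w hne).2)
    · rw [DirectSum.decompose_coe, DirectSum.of_eq_of_ne _ _ _ (Ne.symm hji)]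
      split_ifs with h
      · have : x.coeff V hV f w = 0 := by
          by_contra hne
          exact hji ((x.coeff_mem V hV f.2 w hne).2.symm.trans h)
        rw [this]; simp
      · simp
  | add f g hf hg =>
    rw [DirectSum.decompose_add, DirectSum.add_apply, Submodule.coe_add, map_add, map_add,
      Pi.add_apply, Pi.add_apply, hf, hg]
    split_ifs <;> simp

theorem coeff_injective : Function.Injective (x.coeff V hV) := by
  rw [injective_iff_map_eq_zero]
  intro f hf
  have h : ∀ i, (DirectSum.decompose (𝒪.deg V) f i : 𝒪.sec V) = 0 := fun i => by
    refine (x.coeff_bij V hV i).injOn (SetLike.coe_mem _) (Submodule.zero_mem _) ?_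
    funext w
    rw [coeff_decompose, hf]
    simp
  classical
  rw [← DirectSum.sum_support_decompose (𝒪.deg V) f]
  exact Finset.sum_eq_zero fun i _ => h i

theorem coeff_admissible {f : 𝒪.sec V} {w : Fin m →₀ ℕ} (h : x.coeff V hV f w ≠ 0) :
    Admissible ρ d w := by
  have h1 := x.coeff_decompose V hV f (monDeg d w) w
  rw [if_pos rfl] at h1
  rw [← h1] at h
  exact (x.coeff_mem V hV (SetLike.coe_mem _) w h).1

theorem mem_of_coeff_mem {i : G} {f : 𝒪.sec V} (hf : x.coeff V hV f ∈ homog ρ d V i) :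
    f ∈ 𝒪.deg V i := by
  have h := x.coeff_injective V hV (x.coeff_lift V hV _ hf)
  rw [← h]
  exact x.lift_mem V hV _ hf

theorem coeff_const (φ : Fun 𝕜 K n r V) : x.coeff V hV (x.const V hV φ) = Pi.single 0 φ :=
  x.coeff_lift V hV _ _

theorem const_mem (φ : Fun 𝕜 K n r V) : x.const V hV φ ∈ 𝒪.deg V 0 := x.lift_mem V hV _ _

theorem const_one : x.const V hV 1 = 1 :=
  x.coeff_injective V hV (by rw [coeff_const, x.coeff_one])

theorem const_add (φ ψ : Fun 𝕜 K n r V) :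
    x.const V hV (φ + ψ) = x.const V hV φ + x.const V hV ψ :=
  x.coeff_injective V hV (by rw [map_add, coeff_const, coeff_const, coeff_const, Pi.single_add])

theorem const_smul (c : K) (φ : Fun 𝕜 K n r V) : x.const V hV (c • φ) = c • x.const V hV φ :=
  x.coeff_injective V hV (by rw [map_smul, coeff_const, coeff_const, Pi.single_smul'])

/-- The embedding of the functions of the manifold as a linear map. -/
def constL : Fun 𝕜 K n r V →ₗ[K] 𝒪.sec V where
  toFun := x.const V hV
  map_add' := x.const_add V hV
  map_smul' := x.const_smul V hV

theorem const_algebraMap (c : K) : x.const V hV (algebraMap K _ c) = c • 1 := by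
  rw [Algebra.algebraMap_eq_smul_one, const_smul, const_one]

theorem coeff_const_mul (φ : Fun 𝕜 K n r V) (f : 𝒪.sec V) (w : Fin m →₀ ℕ) :
    x.coeff V hV (x.const V hV φ * f) w = φ * x.coeff V hV f w := by
  rw [x.coeff_mul, coeff_const]
  by_cases hw : Admissible ρ d w
  · exact single_zero_seriesMul ρ d _ _ hw
  · rw [seriesMul_of_not_admissible ρ d hw]
    have : x.coeff V hV f w = 0 := by
      by_contra h
      exact hw (x.coeff_admissible V hV h)
    rw [this, mul_zero]

theorem const_mul (φ ψ : Fun 𝕜 K n r V) :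
    x.const V hV (φ * ψ) = x.const V hV φ * x.const V hV ψ :=
  x.coeff_injective V hV (by
    funext w
    rw [coeff_const_mul, coeff_const, coeff_const]
    by_cases hw : w = 0
    · subst hw; simp
    · simp [hw])

theorem const_res {W : Opens M} (h : W ≤ V) (φ : Fun 𝕜 K n r V) :
    𝒪.res h (x.const V hV φ) = x.const W (h.trans hV) (Fun.res h φ) :=
  x.coeff_injective W (h.trans hV) (by
    funext w
    rw [x.coeff_res V W hV h, coeff_const, coeff_const]
    by_cases hw : w = 0
    · subst hw; simp
    · simp [hw])

theorem fn_castAdd (a : Fin n) : x.fn V hV (Fin.castAdd m a) =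
    x.const V hV (chartCoord x.chart x.chart_mem V (x.le_source V hV) a) := by
  simp [fn]

theorem coeff_fn_natAdd (b : Fin m) : x.coeff V hV (x.fn V hV (Fin.natAdd n b)) =
    Pi.single (Finsupp.single b 1) 1 := by
  simp only [fn, Fin.addCases_right]
  exact x.coeff_lift V hV _ _

theorem coordDeg_castAdd (a : Fin n) : coordDeg n d (Fin.castAdd m a) = 0 := by simp [coordDeg]

theorem coordDeg_natAdd (b : Fin m) : coordDeg n d (Fin.natAdd n b) = d b := by simp [coordDeg]

theorem fn_mem (a : Fin (n + m)) : x.fn V hV a ∈ 𝒪.deg V (coordDeg n d a) := by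
  induction a using Fin.addCases with
  | left a => rw [fn_castAdd, coordDeg_castAdd]; exact x.const_mem V hV _
  | right b =>
    refine x.mem_of_coeff_mem V hV ?_
    rw [coeff_fn_natAdd, coordDeg_natAdd]
    exact single_one_mem ρ d b

theorem fn_res {W : Opens M} (h : W ≤ V) (a : Fin (n + m)) :
    𝒪.res h (x.fn V hV a) = x.fn W (h.trans hV) a := by
  induction a using Fin.addCases with
  | left a => rw [fn_castAdd, fn_castAdd, const_res]; rfl
  | right b =>
    refine x.coeff_injective W (h.trans hV) ?_
    funext w
    rw [x.coeff_res V W hV h, coeff_fn_natAdd, coeff_fn_natAdd]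
    by_cases hw : w = Finsupp.single b 1
    · subst hw; simp
    · simp [hw]

theorem coeff_fn_mul (b : Fin m) (f : 𝒪.sec V) {w : Fin m →₀ ℕ}
    (hw : Admissible ρ d (w + Finsupp.single b 1)) :
    x.coeff V hV (x.fn V hV (Fin.natAdd n b) * f) (w + Finsupp.single b 1) =
      ρ (d b) (degBelow d b w) • x.coeff V hV f w := by
  rw [x.coeff_mul, coeff_fn_natAdd, single_one_seriesMul ρ d b _ hw]

theorem coeff_fn_mul_of_eq_zero (b : Fin m) (f : 𝒪.sec V) {w : Fin m →₀ ℕ} (hw : w b = 0) :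
    x.coeff V hV (x.fn V hV (Fin.natAdd n b) * f) w = 0 := by
  rw [x.coeff_mul, coeff_fn_natAdd, single_one_seriesMul_of_eq_zero ρ d b _ hw]

/-- Taylor expansion of order one in the graded indeterminates: a term is assigned to the first
indeterminate that occurs in it. -/
theorem exists_eq_const_add_sum {i : G} {f : 𝒪.sec V} (hf : f ∈ 𝒪.deg V i) :
    ∃ h : Fin m → 𝒪.sec V, (∀ b, h b ∈ 𝒪.deg V (i - d b)) ∧
      f = x.const V hV (x.coeff V hV f 0) + ∑ b, x.fn V hV (Fin.natAdd n b) * h b ∧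
      ∀ b w, x.coeff V hV f (w + Finsupp.single b 1) = 0 → x.coeff V hV (h b) w = 0 := by
  classical
  set c : Fin m → Series 𝕜 K n m r V := fun b w =>
    if ∀ b' < b, w b' = 0 then x.coeff V hV f (w + Finsupp.single b 1) else 0 with hc
  have hmem : ∀ b, c b ∈ homog ρ d V (i - d b) := by
    intro b w hw
    simp only [hc] at hw
    split_ifs at hw with h
    · obtain ⟨h1, h2⟩ := x.coeff_mem V hV hf _ hw
      refine ⟨h1.mono ρ d (by simp), ?_⟩
      rw [← h2, monDeg_add, monDeg_single, add_sub_cancel_right]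
    · exact absurd rfl hw
  refine ⟨fun b => x.lift V hV (c b) (hmem b), fun b => x.lift_mem V hV _ _, ?_, ?_⟩
  · refine x.coeff_injective V hV ?_
    funext w
    rw [map_add, map_sum, Pi.add_apply, Finset.sum_apply, coeff_const]
    by_cases hw0 : w = 0
    · subst hw0
      rw [Pi.single_eq_same, Finset.sum_eq_zero, add_zero]
      intro b _
      exact x.coeff_fn_mul_of_eq_zero V hV b _ rfl
    rw [Pi.single_eq_of_ne hw0, zero_add]
    by_cases hadm : Admissible ρ d w
    swap
    · have h0 : x.coeff V hV f w = 0 := by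
        by_contra h
        exact hadm (x.coeff_admissible V hV h)
      rw [h0]
      symm
      refine Finset.sum_eq_zero fun b _ => ?_
      by_contra h
      exact hadm (x.coeff_admissible V hV h)
    have hex : (Finset.univ.filter fun b => w b ≠ 0).Nonempty := by
      by_contra h
      refine hw0 (Finsupp.ext fun b => ?_)
      by_contra hb
      exact h ⟨b, by simpa using hb⟩
    set b₀ := (Finset.univ.filter fun b => w b ≠ 0).min' hex with hb₀
    have hb₀w : w b₀ ≠ 0 := (Finset.mem_filter.1 (Finset.min'_mem _ hex)).2
    have hmin : ∀ b, w b ≠ 0 → b₀ ≤ b := fun b hb => Finset.min'_le _ _ (by simpa using hb)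
    have hsplit : ∀ b, w b ≠ 0 → w = (w - Finsupp.single b 1) + Finsupp.single b 1 := fun b hb =>
      (tsub_add_cancel_of_le (Finsupp.single_le_iff.2 (Nat.one_le_iff_ne_zero.2 hb))).symm
    rw [Finset.sum_eq_single b₀]
    · have h1 := hsplit b₀ hb₀w
      set v := w - Finsupp.single b₀ 1
      have hv : ∀ b' < b₀, v b' = 0 := by
        intro b' hb'
        have h2 : w b' = 0 := by
          by_contra h
          exact absurd (hmin b' h) (not_le.2 hb')
        rw [h1, Finsupp.add_apply] at h2
        omega
      rw [h1, coeff_fn_mul _ _ _ _ _ (h1 ▸ hadm), coeff_lift]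
      have h3 : degBelow d b₀ v = 0 := Finset.sum_eq_zero fun b' hb' => by
        rw [hv b' (Finset.mem_filter.1 hb').2, zero_smul]
      rw [h3, ρ.zero_right, one_smul]
      simp only [hc, if_pos hv]
    · intro b _ hb
      by_cases hwb : w b = 0
      · exact x.coeff_fn_mul_of_eq_zero V hV b _ hwb
      have h1 := hsplit b hwb
      have hlt : b₀ < b := lt_of_le_of_ne (hmin b hwb) (Ne.symm hb)
      have hv0 : (w - Finsupp.single b 1 : Fin m →₀ ℕ) b₀ ≠ 0 := by
        rwa [Finsupp.tsub_apply, Finsupp.single_eq_of_ne hlt.ne, tsub_zero]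
      rw [h1, coeff_fn_mul _ _ _ _ _ (h1 ▸ hadm), coeff_lift]
      simp only [hc]
      rw [if_neg fun h => hv0 (h b₀ hlt), smul_zero]
    · intro h
      exact absurd (Finset.mem_univ _) h
  · intro b w h
    rw [coeff_lift]
    simp only [hc, h, ite_self]

/-! ### Partial derivatives of sections -/

theorem coeff_partialDeriv (a : Fin (n + m)) (f : 𝒪.sec V) :
    x.coeff V hV (x.partialDeriv V hV a f) = x.partialSeries V hV a (x.coeff V hV f) :=
  (x.exists_partial V hV a f).choose_spec

/-- The partial derivative as a linear map. -/
def partialL (a : Fin (n + m)) : 𝒪.sec V →ₗ[K] 𝒪.sec V where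
  toFun := x.partialDeriv V hV a
  map_add' f g := x.coeff_injective V hV (by
    rw [map_add, coeff_partialDeriv, coeff_partialDeriv, coeff_partialDeriv, map_add, map_add])
  map_smul' c f := x.coeff_injective V hV (by
    rw [RingHom.id_apply, map_smul, coeff_partialDeriv, coeff_partialDeriv, map_smul, map_smul])

theorem partialL_apply (a : Fin (n + m)) (f : 𝒪.sec V) :
    x.partialL V hV a f = x.partialDeriv V hV a f := rfl

theorem partialDeriv_mem (a : Fin (n + m)) {i : G} {f : 𝒪.sec V} (hf : f ∈ 𝒪.deg V i) :
    x.partialDeriv V hV a f ∈ 𝒪.deg V (i - coordDeg n d a) := by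
  refine x.mem_of_coeff_mem V hV ?_
  rw [coeff_partialDeriv]
  exact x.partialSeries_mem V hV a (x.coeff_mem V hV hf)

theorem partialSeries_castAdd (a : Fin n) (c : Series 𝕜 K n m r V) (w : Fin m →₀ ℕ) :
    x.partialSeries V hV (Fin.castAdd m a) c w =
      chartPartial x.chart x.chart_mem V (x.le_source V hV) a (c w) := by
  simp [partialSeries]

theorem partialSeries_natAdd (b : Fin m) (c : Series 𝕜 K n m r V) :
    x.partialSeries V hV (Fin.natAdd n b) c = formalPartial ρ d V b c := by
  simp [partialSeries]

theorem partialDeriv_mul (a : Fin (n + m)) {i : G} {f : 𝒪.sec V} (hf : f ∈ 𝒪.deg V i)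
    (g : 𝒪.sec V) : x.partialDeriv V hV a (f * g) = x.partialDeriv V hV a f * g +
      ρ (-coordDeg n d a) i • (f * x.partialDeriv V hV a g) := by
  refine x.coeff_injective V hV ?_
  rw [map_add, map_smul, coeff_partialDeriv, x.coeff_mul, x.coeff_mul, x.coeff_mul,
    coeff_partialDeriv, coeff_partialDeriv]
  induction a using Fin.addCases with
  | left a =>
    funext w
    rw [coordDeg_castAdd, neg_zero, ρ.zero_left, one_smul, Pi.add_apply]
    simp only [partialSeries_castAdd]
    by_cases hw : Admissible ρ d w
    · rw [seriesMul_of_admissible ρ d hw, seriesMul_of_admissible ρ d hw,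
        seriesMul_of_admissible ρ d hw, map_sum, ← Finset.sum_add_distrib]
      refine Finset.sum_congr rfl fun q _ => ?_
      rw [map_smul, chartPartial_mul, smul_add, partialSeries_castAdd, partialSeries_castAdd]
    · rw [seriesMul_of_not_admissible ρ d hw, seriesMul_of_not_admissible ρ d hw,
        seriesMul_of_not_admissible ρ d hw, map_zero, add_zero]
  | right b =>
    simp only [partialSeries_natAdd, coordDeg_natAdd]
    exact formalPartial_seriesMul ρ d b (x.coeff_mem V hV hf)
      fun w hw => x.coeff_admissible V hV hw

theorem partialDeriv_res {W : Opens M} (h : W ≤ V) (a : Fin (n + m)) (f : 𝒪.sec V) :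
    x.partialDeriv W (h.trans hV) a (𝒪.res h f) = 𝒪.res h (x.partialDeriv V hV a f) := by
  refine x.coeff_injective W (h.trans hV) ?_
  funext w
  rw [x.coeff_res V W hV h, coeff_partialDeriv, coeff_partialDeriv]
  induction a using Fin.addCases with
  | left a =>
    rw [partialSeries_castAdd, partialSeries_castAdd, x.coeff_res V W hV h, ← chartPartial_res]
  | right b =>
    rw [partialSeries_natAdd, partialSeries_natAdd]
    simp only [formalPartial, LinearMap.coe_mk, AddHom.coe_mk, x.coeff_res V W hV h, Fun.res_smul]

theorem partialDeriv_const_natAdd (b : Fin m) (φ : Fun 𝕜 K n r V) :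
    x.partialDeriv V hV (Fin.natAdd n b) (x.const V hV φ) = 0 := by
  refine x.coeff_injective V hV ?_
  rw [coeff_partialDeriv, partialSeries_natAdd, coeff_const, map_zero]
  funext w
  have : w + Finsupp.single b 1 ≠ 0 := fun h => by
    have := congrArg (fun v => v b) h
    simp at this
  simp [formalPartial, this]

theorem partialDeriv_const_castAdd (a : Fin n) (φ : Fun 𝕜 K n r V) :
    x.partialDeriv V hV (Fin.castAdd m a) (x.const V hV φ) =
      x.const V hV (chartPartial x.chart x.chart_mem V (x.le_source V hV) a φ) := by
  refine x.coeff_injective V hV ?_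
  funext w
  rw [coeff_partialDeriv, partialSeries_castAdd, coeff_const, coeff_const]
  by_cases hw : w = 0
  · subst hw; simp
  · simp [hw]

theorem partialDeriv_fn (a b : Fin (n + m)) :
    x.partialDeriv V hV a (x.fn V hV b) = if a = b then 1 else 0 := by
  induction b using Fin.addCases with
  | left b =>
    rw [fn_castAdd]
    induction a using Fin.addCases with
    | left a =>
      rw [partialDeriv_const_castAdd, chartPartial_chartCoord]
      by_cases hab : a = b
      · subst hab; simp [const_one]
      · have : x.const V hV 0 = 0 := (x.constL V hV).map_zero
        simp [hab, this]
    | right a =>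
      rw [partialDeriv_const_natAdd, if_neg]
      intro h
      have := congrArg Fin.val h
      simp at this
      omega
  | right b =>
    refine x.coeff_injective V hV ?_
    funext w
    rw [coeff_partialDeriv]
    induction a using Fin.addCases with
    | left a =>
      rw [partialSeries_castAdd, coeff_fn_natAdd, if_neg, map_zero]
      · by_cases hw : w = Finsupp.single b 1
        · subst hw; simp [chartPartial_one]
        · simp [hw]
      · intro h
        have := congrArg Fin.val h
        simp at this
        omega
    | right a =>
      rw [partialSeries_natAdd, coeff_fn_natAdd]
      have h0 : formalPartial ρ d V a (Pi.single (Finsupp.single b 1) 1 : Series 𝕜 K n m r V) w =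
          (((w a : K) + 1) * ρ (-d a) (degBelow d a w)) •
          (Pi.single (Finsupp.single b 1) 1 : Series 𝕜 K n m r V) (w + Finsupp.single a 1) := rfl
      rw [h0]
      by_cases hab : a = b
      · subst hab
        rw [if_pos rfl, x.coeff_one]
        by_cases hw : w = 0
        · subst hw; simp [degBelow]
        · simp [hw]
      · have h1 : w + Finsupp.single a 1 ≠ Finsupp.single b 1 := fun h => by
          have := congrArg (fun v => v a) h
          simp [Finsupp.single_eq_of_ne hab] at this
        have h2 : Fin.natAdd n a ≠ Fin.natAdd n b := by simpa using hab
        rw [Pi.single_eq_of_ne h1, if_neg h2, smul_zero, map_zero]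
        rfl

end Coord

end Coordinates

/-! ### Local derivations of the structure sheaf -/

/-- A derivation of degree `q` of the restriction of the sheaf `𝒪` to the open set `U`. -/
structure LocalDer {K : Type*} [RCLike K] {M : Type u} [TopologicalSpace M]
    {G : Type*} [AddCommGroup G] [DecidableEq G] {ρ : CommutationFactor K G}
    (𝒪 : RhoSheaf.{u, w} ρ M) (U : Opens M) (q : G) where
  app : ∀ V ≤ U, 𝒪.sec V →ₗ[K] 𝒪.sec V
  app_mem : ∀ V hV i f, f ∈ 𝒪.deg V i → app V hV f ∈ 𝒪.deg V (i + q)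
  leibniz : ∀ V hV, IsRhoLeibniz ρ (𝒪.deg V) q (app V hV)
  app_res : ∀ V W (hV : V ≤ U) (h : W ≤ V) f,
    app W (h.trans hV) (𝒪.res h f) = 𝒪.res h (app V hV f)

section Coordinates

variable {𝕜 : Type*} [RCLike 𝕜] {K : Type*} [RCLike K] [NormedAlgebra 𝕜 K] {n m : ℕ}
  {r : Regularity} {M : Type u} [TopologicalSpace M] [ChartedSpace (Model 𝕜 n) M]
  [IsManifold 𝓘(𝕜, Model 𝕜 n) r.order M]
  {G : Type*} [AddCommGroup G] [DecidableEq G] {ρ : CommutationFactor K G} {d : Fin m → G}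
  {𝒪 : RhoSheaf.{u, w} ρ M} {U : Opens M} {q : G}

/-- The restriction of a vector field to an open set. -/
def VectorField.local (X : VectorField 𝒪) (U : Opens M) : LocalDer 𝒪 U X.degree where
  app V _ := X.app V
  app_mem V _ := X.app_mem V
  leibniz V _ := X.leibniz V
  app_res _ _ _ h := X.app_res h

namespace LocalDer

/-- The difference of two derivations of the same degree. -/
protected def sub (D E : LocalDer 𝒪 U q) : LocalDer 𝒪 U q where
  app V hV := D.app V hV - E.app V hV
  app_mem V hV i f hf := Submodule.sub_mem _ (D.app_mem V hV i f hf) (E.app_mem V hV i f hf)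
  leibniz V hV i f g hf := by
    simp only [LinearMap.sub_apply]
    rw [D.leibniz V hV i f g hf, E.leibniz V hV i f g hf, sub_mul, mul_sub, smul_sub]
    abel
  app_res V W hV h f := by
    rw [LinearMap.sub_apply, LinearMap.sub_apply, D.app_res V W hV h, E.app_res V W hV h, map_sub]

/-- The commutator `D E - ρ(q, e) E D` of derivations of degrees `q` and `e`. -/
def bracket {e : G} (D : LocalDer 𝒪 U q) (E : LocalDer 𝒪 U e) : LocalDer 𝒪 U (q + e) where
  app V hV := (D.app V hV).comp (E.app V hV) - ρ q e • (E.app V hV).comp (D.app V hV)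
  app_mem V hV i f hf := by
    have h1 := D.app_mem V hV _ _ (E.app_mem V hV i f hf)
    have h2 := E.app_mem V hV _ _ (D.app_mem V hV i f hf)
    rw [add_assoc, add_comm e q] at h1
    rw [add_assoc] at h2
    exact Submodule.sub_mem _ h1 (Submodule.smul_mem _ _ h2)
  leibniz V hV i f g hf := by
    simp only [LinearMap.sub_apply, LinearMap.smul_apply, LinearMap.comp_apply]
    rw [E.leibniz V hV i f g hf, D.leibniz V hV i f g hf, map_add, map_add, map_smul, map_smul,
      D.leibniz V hV _ _ g (E.app_mem V hV i f hf), D.leibniz V hV i f _ hf,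
      E.leibniz V hV _ _ g (D.app_mem V hV i f hf), E.leibniz V hV i f _ hf,
      ρ.add_right, ρ.add_right, ρ.swap q e, ρ.add_left]
    have h := ρ.ne_zero q e
    simp only [sub_mul, mul_sub, smul_sub, smul_add, smul_smul, smul_mul_assoc, mul_smul_comm]
    have h1 : ρ q e * (ρ e i * (ρ q e)⁻¹) = ρ e i := by field_simp
    have h2 : ρ q e * (ρ e i * ρ q i) = ρ q e * (ρ q i * ρ e i) := by ring
    have h3 : ρ e i * ρ q i = ρ q i * ρ e i := by ring
    have h4 : ρ q e * ρ q i = ρ q i * ρ q e := by ring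
    have h5 : ρ q i * ρ e i * ρ q e = ρ q e * (ρ q i * ρ e i) := by ring
    rw [h1, h3, h4, h5]
    abel
  app_res V W hV h f := by
    simp only [LinearMap.sub_apply, LinearMap.smul_apply, LinearMap.comp_apply, map_sub, map_smul]
    rw [D.app_res V W hV h, E.app_res V W hV h, D.app_res V W hV h, E.app_res V W hV h]

theorem app_one (D : LocalDer 𝒪 U q) (V : Opens M) (hV : V ≤ U) : D.app V hV 1 = 0 :=
  (D.leibniz V hV).map_one

end LocalDer

namespace Coord

variable (x : Coord 𝕜 n r d 𝒪)

/-- The partial derivative as a derivation over the domain of the coordinates. -/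
def partialDer (U : Opens M) (hU : U ≤ x.dom) (a : Fin (n + m)) :
    LocalDer 𝒪 U (-coordDeg n d a) where
  app V hV := x.partialL V (hV.trans hU) a
  app_mem V hV i f hf := by
    rw [← sub_eq_add_neg]; exact x.partialDeriv_mem V _ a hf
  leibniz V hV i f g hf := x.partialDeriv_mul V _ a hf g
  app_res V W hV h f := x.partialDeriv_res V _ h a f

/-- The derivation `∑ a, X^a ∂_a`. -/
def ofComponents (U : Opens M) (hU : U ≤ x.dom) (X : Fin (n + m) → 𝒪.sec U)
    (hX : ∀ a, X a ∈ 𝒪.deg U (coordDeg n d a + q)) : LocalDer 𝒪 U q where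
  app V hV := ∑ a, (LinearMap.mulLeft K (𝒪.res hV (X a))).comp (x.partialL V (hV.trans hU) a)
  app_mem V hV i f hf := by
    simp only [LinearMap.sum_apply, LinearMap.comp_apply, LinearMap.mulLeft_apply]
    refine Submodule.sum_mem _ fun a _ => ?_
    have h := SetLike.mul_mem_graded (𝒪.res_mem hV _ _ (hX a)) (x.partialDeriv_mem V (hV.trans hU) a hf)
    rwa [show coordDeg n d a + q + (i - coordDeg n d a) = i + q by abel] at h
  leibniz V hV i f g hf := by
    simp only [LinearMap.sum_apply, LinearMap.comp_apply, LinearMap.mulLeft_apply,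
      partialL_apply, Finset.sum_mul, Finset.mul_sum, Finset.smul_sum, ← Finset.sum_add_distrib]
    refine Finset.sum_congr rfl fun a _ => ?_
    rw [x.partialDeriv_mul V _ a hf, mul_add, mul_assoc, mul_smul_comm, ← mul_assoc _ f,
      𝒪.comm V _ _ _ _ (𝒪.res_mem hV _ _ (hX a)) hf, smul_mul_assoc, smul_smul, mul_assoc,
      ρ.add_left, ρ.neg_left, inv_mul_cancel_left₀ (ρ.ne_zero _ _)]
  app_res V W hV h f := by
    simp only [LinearMap.sum_apply, LinearMap.comp_apply, LinearMap.mulLeft_apply, map_sum,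
      partialL_apply, map_mul, 𝒪.res_res, x.partialDeriv_res V (hV.trans hU) h]

theorem ofComponents_app (hU : U ≤ x.dom) (X : Fin (n + m) → 𝒪.sec U)
    (hX : ∀ a, X a ∈ 𝒪.deg U (coordDeg n d a + q)) (f : 𝒪.sec U) :
    (x.ofComponents U hU X hX).app U le_rfl f = ∑ a, X a * x.partialDeriv U hU a f := by
  simp [ofComponents, partialL_apply, 𝒪.res_refl]

/-- The value at `p` of a coefficient can be computed after restriction to a neighbourhood. -/
theorem coeff_res_apply {V W : Opens M} (hV : V ≤ x.dom) (h : W ≤ V) (f : 𝒪.sec V) (w : Fin m →₀ ℕ)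
    (p : M) (hp : p ∈ W) : (x.coeff W (h.trans hV) (𝒪.res h f) w).1 ⟨p, hp⟩ =
      (x.coeff V hV f w).1 ⟨p, h hp⟩ := by
  rw [x.coeff_res V W hV h]; rfl

/-- A derivation that kills the coordinates of the manifold kills its functions, because a
function is, near a point, its value plus an element of the ideal generated by the differences
of the coordinates and their values. -/
theorem app_const_eq_zero (D : LocalDer 𝒪 U q) (hU : U ≤ x.dom)
    (h : ∀ a, D.app U le_rfl (x.fn U hU a) = 0) (V : Opens M) (hV : V ≤ U) (φ : Fun 𝕜 K n r V) :
    D.app V hV (x.const V (hV.trans hU) φ) = 0 := by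
  refine x.coeff_injective V (hV.trans hU) ?_
  rw [map_zero]
  funext w
  refine Subtype.ext (funext fun p => ?_)
  obtain ⟨W, hW, hpW, g, hg⟩ :=
    exists_chart_slope x.chart x.chart_mem V (x.le_source V (hV.trans hU)) φ p
  have hWx := (hW.trans hV).trans hU
  have hfn : ∀ a : Fin n, D.app W (hW.trans hV) (x.const W hWx
      (chartCoord x.chart x.chart_mem W (x.le_source W hWx) a)) = 0 := fun a => by
    rw [← fn_castAdd, ← x.fn_res U hU (hW.trans hV), D.app_res U W le_rfl (hW.trans hV), h, map_zero]
  have hc : ∀ c : K, D.app W (hW.trans hV) (x.const W hWx (algebraMap K _ c)) = 0 := fun c => by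
    rw [const_algebraMap, map_smul, D.app_one, smul_zero]
  rw [← x.coeff_res_apply (hV.trans hU) hW _ w p.1 hpW, ← D.app_res V W hV hW, x.const_res V _ hW, hg]
  change (x.coeff W hWx (D.app W _ (x.constL W hWx _)) w).1 _ = 0
  simp only [map_add, map_sum]
  change (x.coeff W hWx (D.app W _ (x.const W hWx (algebraMap K _ (φ.1 p)))) w +
    (∑ a, x.coeff W hWx (D.app W _ (x.const W hWx _))) w).1 _ = 0
  rw [hc, map_zero, Pi.zero_apply, zero_add, Finset.sum_apply, AddSubmonoidClass.coe_finsetSum,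
    Finset.sum_apply]
  refine Finset.sum_eq_zero fun a _ => ?_
  have hsub : D.app W (hW.trans hV) (x.const W hWx
      (chartCoord x.chart x.chart_mem W (x.le_source W hWx) a -
          algebraMap K _ (algebraMap 𝕜 K (x.chart p.1 a)))) = 0 := by
    change D.app W _ (x.constL W hWx _) = 0
    rw [map_sub, map_sub]
    exact (congrArg₂ _ (hfn a) (hc _)).trans (sub_zero _)
  rw [const_mul, D.leibniz W _ 0 _ _ (x.const_mem W hWx _), hsub, zero_mul, zero_add,
    ρ.zero_right, one_smul, coeff_const_mul]
  change ((algebraMap 𝕜 K (x.chart p.1 a)) - (algebraMap 𝕜 K (x.chart p.1 a))) * _ = 0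
  rw [sub_self, zero_mul]

/-- A derivation that kills the coordinates is zero: the coefficients of `D f` vanish by induction
on their order, because `D` maps `x^b h` to a multiple of `x^b (D h)`. -/
theorem app_eq_zero (D : LocalDer 𝒪 U q) (hU : U ≤ x.dom)
    (h : ∀ a, D.app U le_rfl (x.fn U hU a) = 0) (V : Opens M) (hV : V ≤ U) (f : 𝒪.sec V) :
    D.app V hV f = 0 := by
  have key : ∀ N : ℕ, ∀ w : Fin m →₀ ℕ, w.degree = N → ∀ i, ∀ f ∈ 𝒪.deg V i,
      x.coeff V (hV.trans hU) (D.app V hV f) w = 0 := by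
    intro N
    induction N using Nat.strong_induction_on with
    | h N ih =>
      intro w hw i f hf
      obtain ⟨g, hg, hfg, -⟩ := x.exists_eq_const_add_sum V (hV.trans hU) hf
      rw [hfg, map_add, x.app_const_eq_zero D hU h, zero_add, map_sum, map_sum, Finset.sum_apply]
      refine Finset.sum_eq_zero fun b _ => ?_
      have hb : D.app V hV (x.fn V (hV.trans hU) (Fin.natAdd n b)) = 0 := by
        rw [← x.fn_res U hU hV, D.app_res U V le_rfl hV, h, map_zero]
      rw [D.leibniz V hV _ _ _ (x.fn_mem V (hV.trans hU) (Fin.natAdd n b)), hb, zero_mul, zero_add,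
        map_smul, Pi.smul_apply]
      by_cases hwb : w b = 0
      · rw [coeff_fn_mul_of_eq_zero _ _ _ _ _ hwb, smul_zero]
      have hwv : w = (w - Finsupp.single b 1) + Finsupp.single b 1 :=
        (tsub_add_cancel_of_le (Finsupp.single_le_iff.2 (Nat.one_le_iff_ne_zero.2 hwb))).symm
      by_cases hadm : Admissible ρ d w
      · set v := w - Finsupp.single b 1
        have hv : v.degree < N := by
          rw [hwv, map_add, Finsupp.degree_single] at hw
          omega
        rw [hwv, coeff_fn_mul _ _ _ _ _ (hwv ▸ hadm), ih _ hv v rfl _ _ (hg b), smul_zero, smul_zero]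
      · have h0 : x.coeff V (hV.trans hU)
            (x.fn V (hV.trans hU) (Fin.natAdd n b) * D.app V hV (g b)) w = 0 := by
          by_contra hne
          exact hadm (x.coeff_admissible V _ hne)
        rw [h0, smul_zero]
  induction f using DirectSum.Decomposition.inductionOn (𝒪.deg V) with
  | zero => exact map_zero _
  | @homogeneous i f =>
    refine x.coeff_injective V (hV.trans hU) ?_
    rw [map_zero]
    funext w
    exact key _ w rfl i f f.2
  | add f g hf hg => rw [map_add, hf, hg, add_zero]

/-- A derivation is `∑ a, D(x^a) ∂_a`. -/
theorem app_eq_sum (D : LocalDer 𝒪 U q) (hU : U ≤ x.dom) (f : 𝒪.sec U) :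
    D.app U le_rfl f = ∑ a, D.app U le_rfl (x.fn U hU a) * x.partialDeriv U hU a f := by
  have hX : ∀ a, D.app U le_rfl (x.fn U hU a) ∈ 𝒪.deg U (coordDeg n d a + q) := fun a =>
    D.app_mem U le_rfl _ _ (x.fn_mem U hU a)
  rw [← x.ofComponents_app hU _ hX, ← sub_eq_zero]
  refine x.app_eq_zero (D.sub (x.ofComponents U hU _ hX)) hU (fun a => ?_) U le_rfl f
  change D.app U le_rfl _ - (x.ofComponents U hU _ hX).app U le_rfl _ = 0
  rw [ofComponents_app, Finset.sum_eq_single a, x.partialDeriv_fn, if_pos rfl, mul_one, sub_self]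
  · intro b _ hb
    rw [x.partialDeriv_fn, if_neg hb, mul_zero]
  · intro h; exact absurd (Finset.mem_univ _) h

/-- The chain rule. -/
theorem partialDeriv_eq_sum (y : Coord 𝕜 n r d 𝒪) (hx : U ≤ x.dom) (hy : U ≤ y.dom)
    (b : Fin (n + m)) (f : 𝒪.sec U) : x.partialDeriv U hx b f =
      ∑ a, x.jacobian U hx y hy b a * y.partialDeriv U hy a f :=
  y.app_eq_sum (x.partialDer U hx b) hy f

/-- The Jacobian matrices of a change of coordinates and of its inverse are inverse to each other. -/
theorem jacobian_mul_jacobian (y : Coord 𝕜 n r d 𝒪) (hx : U ≤ x.dom) (hy : U ≤ y.dom) :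
    x.jacobian U hx y hy * y.jacobian U hy x hx = 1 := by
  ext b c
  rw [Matrix.mul_apply, Matrix.one_apply, ← x.partialDeriv_fn U hx]
  exact (x.partialDeriv_eq_sum y hx hy b _).symm

/-- The matrix `∂_b D(x^e)` of a derivation. -/
def derMatrix (U : Opens M) (hU : U ≤ x.dom) (D : LocalDer 𝒪 U q) :
    Matrix (Fin (n + m)) (Fin (n + m)) (𝒪.sec U) :=
  Matrix.of fun b e => x.partialDeriv U hU b (D.app U le_rfl (x.fn U hU e))

theorem derMatrix_mem (hU : U ≤ x.dom) (D : LocalDer 𝒪 U q) (b e : Fin (n + m)) :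
    x.derMatrix U hU D b e ∈ 𝒪.deg U (-coordDeg n d b - -coordDeg n d e + q) := by
  have h := x.partialDeriv_mem U hU b (D.app_mem U le_rfl _ _ (x.fn_mem U hU e))
  rwa [show coordDeg n d e + q - coordDeg n d b = -coordDeg n d b - -coordDeg n d e + q by abel] at h

theorem jacobian_mem (y : Coord 𝕜 n r d 𝒪) (hx : U ≤ x.dom) (hy : U ≤ y.dom)
    (b a : Fin (n + m)) :
    x.jacobian U hx y hy b a ∈ 𝒪.deg U (-coordDeg n d b - -coordDeg n d a) := by
  have h := x.partialDeriv_mem U hx b (y.fn_mem U hy a)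
  rwa [show coordDeg n d a - coordDeg n d b = -coordDeg n d b - -coordDeg n d a by abel] at h

/-- Commutation of a derivation with the partial derivatives: their commutator is a derivation, so
it is determined by its values on the coordinates. -/
theorem app_partialDeriv (D : LocalDer 𝒪 U q) (hU : U ≤ x.dom) (b : Fin (n + m)) (f : 𝒪.sec U) :
    D.app U le_rfl (x.partialDeriv U hU b f) = ρ q (-coordDeg n d b) •
      (x.partialDeriv U hU b (D.app U le_rfl f) -
        ∑ e, x.derMatrix U hU D b e * x.partialDeriv U hU e f) := by
  have h := x.app_eq_sum (D.bracket (x.partialDer U hU b)) hU f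
  have h1 : ∀ g, (D.bracket (x.partialDer U hU b)).app U le_rfl g =
      D.app U le_rfl (x.partialDeriv U hU b g) -
        ρ q (-coordDeg n d b) • x.partialDeriv U hU b (D.app U le_rfl g) := fun g => rfl
  have h2 : ∀ e, (D.bracket (x.partialDer U hU b)).app U le_rfl (x.fn U hU e) =
      -(ρ q (-coordDeg n d b) • x.derMatrix U hU D b e) := fun e => by
    have h0 : D.app U le_rfl (if b = e then 1 else 0) = 0 := by
      split_ifs
      · exact D.app_one U le_rfl
      · exact map_zero _
    rw [h1, x.partialDeriv_fn, h0, zero_sub]; rfl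
  rw [h1, sub_eq_iff_eq_add] at h
  rw [h, smul_sub, Finset.smul_sum, sub_eq_add_neg, add_comm, ← Finset.sum_neg_distrib]
  congr 1
  refine Finset.sum_congr rfl fun e _ => ?_
  rw [h2, neg_mul, smul_mul_assoc]

/-- The twisted derivative of the Jacobian matrix `J` is `J P_y - P_x J`, by the commutation with
the partial derivatives and the chain rule. -/
theorem hasMatrixDeriv_jacobian (D : LocalDer 𝒪 U q) (y : Coord 𝕜 n r d 𝒪) (hx : U ≤ x.dom)
    (hy : U ≤ y.dom) :
    HasMatrixDeriv ρ q (D.app U le_rfl) (fun k => -coordDeg n d k) (x.jacobian U hx y hy)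
      (x.jacobian U hx y hy * y.derMatrix U hy D - x.derMatrix U hx D * x.jacobian U hx y hy) := by
  intro b a
  refine (x.app_partialDeriv D hx b (y.fn U hy a)).trans ?_
  rw [x.partialDeriv_eq_sum y hx hy b (D.app U le_rfl _)]
  rfl

/-- The divergence of a derivation with respect to the coordinate frame `D(x)`. -/
def coordDiv (U : Opens M) (hU : U ≤ x.dom) (D : LocalDer 𝒪 U q) : 𝒪.sec U :=
  rhoTrace ρ (fun k => -coordDeg n d k) q (x.derMatrix U hU D)

theorem coordDiv_eq (hU : U ≤ x.dom) (D : LocalDer 𝒪 U q) : x.coordDiv U hU D =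
    ∑ a, ρ (coordDeg n d a) (coordDeg n d a + q) •
      x.partialDeriv U hU a (D.app U le_rfl (x.fn U hU a)) := by
  unfold coordDiv rhoTrace
  refine Finset.sum_congr rfl fun a _ => ?_
  rw [ρ.neg_left, ρ.neg_right, ρ.neg_right, inv_inv, ρ.add_right, ρ.swap (coordDeg n d a) q, inv_inv]
  rfl

/-- The logarithmic derivative of the Berezinian of a change of coordinates. -/
theorem app_rhoBer_jacobian (D : LocalDer 𝒪 U q) (y : Coord 𝕜 n r d 𝒪) (hx : U ≤ x.dom)
    (hy : U ≤ y.dom)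
    (hu : IsUnit (rhoBer ρ (fun k => -coordDeg n d k) (x.jacobian U hx y hy))) :
    D.app U le_rfl (rhoBer ρ (fun k => -coordDeg n d k) (x.jacobian U hx y hy)) =
      rhoBer ρ (fun k => -coordDeg n d k) (x.jacobian U hx y hy) *
        (y.coordDiv U hy D - x.coordDiv U hx D) := by
  set J := x.jacobian U hx y hy
  set J' := y.jacobian U hy x hx
  set Px := x.derMatrix U hx D
  set Py := y.derMatrix U hy D
  have hJJ' : J * J' = 1 := x.jacobian_mul_jacobian y hx hy
  have hPJ : ∀ k l, (Px * J) k l ∈ 𝒪.deg U (-coordDeg n d k - -coordDeg n d l + q) := fun k l => by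
    have h := matrix_mul_mem (I := fun k => -coordDeg n d k) (J := fun k => -coordDeg n d k)
      (L := fun k => -coordDeg n d k) (a := q) (b := 0)
      (x.derMatrix_mem hx D) (fun k l => by simpa using x.jacobian_mem y hx hy k l) k l
    simpa using h
  have hJ' : ∀ k l, J' k l ∈ 𝒪.deg U (-coordDeg n d k - -coordDeg n d l + 0) := fun k l => by
    simpa using y.jacobian_mem x hy hx k l
  have hJPJ : ∀ k l, (J' * (Px * J)) k l ∈ 𝒪.deg U (-coordDeg n d k - -coordDeg n d l + q) :=
    fun k l => by
    have h := matrix_mul_mem (I := fun k => -coordDeg n d k) (J := fun k => -coordDeg n d k)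
      (L := fun k => -coordDeg n d k) hJ' hPJ k l
    simpa using h
  have hD := x.hasMatrixDeriv_jacobian D y hx hy
  have hY : J * Py - Px * J = J * (Py - J' * (Px * J)) := by
    rw [Matrix.mul_sub, ← Matrix.mul_assoc J J', hJJ', Matrix.one_mul]
  have htr : rhoTrace ρ (fun k => -coordDeg n d k) q (J' * (Px * J)) = x.coordDiv U hx D := by
    have h := rhoTrace_mul_comm (𝒪.isRhoComm U) (I := fun k => -coordDeg n d k)
      (J := fun k => -coordDeg n d k) hJ' hPJ
    rw [zero_add, ρ.zero_left, one_smul, Matrix.mul_assoc, hJJ', Matrix.mul_one] at h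
    exact h
  rw [map_rhoBer (Y := Py - J' * (Px * J)) (𝒪.isRhoComm U) (D.leibniz U le_rfl)
    (x.jacobian_mem y hx hy) (fun k l => Submodule.sub_mem _ (y.derMatrix_mem hy D k l) (hJPJ k l)) (hY ▸ hD) hu,
    rhoTrace_sub, htr]
  rfl

end Coord

end Coordinates

/-! ### Logarithmic derivatives -/

section LogDeriv

variable {K : Type*} {G : Type*} [Field K] [AddCommGroup G] [DecidableEq G]
  {ρ : CommutationFactor K G} {A : Type*} [Ring A] [Algebra K A] {𝒜 : G → Submodule K A}
  [GradedAlgebra 𝒜]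

theorem ringInverse_mem_zero {s : A} (hs : s ∈ 𝒜 0) (hu : IsUnit s) : Ring.inverse s ∈ 𝒜 0 :=
  inverse_mem_zero hs (Ring.mul_inverse_cancel s hu) (Ring.inverse_mul_cancel s hu)

/-- The logarithmic derivative `s⁻¹ D(s)`. -/
def logDeriv (D : A →ₗ[K] A) (s : A) : A := Ring.inverse s * D s

theorem mul_logDeriv (D : A →ₗ[K] A) {s : A} (hu : IsUnit s) : s * logDeriv D s = D s := by
  rw [logDeriv, ← mul_assoc, Ring.mul_inverse_cancel s hu, one_mul]

theorem logDeriv_eq_iff (D : A →ₗ[K] A) {s g : A} (hu : IsUnit s) :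
    logDeriv D s = g ↔ D s = s * g := by
  rw [← hu.mul_right_inj, mul_logDeriv D hu]

theorem logDeriv_mem {q : G} {D : A →ₗ[K] A} (hq : ∀ i f, f ∈ 𝒜 i → D f ∈ 𝒜 (i + q)) {s : A}
    (hs : s ∈ 𝒜 0) (hu : IsUnit s) : logDeriv D s ∈ 𝒜 q := by
  have h := SetLike.mul_mem_graded (ringInverse_mem_zero hs hu) (hq 0 s hs)
  rwa [zero_add, zero_add] at h

theorem logDeriv_mul (hc : IsRhoComm ρ 𝒜) {q : G} {D : A →ₗ[K] A} (hD : IsRhoLeibniz ρ 𝒜 q D)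
    {s t : A} (hs : s ∈ 𝒜 0) (ht : t ∈ 𝒜 0) (hus : IsUnit s) (hut : IsUnit t) :
    logDeriv D (s * t) = logDeriv D s + logDeriv D t := by
  rw [logDeriv_eq_iff D (hus.mul hut), hD 0 s t hs, ρ.zero_right, one_smul, mul_add, mul_assoc s t,
    mul_assoc s t, hc.zero_comm_all ht (logDeriv D s), mul_logDeriv D hut, ← mul_assoc,
    mul_logDeriv D hus]

/-- The logarithmic derivative `u` of `s` under an odd derivation of square zero is closed: it is odd,
hence `u² = 0`, and `0 = D (s u) = s u² + s (D u)`. -/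
theorem map_logDeriv [CharZero K] (hc : IsRhoComm ρ 𝒜) {q : G} {D : A →ₗ[K] A}
    (hD : IsRhoLeibniz ρ 𝒜 q D) (hq : ∀ i f, f ∈ 𝒜 i → D f ∈ 𝒜 (i + q)) (hodd : ρ q q = -1)
    (hDD : ∀ f, D (D f) = 0) {s : A} (hs : s ∈ 𝒜 0) (hu : IsUnit s) : D (logDeriv D s) = 0 := by
  have h1 := hDD s
  have hmem := logDeriv_mem hq hs hu
  rw [← mul_logDeriv D hu, hD 0 s _ hs, ρ.zero_right, one_smul] at h1
  have h2 : logDeriv D s * logDeriv D s = 0 := by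
    have h := hc q q _ _ hmem hmem
    rw [hodd, neg_one_smul] at h
    rw [eq_neg_iff_add_eq_zero, ← two_smul K] at h
    exact (smul_eq_zero_iff_right two_ne_zero).1 h
  rw [← mul_logDeriv D hu, mul_assoc, h2, mul_zero, zero_add] at h1
  exact (hu.mul_right_eq_zero).1 h1

end LogDeriv

section Coordinates

variable {𝕜 : Type*} [RCLike 𝕜] {K : Type*} [RCLike K] [NormedAlgebra 𝕜 K] {n m : ℕ}
  {r : Regularity} {M : Type u} [TopologicalSpace M] [ChartedSpace (Model 𝕜 n) M]
  [IsManifold 𝓘(𝕜, Model 𝕜 n) r.order M]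
  {G : Type*} [AddCommGroup G] [DecidableEq G] {ρ : CommutationFactor K G} {d : Fin m → G}

/-! ### Gluing over coordinate domains -/

section Glue

variable (𝓜 : RhoManifold.{u, w} 𝕜 n r M ρ d)

/-- Homogeneous sections that agree in all coordinates are equal. -/
theorem RhoManifold.ext_coord {i : G} {W : Opens M} {f g : 𝓜.sec W} (hf : f ∈ 𝓜.deg W i)
    (hg : g ∈ 𝓜.deg W i)
    (h : ∀ x : Coord 𝕜 n r d 𝓜.toRhoSheaf, 𝓜.res (inf_le_left : W ⊓ x.dom ≤ W) f =
      𝓜.res (inf_le_left : W ⊓ x.dom ≤ W) g) : f = g := by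
  choose x hx using 𝓜.exists_coord
  have key := 𝓜.glue i W M (fun p => W ⊓ (x p).dom) (fun p => inf_le_left)
    (fun p hp => ⟨p, hp, hx p⟩) (fun p => 𝓜.res inf_le_left g)
    (fun p => 𝓜.res_mem _ _ _ hg) (fun p p' => by rw [𝓜.res_res, 𝓜.res_res])
  exact key.unique ⟨hf, fun p => h (x p)⟩ ⟨hg, fun p => rfl⟩

/-- Homogeneous sections on the coordinate domains that agree on the overlaps come from a global
section. -/
theorem RhoManifold.exists_glue {i : G} (g : ∀ x : Coord 𝕜 n r d 𝓜.toRhoSheaf, 𝓜.sec x.dom)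
    (hg : ∀ x, g x ∈ 𝓜.deg x.dom i)
    (h : ∀ x y : Coord 𝕜 n r d 𝓜.toRhoSheaf,
      𝓜.res (inf_le_left : x.dom ⊓ y.dom ≤ x.dom) (g x) =
        𝓜.res (inf_le_right : x.dom ⊓ y.dom ≤ y.dom) (g y)) :
    ∃ f ∈ 𝓜.deg ⊤ i, ∀ x, 𝓜.res le_top f = g x := by
  choose x hx using 𝓜.exists_coord
  obtain ⟨f, ⟨hf, hfg⟩, -⟩ := 𝓜.glue i ⊤ M (fun p => (x p).dom) (fun p => le_top)
    (fun p _ => ⟨p, hx p⟩) (fun p => g (x p)) (fun p => hg _) (fun p p' => h _ _)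
  refine ⟨f, hf, fun y => ?_⟩
  have key := 𝓜.glue i y.dom M (fun p => y.dom ⊓ (x p).dom) (fun p => inf_le_left)
    (fun p hp => ⟨p, hp, hx p⟩) (fun p => 𝓜.res inf_le_left (g y))
    (fun p => 𝓜.res_mem _ _ _ (hg y)) (fun p p' => by rw [𝓜.res_res, 𝓜.res_res])
  refine key.unique ⟨𝓜.res_mem _ _ _ hf, fun p => ?_⟩ ⟨hg y, fun p => rfl⟩
  rw [h y (x p), ← hfg p, 𝓜.res_res, 𝓜.res_res]

end Glue

/-! ### The divergence -/

variable {𝓜 : RhoManifold.{u, w} 𝕜 n r M ρ d}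

theorem RhoSheaf.res_logDeriv {𝒪 : RhoSheaf.{u, w} ρ M} {V W : Opens M} (h : W ≤ V)
    {D : 𝒪.sec V →ₗ[K] 𝒪.sec V} {D' : 𝒪.sec W →ₗ[K] 𝒪.sec W}
    (hD : ∀ f, D' (𝒪.res h f) = 𝒪.res h (D f)) {s : 𝒪.sec V} (hu : IsUnit s) :
    𝒪.res h (logDeriv D s) = logDeriv D' (𝒪.res h s) := by
  symm
  rw [logDeriv_eq_iff _ (hu.map (𝒪.res h)), hD, ← map_mul, mul_logDeriv _ hu]

theorem Coord.res_coordDiv {𝒪 : RhoSheaf.{u, w} ρ M} (X : VectorField 𝒪) (x : Coord 𝕜 n r d 𝒪)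
    {V W : Opens M} (hV : V ≤ x.dom) (h : W ≤ V) : 𝒪.res h (x.coordDiv V hV (X.local V)) =
      x.coordDiv W (h.trans hV) (X.local W) := by
  rw [coordDiv_eq, coordDiv_eq, map_sum]
  refine Finset.sum_congr rfl fun a _ => ?_
  rw [map_smul, ← x.partialDeriv_res V hV h]
  change _ • x.partialDeriv W _ a (𝒪.res h (X.app V _)) = _ • x.partialDeriv W _ a (X.app W _)
  rw [← X.app_res, x.fn_res]

theorem Coord.coordDiv_mem {𝒪 : RhoSheaf.{u, w} ρ M} {U : Opens M} {q : G} (D : LocalDer 𝒪 U q)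
    (x : Coord 𝕜 n r d 𝒪) (hU : U ≤ x.dom) : x.coordDiv U hU D ∈ 𝒪.deg U q := by
  unfold coordDiv rhoTrace
  refine Submodule.sum_mem _ fun k _ => Submodule.smul_mem _ _ ?_
  have h := x.derMatrix_mem hU D k k
  rwa [sub_self, zero_add] at h

/-- The Lie derivative of a section in terms of the divergence with respect to the
coordinate frame. -/
theorem lieDeriv_eq (X : VectorField 𝓜.toRhoSheaf) (s : BerSection 𝓜)
    (x : Coord 𝕜 n r d 𝓜.toRhoSheaf) :
    lieDeriv X s x = x.coordDiv x.dom le_rfl (X.local x.dom) * s.val x + X.app x.dom (s.val x) := by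
  have h1 := x.app_eq_sum (X.local x.dom) le_rfl (s.val x)
  have h2 : X.app x.dom (s.val x) = (X.local x.dom).app x.dom le_rfl (s.val x) := rfl
  rw [h2, h1, Coord.coordDiv_eq, lieDeriv, Finset.sum_mul, ← Finset.sum_add_distrib]
  refine Finset.sum_congr rfl fun a _ => ?_
  rw [x.partialDeriv_mul x.dom le_rfl a (X.app_mem x.dom _ _ (x.fn_mem x.dom le_rfl a)), smul_add,
    smul_smul, ρ.neg_left, mul_inv_cancel₀ (ρ.ne_zero _ _), one_smul, smul_mul_assoc]
  rfl

/-- The divergence with respect to `D(x) s`, where `s` is invertible of degree zero. -/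
def localDiv (vol : VolumeForm 𝓜) (X : VectorField 𝓜.toRhoSheaf)
    (x : Coord 𝕜 n r d 𝓜.toRhoSheaf) : 𝓜.sec x.dom :=
  x.coordDiv x.dom le_rfl (X.local x.dom) + logDeriv (X.app x.dom) (vol.val x)

theorem mul_localDiv (vol : VolumeForm 𝓜) (X : VectorField 𝓜.toRhoSheaf)
    (x : Coord 𝕜 n r d 𝓜.toRhoSheaf) :
    vol.val x * localDiv vol X x = lieDeriv X vol.toBerSection x := by
  rw [lieDeriv_eq X _ x, localDiv, mul_add, mul_logDeriv _ (vol.isUnit x),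
    (𝓜.isRhoComm x.dom).zero_comm_all (vol.deg_zero x)]

theorem localDiv_mem (vol : VolumeForm 𝓜) (X : VectorField 𝓜.toRhoSheaf)
    (x : Coord 𝕜 n r d 𝓜.toRhoSheaf) : localDiv vol X x ∈ 𝓜.deg x.dom X.degree :=
  Submodule.add_mem _ (x.coordDiv_mem _ _)
    (logDeriv_mem (X.app_mem x.dom) (vol.deg_zero x) (vol.isUnit x))

theorem isDivergence_iff {vol : VolumeForm 𝓜} {X : VectorField 𝓜.toRhoSheaf} {g : 𝓜.sec ⊤} :
    IsDivergence vol X g ↔ g ∈ 𝓜.deg ⊤ X.degree ∧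
      ∀ x : Coord 𝕜 n r d 𝓜.toRhoSheaf, 𝓜.res le_top g = localDiv vol X x := by
  refine and_congr_right fun _ => forall_congr' fun x => ?_
  rw [← mul_localDiv, (vol.isUnit x).mul_right_inj]

/-- The transition function of a volume form: it is invertible of degree zero. -/
theorem VolumeForm.rhoBer_jacobian (vol : VolumeForm 𝓜) (x y : Coord 𝕜 n r d 𝓜.toRhoSheaf) :
    IsUnit (rhoBer ρ (fun k => -coordDeg n d k)
      (x.jacobian (x.dom ⊓ y.dom) inf_le_left y inf_le_right)) ∧
    rhoBer ρ (fun k => -coordDeg n d k)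
      (x.jacobian (x.dom ⊓ y.dom) inf_le_left y inf_le_right) ∈ 𝓜.deg (x.dom ⊓ y.dom) 0 := by
  have hx := (vol.isUnit x).map (𝓜.res (inf_le_left : x.dom ⊓ y.dom ≤ x.dom))
  have hy := (vol.isUnit y).map (𝓜.res (inf_le_right : x.dom ⊓ y.dom ≤ y.dom))
  have hxm := 𝓜.res_mem (inf_le_left : x.dom ⊓ y.dom ≤ x.dom) _ _ (vol.deg_zero x)
  have hym := 𝓜.res_mem (inf_le_right : x.dom ⊓ y.dom ≤ y.dom) _ _ (vol.deg_zero y)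
  have ht := vol.transition x y
  set B := rhoBer ρ (fun k => -coordDeg n d k)
    (x.jacobian (x.dom ⊓ y.dom) inf_le_left y inf_le_right)
  have hB : B = 𝓜.res inf_le_left (vol.val x) * Ring.inverse (𝓜.res inf_le_right (vol.val y)) := by
    rw [ht, mul_assoc, Ring.mul_inverse_cancel _ hy, mul_one]
  rw [hB]
  refine ⟨hx.mul (isUnit_ringInverse.2 hy), ?_⟩
  have h := SetLike.mul_mem_graded hxm (ringInverse_mem_zero hym hy)
  rwa [zero_add] at h

/-- The local divergences agree on overlaps: the logarithmic derivative of the transition function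
is the difference of the coordinate divergences. -/
theorem res_localDiv (vol : VolumeForm 𝓜) (X : VectorField 𝓜.toRhoSheaf)
    (x y : Coord 𝕜 n r d 𝓜.toRhoSheaf) :
    𝓜.res (inf_le_left : x.dom ⊓ y.dom ≤ x.dom) (localDiv vol X x) =
      𝓜.res (inf_le_right : x.dom ⊓ y.dom ≤ y.dom) (localDiv vol X y) := by
  obtain ⟨hu, hm⟩ := vol.rhoBer_jacobian x y
  have hy := (vol.isUnit y).map (𝓜.res (inf_le_right : x.dom ⊓ y.dom ≤ y.dom))
  have hym := 𝓜.res_mem (inf_le_right : x.dom ⊓ y.dom ≤ y.dom) _ _ (vol.deg_zero y)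
  rw [localDiv, localDiv, map_add, map_add, x.res_coordDiv X, y.res_coordDiv X,
    𝓜.res_logDeriv _ (X.app_res _) (vol.isUnit x), 𝓜.res_logDeriv _ (X.app_res _) (vol.isUnit y), vol.transition x y,
    logDeriv_mul (𝓜.isRhoComm _) (X.leibniz _) hm hym hu hy, ← add_assoc]
  congr 1
  rw [add_comm, ← eq_sub_iff_add_eq, logDeriv_eq_iff _ hu]
  exact x.app_rhoBer_jacobian (X.local _) y inf_le_left inf_le_right hu

theorem exists_isDivergence (vol : VolumeForm 𝓜) (X : VectorField 𝓜.toRhoSheaf) :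
    ∃ g, IsDivergence vol X g := by
  obtain ⟨g, hg, h⟩ := 𝓜.exists_glue (localDiv vol X) (localDiv_mem vol X) (res_localDiv vol X)
  exact ⟨g, isDivergence_iff.2 ⟨hg, h⟩⟩

/-- Homogeneous global sections that agree on the coordinate domains are equal. -/
theorem RhoManifold.ext_top {i : G} {f g : 𝓜.sec ⊤} (hf : f ∈ 𝓜.deg ⊤ i) (hg : g ∈ 𝓜.deg ⊤ i)
    (h : ∀ x : Coord 𝕜 n r d 𝓜.toRhoSheaf, 𝓜.res (le_top : x.dom ≤ ⊤) f =
      𝓜.res (le_top : x.dom ≤ ⊤) g) : f = g := by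
  refine 𝓜.ext_coord hf hg fun x => ?_
  have hx := congrArg (𝓜.res (inf_le_right : ⊤ ⊓ x.dom ≤ x.dom)) (h x)
  rwa [𝓜.res_res, 𝓜.res_res] at hx

theorem IsDivergence.unique {vol : VolumeForm 𝓜} {X : VectorField 𝓜.toRhoSheaf} {g g' : 𝓜.sec ⊤}
    (h : IsDivergence vol X g) (h' : IsDivergence vol X g') : g = g' := by
  rw [isDivergence_iff] at h h'
  exact RhoManifold.ext_top h.1 h'.1 fun x => (h.2 x).trans (h'.2 x).symm

theorem VectorField.IsHomological.app_app {𝒪 : RhoSheaf.{u, w} ρ M} {Q : VectorField 𝒪}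
    (hQ : Q.IsHomological) (U : Opens M) (f : 𝒪.sec U) : Q.app U (Q.app U f) = 0 := by
  have h := hQ.bracket U f
  rw [hQ.odd, neg_one_smul, sub_neg_eq_add, ← two_smul K] at h
  exact (smul_eq_zero_iff_right two_ne_zero).1 h

/-- The coordinate divergence of a homological vector field is closed, because its derivative is
the graded trace of the square of an odd matrix. -/
theorem Coord.app_coordDiv {𝒪 : RhoSheaf.{u, w} ρ M} {Q : VectorField 𝒪} (hQ : Q.IsHomological)
    (x : Coord 𝕜 n r d 𝒪) {U : Opens M} (hU : U ≤ x.dom) :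
    Q.app U (x.coordDiv U hU (Q.local U)) = 0 := by
  set P := x.derMatrix U hU (Q.local U)
  set q := Q.degree
  have hP := x.derMatrix_mem hU (Q.local U)
  have h1 : Q.app U (x.coordDiv U hU (Q.local U)) =
      -rhoTrace ρ (fun k => -coordDeg n d k) (q + q) (P * P) := by
    rw [coordDiv, rhoTrace, rhoTrace, map_sum, ← Finset.sum_neg_distrib]
    refine Finset.sum_congr rfl fun a _ => ?_
    have h2 := x.app_partialDeriv (Q.local U) hU a (Q.app U (x.fn U hU a))
    have h3 : (Q.local U).app U le_rfl (Q.app U (x.fn U hU a)) = 0 := hQ.app_app U _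
    rw [h3] at h2
    have h4 : x.partialDeriv U hU a 0 = 0 := (x.partialL U hU a).map_zero
    rw [h4, zero_sub, smul_neg] at h2
    rw [map_smul]
    refine (congrArg _ h2).trans ?_
    rw [smul_neg, smul_smul, ρ.add_left, mul_assoc]
    rfl
  have h5 := rhoTrace_mul_comm (𝒪.isRhoComm U) (I := fun k => -coordDeg n d k)
      (J := fun k => -coordDeg n d k) hP hP
  change rhoTrace ρ _ (q + q) (P * P) = ρ q q • rhoTrace ρ _ (q + q) (P * P) at h5
  rw [hQ.odd, neg_one_smul, eq_neg_iff_add_eq_zero, ← two_smul K] at h5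
  rw [h1, (smul_eq_zero_iff_right two_ne_zero).1 h5, neg_zero]

/-- The divergence of a homological vector field is closed. -/
theorem IsDivergence.app_eq_zero {vol : VolumeForm 𝓜} {Q : VectorField 𝓜.toRhoSheaf}
    (hQ : Q.IsHomological) {g : 𝓜.sec ⊤} (h : IsDivergence vol Q g) : Q.app ⊤ g = 0 := by
  rw [isDivergence_iff] at h
  refine RhoManifold.ext_top (Q.app_mem _ _ _ h.1) (Submodule.zero_mem _) fun x => ?_
  rw [← Q.app_res, h.2, localDiv, map_add, x.app_coordDiv hQ, map_zero, zero_add]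
  exact map_logDeriv (𝓜.isRhoComm _) (Q.leibniz _) (Q.app_mem _) hQ.odd (hQ.app_app _)
    (vol.deg_zero x) (vol.isUnit x)

/-! ### The modular class -/

theorem exists_unique_isModularClass {Q : VectorField 𝓜.toRhoSheaf} (hQ : Q.IsHomological)
    (vol : VolumeForm 𝓜) : ∃! c, IsModularClass Q vol c := by
  obtain ⟨g, hg⟩ := exists_isDivergence vol Q
  refine ⟨_, ⟨⟨g, ?_, hg.app_eq_zero hQ⟩, hg, rfl⟩, ?_⟩
  · rw [one_smul]
    exact hg.1
  · rintro c ⟨z, hz, rfl⟩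
    congr 1
    exact Subtype.ext (hz.unique hg)

/-- If the logarithmic derivatives of two volume forms differ by `Q h`, they have the same modular
class. -/
theorem IsModularClass.of_logDeriv {Q : VectorField 𝓜.toRhoSheaf} (hQ : Q.IsHomological)
    {vol₁ vol₂ : VolumeForm 𝓜} {h : 𝓜.sec ⊤} (hh : h ∈ 𝓜.deg ⊤ 0)
    (heq : ∀ x : Coord 𝕜 n r d 𝓜.toRhoSheaf, logDeriv (Q.app x.dom) (vol₂.val x) =
      logDeriv (Q.app x.dom) (vol₁.val x) + Q.app x.dom (𝓜.res le_top h)) {c : Cohomology Q 1}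
    (hc : IsModularClass Q vol₁ c) : IsModularClass Q vol₂ c := by
  obtain ⟨z, hz, rfl⟩ := hc
  have hQh : Q.app ⊤ h ∈ 𝓜.deg ⊤ Q.degree := by simpa using Q.app_mem ⊤ 0 h hh
  have hdiv : IsDivergence vol₂ Q (z.1 + Q.app ⊤ h) := by
    rw [isDivergence_iff] at hz ⊢
    refine ⟨Submodule.add_mem _ hz.1 hQh, fun x => ?_⟩
    rw [map_add, hz.2 x, localDiv, localDiv, heq, ← Q.app_res, add_assoc]
  refine ⟨⟨z.1 + Q.app ⊤ h, ?_, hdiv.app_eq_zero hQ⟩, hdiv, ?_⟩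
  · rw [one_smul]
    exact hdiv.1
  · rw [Submodule.Quotient.eq]
    refine ⟨h, by simpa using hh, ?_⟩
    simp

end Coordinates

/-! ### Reciprocals and logarithms of functions -/

section Logarithm

variable {K : Type*} [RCLike K]

/-- The logarithm of the absolute value on a copy of the real numbers. -/
def absLog (z : K) : K := ((Real.log (RCLike.re z) : ℝ) : K)

theorem IsRealCategory.ofReal_re (h : IsRealCategory K) (z : K) : ((RCLike.re z : ℝ) : K) = z := by
  have hz := RCLike.re_add_im z
  unfold IsRealCategory at h
  rwa [h, mul_zero, add_zero] at hz

theorem exp_ofReal (t : ℝ) : NormedSpace.exp (t : K) = ((Real.exp t : ℝ) : K) := by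
  rw [Real.exp_eq_exp_ℝ]
  exact (NormedSpace.algebraMap_exp_comm (𝔸 := K) t).symm

theorem IsRealCategory.absLog_exp (h : IsRealCategory K) (z : K) :
    absLog (NormedSpace.exp z) = z := by
  rw [← h.ofReal_re z, exp_ofReal, absLog, RCLike.ofReal_re, Real.log_exp]

theorem absLog_neg (z : K) : absLog (-z) = absLog z := by
  simp [absLog]

theorem IsRealCategory.exists_exp (h : IsRealCategory K) {z : K} (hz : z ≠ 0) :
    ∃ v : K, z = NormedSpace.exp v ∨ z = -NormedSpace.exp v := by
  have hre : RCLike.re z ≠ 0 := fun h0 => hz (by rw [← h.ofReal_re z, h0, RCLike.ofReal_zero])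
  refine ⟨absLog z, ?_⟩
  rw [absLog, exp_ofReal]
  rcases lt_or_gt_of_ne hre with h0 | h0
  · right
    rw [Real.exp_log_of_neg h0, RCLike.ofReal_neg, neg_neg, h.ofReal_re]
  · left
    rw [Real.exp_log h0, h.ofReal_re]

/-- The logarithm is a local inverse of the exponential, hence analytic, with derivative `1 / z`. -/
theorem IsRealCategory.absLog_regular (h : IsRealCategory K) (k : WithTop ℕ∞) {z : K}
    (hz : z ≠ 0) : ContDiffAt K k (absLog : K → K) z ∧ HasDerivAt (absLog : K → K) z⁻¹ z := by
  have key : ∀ v : K, ContDiffAt K k (absLog : K → K) (NormedSpace.exp v) ∧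
      HasDerivAt (absLog : K → K) (NormedSpace.exp v)⁻¹ (NormedSpace.exp v) := by
    intro v
    have hne : NormedSpace.exp v ≠ 0 := (NormedSpace.isUnit_exp v).ne_zero
    have hs : HasStrictDerivAt NormedSpace.exp (NormedSpace.exp v) v := hasStrictDerivAt_exp
    have hsf := hs.hasStrictFDerivAt_equiv hne
    set e := hsf.toOpenPartialHomeomorph NormedSpace.exp
    have hmem : NormedSpace.exp v ∈ e.target := hsf.image_mem_toOpenPartialHomeomorph_target
    have hsv : e.symm (NormedSpace.exp v) = v := hsf.localInverse_apply_image
    have heq : (absLog : K → K) =ᶠ[𝓝 (NormedSpace.exp v)] e.symm := by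
      filter_upwards [e.open_target.mem_nhds hmem] with y hy
      have h1 : NormedSpace.exp (e.symm y) = y := e.right_inv hy
      conv_lhs => rw [← h1]
      exact h.absLog_exp _
    have hex : ContDiff K k (NormedSpace.exp : K → K) :=
      AnalyticOnNhd.contDiff fun x _ => NormedSpace.exp_analytic x
    refine ⟨(e.contDiffAt_symm_deriv hne hmem ?_ ?_).congr_of_eventuallyEq heq,
      (hs.to_localInverse hne).hasDerivAt.congr_of_eventuallyEq heq⟩
    · rw [hsv]; exact hs.hasDerivAt
    · exact hex.contDiffAt
  obtain ⟨v, rfl | rfl⟩ := h.exists_exp hz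
  · exact key v
  · have hneg : (absLog : K → K) = absLog ∘ Neg.neg := funext fun y => (absLog_neg y).symm
    obtain ⟨h1, h2⟩ := key v
    rw [← neg_neg (NormedSpace.exp v)] at h1 h2
    rw [hneg]
    refine ⟨h1.comp _ contDiff_neg.contDiffAt, ?_⟩
    have h3 := h2.comp _ (hasDerivAt_neg (-NormedSpace.exp v))
    rwa [neg_neg, mul_neg_one, ← inv_neg] at h3

end Logarithm

section Functions

variable {𝕜 : Type*} [RCLike 𝕜] {K : Type*} [RCLike K] [NormedAlgebra 𝕜 K] {n : ℕ}
  {r : Regularity} {M : Type*} [TopologicalSpace M] [ChartedSpace (Model 𝕜 n) M] {V : Opens M}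

/-- The composition of a function with a map that is regular at its values. -/
def Fun.postcomp (f : Fun 𝕜 K n r V) (θ : K → K) (hθ : ∀ p, ContDiffAt 𝕜 r.order θ (f.1 p)) :
    Fun 𝕜 K n r V :=
  ⟨fun p => θ (f.1 p), fun p => (hθ p).contMDiffAt.comp p (f.2 p)⟩

/-- The reciprocal of a function without zeros. -/
def Fun.inv (f : Fun 𝕜 K n r V) (hf : ∀ p, f.1 p ≠ 0) : Fun 𝕜 K n r V :=
  Fun.postcomp f (fun z => z⁻¹) fun p => contDiffAt_inv 𝕜 (hf p)

theorem Fun.mul_inv (f : Fun 𝕜 K n r V) (hf : ∀ p, f.1 p ≠ 0) : f * Fun.inv f hf = 1 :=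
  Subtype.ext (funext fun p => mul_inv_cancel₀ (hf p))

end Functions

section Coordinates

variable {𝕜 : Type*} [RCLike 𝕜] {K : Type*} [RCLike K] [NormedAlgebra 𝕜 K] {n m : ℕ}
  {r : Regularity} {M : Type u} [TopologicalSpace M] [ChartedSpace (Model 𝕜 n) M]
  [IsManifold 𝓘(𝕜, Model 𝕜 n) r.order M]
  {G : Type*} [AddCommGroup G] [DecidableEq G] {ρ : CommutationFactor K G} {d : Fin m → G}

namespace Coord

variable {𝒪 : RhoSheaf.{u, w} ρ M} (x : Coord 𝕜 n r d 𝒪) (V : Opens M) (hV : V ≤ x.dom)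

/-- Chain rule for the composition of a function of the manifold with a scalar map. -/
theorem app_const_comp {q : G} (D : LocalDer 𝒪 V q) (f g f' : Fun 𝕜 K n r V) {θ : K → K}
    (hg : ∀ p, g.1 p = θ (f.1 p)) (hf' : ∀ p, HasDerivAt θ (f'.1 p) (f.1 p)) :
    D.app V le_rfl (x.const V hV g) = x.const V hV f' * D.app V le_rfl (x.const V hV f) := by
  rw [x.app_eq_sum D hV (x.const V hV g), x.app_eq_sum D hV (x.const V hV f), Finset.mul_sum]
  refine Finset.sum_congr rfl fun a _ => ?_
  rw [← mul_assoc, (𝒪.isRhoComm V).zero_comm_all (x.const_mem V hV f'), mul_assoc]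
  congr 1
  induction a using Fin.addCases with
  | left a =>
    rw [partialDeriv_const_castAdd, partialDeriv_const_castAdd, ← const_mul,
      chartPartial_comp _ _ _ _ a f g f' hg hf']
  | right b => rw [partialDeriv_const_natAdd, partialDeriv_const_natAdd, mul_zero]

/-! ### The order filtration -/

/-- The section `f` has no terms of order less than `L` in the graded indeterminates. -/
def HasOrder (L : ℕ) (f : 𝒪.sec V) : Prop := ∀ w : Fin m →₀ ℕ, w.degree < L → x.coeff V hV f w = 0

variable {x V hV}

theorem HasOrder.add {L : ℕ} {f g : 𝒪.sec V} (hf : x.HasOrder V hV L f) (hg : x.HasOrder V hV L g) :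
    x.HasOrder V hV L (f + g) := fun w hw => by
  rw [map_add, Pi.add_apply, hf w hw, hg w hw, add_zero]

theorem HasOrder.smul {L : ℕ} {f : 𝒪.sec V} (hf : x.HasOrder V hV L f) (c : K) :
    x.HasOrder V hV L (c • f) := fun w hw => by
  rw [map_smul, Pi.smul_apply, hf w hw, smul_zero]

theorem HasOrder.sub {L : ℕ} {f g : 𝒪.sec V} (hf : x.HasOrder V hV L f) (hg : x.HasOrder V hV L g) :
    x.HasOrder V hV L (f - g) := fun w hw => by
  rw [map_sub, Pi.sub_apply, hf w hw, hg w hw, sub_zero]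

theorem HasOrder.sum {L : ℕ} {ι : Type*} {s : Finset ι} {f : ι → 𝒪.sec V}
    (hf : ∀ k ∈ s, x.HasOrder V hV L (f k)) : x.HasOrder V hV L (∑ k ∈ s, f k) := fun w hw => by
  rw [map_sum, Finset.sum_apply]
  exact Finset.sum_eq_zero fun k hk => hf k hk w hw

theorem HasOrder.mono {L L' : ℕ} (h : L ≤ L') {f : 𝒪.sec V} (hf : x.HasOrder V hV L' f) :
    x.HasOrder V hV L f := fun w hw => hf w (hw.trans_le h)

theorem HasOrder.mul {L L' : ℕ} {f g : 𝒪.sec V} (hf : x.HasOrder V hV L f)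
    (hg : x.HasOrder V hV L' g) : x.HasOrder V hV (L + L') (f * g) := fun w hw => by
  rw [x.coeff_mul]
  unfold seriesMul
  split_ifs
  · refine Finset.sum_eq_zero fun q hq => ?_
    have hdeg : q.1.degree + q.2.degree = w.degree := by
      rw [← map_add, Finset.HasAntidiagonal.mem_antidiagonal.1 hq]
    rcases lt_or_ge q.1.degree L with h | h
    · rw [hf _ h, zero_mul, smul_zero]
    · rw [hg _ (by omega), mul_zero, smul_zero]
  · rfl

theorem HasOrder.pow {f : 𝒪.sec V} (hf : x.HasOrder V hV 1 f) (k : ℕ) :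
    x.HasOrder V hV k (f ^ k) := by
  induction k with
  | zero => exact fun w hw => absurd hw (Nat.not_lt_zero _)
  | succ k ih => rw [pow_succ]; exact ih.mul hf

theorem hasOrder_zero (f : 𝒪.sec V) : x.HasOrder V hV 0 f := fun _ hw =>
  absurd hw (Nat.not_lt_zero _)

theorem eq_of_hasOrder {f g : 𝒪.sec V} (h : ∀ L, x.HasOrder V hV L (f - g)) : f = g := by
  refine sub_eq_zero.1 (x.coeff_injective V hV ?_)
  rw [map_zero]
  exact funext fun w => h _ w (Nat.lt_succ_self _)

theorem hasOrder_one_iff {f : 𝒪.sec V} : x.HasOrder V hV 1 f ↔ x.coeff V hV f 0 = 0 := by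
  refine ⟨fun h => h 0 (by simp), fun h w hw => ?_⟩
  rw [Nat.lt_one_iff, Finsupp.degree_eq_zero_iff] at hw
  rw [hw, h]

theorem hasOrder_fn (b : Fin m) : x.HasOrder V hV 1 (x.fn V hV (Fin.natAdd n b)) := by
  rw [hasOrder_one_iff, coeff_fn_natAdd, Pi.single_eq_of_ne]
  exact fun h => by simpa using congrArg (fun v => v b) h

/-- A derivation lowers the order at most by one. -/
theorem HasOrder.app {q : G} (D : LocalDer 𝒪 V q) {L : ℕ} {i : G} {f : 𝒪.sec V}
    (hi : f ∈ 𝒪.deg V i) (hf : x.HasOrder V hV (L + 1) f) :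
    x.HasOrder V hV L (D.app V le_rfl f) := by
  induction L generalizing i f with
  | zero => exact hasOrder_zero _
  | succ L ih =>
    obtain ⟨h, hh, hfh, hord⟩ := x.exists_eq_const_add_sum V hV hi
    have h0 : x.const V hV (x.coeff V hV f 0) = 0 := by
      rw [hf 0 (by simp)]; exact (x.constL V hV).map_zero
    have hb : ∀ b, x.HasOrder V hV (L + 1) (h b) := fun b w hw => hord b w (hf _ (by
      rw [map_add, Finsupp.degree_single]; omega))
    rw [hfh, h0, zero_add, map_sum]
    refine HasOrder.sum fun b _ => ?_
    rw [D.leibniz V le_rfl _ _ _ (x.fn_mem V hV (Fin.natAdd n b))]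
    refine HasOrder.add ?_ (HasOrder.smul ?_ _)
    · exact ((hasOrder_zero _).mul (hb b)).mono (by omega)
    · exact ((hasOrder_fn b).mul (ih (hh b) (hb b))).mono (by omega)

variable (x V hV)

/-! ### Power series of nilpotent sections -/

theorem powerSeries_coeff_mem (a : ℕ → K) {N : 𝒪.sec V} (hN : N ∈ 𝒪.deg V 0) :
    (fun w => ∑ k ∈ Finset.range (w.degree + 1), a k • x.coeff V hV (N ^ k) w :
      Series 𝕜 K n m r V) ∈ homog ρ d V 0 := by
  intro w hw
  have h : ∃ k, x.coeff V hV (N ^ k) w ≠ 0 := by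
    by_contra! h
    exact hw (by simp [h])
  obtain ⟨k, hk⟩ := h
  have h2 := SetLike.pow_mem_graded k hN
  rw [smul_zero] at h2
  exact x.coeff_mem V hV h2 w hk

/-- The substitution of a section `N` of degree zero without constant term into the power series
`∑ k, a k t^k`.  The coefficient at `w` is the finite sum over the `k` up to the order of `w`, since
`N ^ k` has no terms of order less than `k`. -/
def powerSeries (a : ℕ → K) (N : 𝒪.sec V) (hN : N ∈ 𝒪.deg V 0) : 𝒪.sec V :=
  x.lift V hV _ (x.powerSeries_coeff_mem V hV a hN)

variable {x V hV}

theorem powerSeries_mem (a : ℕ → K) {N : 𝒪.sec V} (hN : N ∈ 𝒪.deg V 0) :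
    x.powerSeries V hV a N hN ∈ 𝒪.deg V 0 := x.lift_mem V hV _ _

theorem coeff_powerSeries (a : ℕ → K) {N : 𝒪.sec V} (hN : N ∈ 𝒪.deg V 0) (w : Fin m →₀ ℕ) :
    x.coeff V hV (x.powerSeries V hV a N hN) w =
      ∑ k ∈ Finset.range (w.degree + 1), a k • x.coeff V hV (N ^ k) w := by
  rw [powerSeries, coeff_lift]

theorem hasOrder_powerSeries_sub (a : ℕ → K) {N : 𝒪.sec V} (hN : N ∈ 𝒪.deg V 0)
    (h1 : x.HasOrder V hV 1 N) (L : ℕ) : x.HasOrder V hV L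
      (x.powerSeries V hV a N hN - ∑ k ∈ Finset.range L, a k • N ^ k) := by
  intro w hw
  rw [map_sub, Pi.sub_apply, coeff_powerSeries, map_sum, Finset.sum_apply, sub_eq_zero]
  simp only [map_smul, Pi.smul_apply]
  have hsub : Finset.range (w.degree + 1) ⊆ Finset.range L := Finset.range_mono hw
  refine Finset.sum_subset hsub fun k _ hk => ?_
  rw [h1.pow k w, smul_zero]
  simp only [Finset.mem_range] at hk
  omega

theorem pow_mem_zero {N : 𝒪.sec V} (hN : N ∈ 𝒪.deg V 0) (k : ℕ) : N ^ k ∈ 𝒪.deg V 0 := by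
  have h := SetLike.pow_mem_graded k hN
  rwa [smul_zero] at h

theorem _root_.RhoGeometry.LocalDer.app_pow {q : G} (D : LocalDer 𝒪 V q) {N : 𝒪.sec V}
    (hN : N ∈ 𝒪.deg V 0) (k : ℕ) :
    D.app V le_rfl (N ^ (k + 1)) = ((k : K) + 1) • (N ^ k * D.app V le_rfl N) := by
  induction k with
  | zero => simp
  | succ k ih =>
    rw [pow_succ, D.leibniz V le_rfl 0 _ _ (pow_mem_zero hN _), ih, ρ.zero_right, one_smul,
      smul_mul_assoc, mul_assoc, ← (𝒪.isRhoComm V).zero_comm_all hN, ← mul_assoc, ← pow_succ,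
      Nat.cast_succ, add_smul ((k : K) + 1) (1 : K), one_smul]

/-- Chain rule for the substitution into a power series.  Both sides agree up to any order, since
a derivation lowers the order at most by one. -/
theorem app_powerSeries {q : G} (D : LocalDer 𝒪 V q) (a : ℕ → K) {N : 𝒪.sec V}
    (hN : N ∈ 𝒪.deg V 0) (h1 : x.HasOrder V hV 1 N) :
    D.app V le_rfl (x.powerSeries V hV a N hN) =
      x.powerSeries V hV (fun k => ((k : K) + 1) * a (k + 1)) N hN * D.app V le_rfl N := by
  refine eq_of_hasOrder (x := x) (hV := hV) fun L => ?_
  have hmem : x.powerSeries V hV a N hN - ∑ k ∈ Finset.range (L + 1), a k • N ^ k ∈ 𝒪.deg V 0 :=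
    Submodule.sub_mem _ (powerSeries_mem a hN)
      (Submodule.sum_mem _ fun k _ => Submodule.smul_mem _ _ (pow_mem_zero hN k))
  have hA := (hasOrder_powerSeries_sub (x := x) (hV := hV) a hN h1 (L + 1)).app D hmem
  have hB := (hasOrder_powerSeries_sub (x := x) (hV := hV)
    (fun k => ((k : K) + 1) * a (k + 1)) hN h1 L).mul
    (hasOrder_zero (x := x) (hV := hV) (D.app V le_rfl N))
  have hC := hA.sub hB
  have hsum : D.app V le_rfl (∑ k ∈ Finset.range (L + 1), a k • N ^ k) =
      (∑ k ∈ Finset.range L, (((k : K) + 1) * a (k + 1)) • N ^ k) * D.app V le_rfl N := by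
    rw [Finset.sum_range_succ', map_add, map_smul, pow_zero, D.app_one, smul_zero, add_zero, map_sum,
      Finset.sum_mul]
    refine Finset.sum_congr rfl fun k _ => ?_
    rw [map_smul, D.app_pow hN, smul_smul, smul_mul_assoc, mul_comm]
  rw [map_sub, hsum, sub_mul, sub_sub_sub_cancel_right] at hC
  exact hC

/-- The geometric series. -/
theorem powerSeries_mul_one_add {N : 𝒪.sec V} (hN : N ∈ 𝒪.deg V 0) (h1 : x.HasOrder V hV 1 N) :
    x.powerSeries V hV (fun k => (-1) ^ k) N hN * (1 + N) = 1 := by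
  refine eq_of_hasOrder (x := x) (hV := hV) fun L => ?_
  have h2 := (hasOrder_powerSeries_sub (x := x) (hV := hV) (fun k => (-1 : K) ^ k) hN h1 L).mul
    (hasOrder_zero (x := x) (hV := hV) (1 + N))
  have hgeom : (∑ k ∈ Finset.range L, (-1 : K) ^ k • N ^ k) * (1 + N) = 1 - (-1 : K) ^ L • N ^ L := by
    have h := geom_sum_mul_neg (-N) L
    have hp : ∀ k : ℕ, (-N) ^ k = (-1 : K) ^ k • N ^ k := fun k => by
      rw [← smul_pow, neg_one_smul]
    simpa only [hp, sub_neg_eq_add] using h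
  rw [sub_mul, hgeom] at h2
  have h3 := h2.sub ((h1.pow L).smul ((-1 : K) ^ L))
  have h4 : ∀ a b c : 𝒪.sec V, a - (b - c) - c = a - b := fun a b c => by abel
  rwa [h4] at h3

end Coord

end Coordinates

section Coordinates

variable {𝕜 : Type*} [RCLike 𝕜] {K : Type*} [RCLike K] [NormedAlgebra 𝕜 K] {n m : ℕ}
  {r : Regularity} {M : Type u} [TopologicalSpace M] [ChartedSpace (Model 𝕜 n) M]
  [IsManifold 𝓘(𝕜, Model 𝕜 n) r.order M]
  {G : Type*} [AddCommGroup G] [DecidableEq G] {ρ : CommutationFactor K G} {d : Fin m → G}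

/-! ### The exponential -/

namespace Coord

variable {𝒪 : RhoSheaf.{u, w} ρ M} (x : Coord 𝕜 n r d 𝒪) (V : Opens M) (hV : V ≤ x.dom)

/-- The part of a section without constant term. -/
def higher (f : 𝒪.sec V) : 𝒪.sec V := f - x.const V hV (x.coeff V hV f 0)

variable {x V hV}

theorem higher_mem {f : 𝒪.sec V} (hf : f ∈ 𝒪.deg V 0) : x.higher V hV f ∈ 𝒪.deg V 0 :=
  Submodule.sub_mem _ hf (x.const_mem V hV _)

theorem hasOrder_higher (f : 𝒪.sec V) : x.HasOrder V hV 1 (x.higher V hV f) := by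
  rw [hasOrder_one_iff, higher, map_sub, coeff_const, Pi.sub_apply, Pi.single_eq_same, sub_self]

theorem exp_eq {f : 𝒪.sec V} (hf : f ∈ 𝒪.deg V 0) : x.exp V hV f hf =
    x.const V hV (Fun.exp (x.coeff V hV f 0)) *
      x.powerSeries V hV (fun k => (k.factorial : K)⁻¹) (x.higher V hV f) (higher_mem hf) := by
  refine x.coeff_injective V hV (funext fun w => ?_)
  rw [exp, coeff_lift, coeff_const_mul, coeff_powerSeries]
  rfl

/-- The chain rule `D (exp f) = exp f · D f`. -/
theorem app_exp {q : G} (D : LocalDer 𝒪 V q) {f : 𝒪.sec V} (hf : f ∈ 𝒪.deg V 0) :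
    D.app V le_rfl (x.exp V hV f hf) = x.exp V hV f hf * D.app V le_rfl f := by
  set f₀ := x.coeff V hV f 0 with hf₀
  have hN := higher_mem (x := x) (hV := hV) hf
  have h0 : D.app V le_rfl (x.const V hV (Fun.exp f₀)) =
      x.const V hV (Fun.exp f₀) * D.app V le_rfl (x.const V hV f₀) :=
    x.app_const_comp V hV D f₀ (Fun.exp f₀) (Fun.exp f₀) (θ := NormedSpace.exp) (fun _ => rfl)
      fun p => hasDerivAt_exp
  have h1 := app_powerSeries D (fun k => (k.factorial : K)⁻¹) hN (hasOrder_higher f)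
  have hfac : (fun k : ℕ => ((k : K) + 1) * (((k + 1).factorial : ℕ) : K)⁻¹) =
      fun k => (k.factorial : K)⁻¹ := funext fun k => by
    have h2 : ((k : K) + 1) ≠ 0 := by exact_mod_cast Nat.succ_ne_zero k
    rw [Nat.factorial_succ, Nat.cast_mul, mul_inv, Nat.cast_succ, mul_inv_cancel_left₀ h2]
  rw [hfac] at h1
  have hsplit : f = x.const V hV f₀ + x.higher V hV f := by rw [higher, ← hf₀]; abel
  have hDf : D.app V le_rfl f =
      D.app V le_rfl (x.const V hV f₀) + D.app V le_rfl (x.higher V hV f) := by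
    rw [← map_add, ← hsplit]
  rw [exp_eq, D.leibniz V le_rfl 0 _ _ (x.const_mem V hV _), ρ.zero_right, one_smul, h0, h1, hDf,
    mul_add, mul_assoc, mul_assoc, mul_assoc,
    ← (𝒪.isRhoComm V).zero_comm_all (powerSeries_mem _ hN)]

/-! ### The value of a section at a point -/

theorem coeff_mul_zero (f g : 𝒪.sec V) :
    x.coeff V hV (f * g) 0 = x.coeff V hV f 0 * x.coeff V hV g 0 := by
  rw [x.coeff_mul, seriesMul_apply_zero]

theorem coeff_zero_ne_zero {f : 𝒪.sec V} (hf : IsUnit f) (p : V) :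
    (x.coeff V hV f 0).1 p ≠ 0 := by
  obtain ⟨g, hg⟩ := hf.exists_right_inv
  have h := coeff_mul_zero (x := x) (hV := hV) f g
  rw [hg, x.coeff_one, Pi.single_eq_same] at h
  intro h0
  have h1 : (1 : K) = (x.coeff V hV f 0).1 p * (x.coeff V hV g 0).1 p :=
    congrArg (fun φ : Fun 𝕜 K n r V => φ.1 p) h
  rw [h0, zero_mul] at h1
  exact one_ne_zero h1

/-- A section whose constant term has no zeros is its constant term times `1 + N`, with `N` without
constant term. -/
theorem exists_eq_const_mul {f : 𝒪.sec V} (hf : f ∈ 𝒪.deg V 0)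
    (h : ∀ p, (x.coeff V hV f 0).1 p ≠ 0) : ∃ N ∈ 𝒪.deg V 0, x.HasOrder V hV 1 N ∧
      f = x.const V hV (x.coeff V hV f 0) * (1 + N) := by
  refine ⟨x.const V hV (Fun.inv _ h) * f - 1, Submodule.sub_mem _ ?_ SetLike.GradedOne.one_mem,
    ?_, ?_⟩
  · have h1 := SetLike.mul_mem_graded (x.const_mem V hV (Fun.inv _ h)) hf
    rwa [zero_add] at h1
  · rw [hasOrder_one_iff, map_sub, Pi.sub_apply, coeff_const_mul, mul_comm, Fun.mul_inv, x.coeff_one,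
      Pi.single_eq_same, sub_self]
  · rw [add_sub_cancel, ← mul_assoc, ← const_mul, Fun.mul_inv, const_one, one_mul]

theorem isUnit_one_add {N : 𝒪.sec V} (hN : N ∈ 𝒪.deg V 0) (h1 : x.HasOrder V hV 1 N) :
    IsUnit (1 + N) := by
  have h := powerSeries_mul_one_add hN h1
  exact ⟨⟨1 + N, _, ((𝒪.isRhoComm V).zero_comm_all (powerSeries_mem _ hN) _).symm.trans h, h⟩, rfl⟩

/-- A section of degree zero is invertible if its constant term has no zeros. -/
theorem isUnit_of_coeff_zero {f : 𝒪.sec V} (hf : f ∈ 𝒪.deg V 0)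
    (h : ∀ p, (x.coeff V hV f 0).1 p ≠ 0) : IsUnit f := by
  obtain ⟨N, hN, h1, hfN⟩ := exists_eq_const_mul hf h
  rw [hfN]
  refine IsUnit.mul ?_ (isUnit_one_add hN h1)
  refine ⟨⟨x.const V hV (x.coeff V hV f 0), x.const V hV (Fun.inv _ h), ?_, ?_⟩, rfl⟩
  · rw [← const_mul, Fun.mul_inv, const_one]
  · rw [← const_mul, mul_comm, Fun.mul_inv, const_one]

/-- The constant term vanishes at `p` in all coordinates or in none, because this means that the
section is not invertible near `p`. -/
theorem coeff_zero_eq_zero (y : Coord 𝕜 n r d 𝒪) (hy : V ≤ y.dom) {f : 𝒪.sec V}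
    (hf : f ∈ 𝒪.deg V 0) {p : V} (h : (x.coeff V hV f 0).1 p = 0) :
    (y.coeff V hy f 0).1 p = 0 := by
  by_contra hne
  have hopen : IsOpen {p : V | (y.coeff V hy f 0).1 p ≠ 0} :=
    isOpen_ne_fun (y.coeff V hy f 0).2.continuous continuous_const
  set W : Opens M := ⟨Subtype.val '' {p : V | (y.coeff V hy f 0).1 p ≠ 0},
    V.2.isOpenMap_subtype_val _ hopen⟩
  have hW : W ≤ V := by
    rintro _ ⟨q, -, rfl⟩
    exact q.2
  have hp : p.1 ∈ W := ⟨p, hne, rfl⟩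
  have hu : IsUnit (𝒪.res hW f) := by
    refine isUnit_of_coeff_zero (x := y) (hV := hW.trans hy) (𝒪.res_mem hW _ _ hf) ?_
    intro p'
    obtain ⟨q, hq, hqp⟩ := p'.2
    rw [y.coeff_res_apply hy hW _ _ p'.1 p'.2]
    rwa [show q = ⟨p'.1, hW p'.2⟩ from Subtype.ext hqp] at hq
  have h2 := coeff_zero_ne_zero (x := x) (hV := hW.trans hV) hu ⟨p.1, hp⟩
  rw [x.coeff_res_apply hV hW] at h2
  exact h2 h

/-- The constant term of a section of degree zero does not depend on the coordinates. -/
theorem coeff_zero_eq (y : Coord 𝕜 n r d 𝒪) (hy : V ≤ y.dom) {f : 𝒪.sec V}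
    (hf : f ∈ 𝒪.deg V 0) (p : V) :
    (x.coeff V hV f 0).1 p = (y.coeff V hy f 0).1 p := by
  have key : ∀ z : Coord 𝕜 n r d 𝒪, ∀ hz : V ≤ z.dom, ∀ c : K,
      (z.coeff V hz (f - c • 1) 0).1 p = (z.coeff V hz f 0).1 p - c := by
    intro z hz c
    rw [map_sub, map_smul, z.coeff_one, Pi.sub_apply, Pi.smul_apply, Pi.single_eq_same]
    change _ - c * 1 = _
    rw [mul_one]
  have hmem : f - (x.coeff V hV f 0).1 p • (1 : 𝒪.sec V) ∈ 𝒪.deg V 0 :=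
    Submodule.sub_mem _ hf (Submodule.smul_mem _ _ SetLike.GradedOne.one_mem)
  have h := coeff_zero_eq_zero (x := x) (hV := hV) y hy hmem (p := p) (by rw [key, sub_self])
  rw [key] at h
  exact (sub_eq_zero.1 h).symm

/-! ### The logarithm in the real category -/

/-- The coefficients of the power series of the logarithm of `1 + t`.  At `k = 0` the division by zero
gives the right value zero. -/
def logCoeff (K : Type*) [RCLike K] (k : ℕ) : K := -(-1) ^ k / k

theorem logCoeff_succ (k : ℕ) : ((k : K) + 1) * logCoeff K (k + 1) = (-1) ^ k := by
  have h : ((k : K) + 1) ≠ 0 := by exact_mod_cast Nat.succ_ne_zero k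
  rw [logCoeff, Nat.cast_succ, mul_div_cancel₀ _ h, pow_succ, mul_neg_one, neg_neg]

/-- An invertible section `s` of degree zero has a logarithm of its absolute value: its derivatives
are the logarithmic derivatives of `s`. -/
theorem exists_log (hK : IsRealCategory K) {s : 𝒪.sec V} (hs : s ∈ 𝒪.deg V 0) (hu : IsUnit s) :
    ∃ f ∈ 𝒪.deg V 0, (∀ p, (x.coeff V hV f 0).1 p = absLog ((x.coeff V hV s 0).1 p)) ∧
      ∀ (q : G) (D : LocalDer 𝒪 V q), D.app V le_rfl f = logDeriv (D.app V le_rfl) s := by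
  have hne := coeff_zero_ne_zero (x := x) (hV := hV) hu
  obtain ⟨N, hN, h1, hsN⟩ := exists_eq_const_mul hs hne
  set s₀ := x.coeff V hV s 0
  have hreg := fun p => hK.absLog_regular r.order (hne p)
  set L := Fun.postcomp s₀ absLog fun p => (hreg p).1.restrict_scalars 𝕜
  refine ⟨x.const V hV L + x.powerSeries V hV (logCoeff K) N hN,
    Submodule.add_mem _ (x.const_mem V hV _) (powerSeries_mem _ hN), fun p => ?_, fun q D => ?_⟩
  · have h0 : x.coeff V hV (x.powerSeries V hV (logCoeff K) N hN) 0 = 0 := by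
      rw [coeff_powerSeries]
      simp [logCoeff]
    rw [map_add, Pi.add_apply, h0, add_zero, coeff_const, Pi.single_eq_same]
    rfl
  · symm
    have hL := x.app_const_comp V hV D s₀ L (Fun.inv s₀ hne) (θ := absLog) (fun _ => rfl)
      fun p => (hreg p).2
    have hP := app_powerSeries D (logCoeff K) hN h1
    simp only [logCoeff_succ] at hP
    have hgeo := powerSeries_mul_one_add hN h1
    have hgm := powerSeries_mem (x := x) (hV := hV) (fun k => (-1 : K) ^ k) hN
    rw [logDeriv_eq_iff _ hu, map_add, hL, hP]
    conv_lhs => rw [hsN]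
    conv_rhs => rw [hsN]
    rw [D.leibniz V le_rfl 0 _ _ (x.const_mem V hV _), ρ.zero_right, one_smul, map_add, D.app_one,
      zero_add, mul_add (x.const V hV s₀ * (1 + N))]
    have hcomm : x.const V hV s₀ * (1 + N) = (1 + N) * x.const V hV s₀ :=
      (𝒪.isRhoComm V).zero_comm_all (x.const_mem V hV _) _
    congr 1
    · rw [hcomm, mul_assoc, ← mul_assoc (x.const V hV s₀), ← const_mul, Fun.mul_inv, const_one,
        one_mul, (𝒪.isRhoComm V).zero_comm_all
          (Submodule.add_mem _ SetLike.GradedOne.one_mem hN)]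
    · rw [mul_assoc, ← mul_assoc (1 + N), ← (𝒪.isRhoComm V).zero_comm_all hgm, hgeo, one_mul]

/-- Sections with the same derivatives with respect to the graded indeterminates and the same
constant term are equal. -/
theorem ext_partialDeriv {f g : 𝒪.sec V}
    (h : ∀ b : Fin m, x.partialDeriv V hV (Fin.natAdd n b) f = x.partialDeriv V hV (Fin.natAdd n b) g)
    (h0 : ∀ p, (x.coeff V hV f 0).1 p = (x.coeff V hV g 0).1 p) : f = g := by
  refine x.coeff_injective V hV (funext fun w => ?_)
  by_cases hw : w = 0
  · subst hw
    exact Subtype.ext (funext h0)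
  obtain ⟨b, hb⟩ : ∃ b, w b ≠ 0 := by
    by_contra! hall
    exact hw (Finsupp.ext hall)
  have hwv : w = (w - Finsupp.single b 1) + Finsupp.single b 1 :=
    (tsub_add_cancel_of_le (Finsupp.single_le_iff.2 (Nat.one_le_iff_ne_zero.2 hb))).symm
  have h1 := congrArg (fun s => x.coeff V hV s (w - Finsupp.single b 1)) (h b)
  simp only [coeff_partialDeriv, partialSeries_natAdd, formalPartial, LinearMap.coe_mk,
    AddHom.coe_mk, ← hwv] at h1
  refine smul_right_injective (Fun 𝕜 K n r V) (mul_ne_zero ?_ (ρ.ne_zero _ _)) h1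
  exact Nat.cast_add_one_ne_zero _

end Coord

/-! ### Comparison of volume forms -/

variable {𝓜 : RhoManifold.{u, w} 𝕜 n r M ρ d}

/-- The quotient of two volume forms in the coordinates `x`. -/
def VolumeForm.ratio (vol₁ vol₂ : VolumeForm 𝓜) (x : Coord 𝕜 n r d 𝓜.toRhoSheaf) :
    𝓜.sec x.dom := Ring.inverse (vol₁.val x) * vol₂.val x

theorem VolumeForm.mul_ratio (vol₁ vol₂ : VolumeForm 𝓜) (x : Coord 𝕜 n r d 𝓜.toRhoSheaf) :
    vol₁.val x * vol₁.ratio vol₂ x = vol₂.val x := by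
  rw [ratio, ← mul_assoc, Ring.mul_inverse_cancel _ (vol₁.isUnit x), one_mul]

theorem VolumeForm.ratio_mem (vol₁ vol₂ : VolumeForm 𝓜) (x : Coord 𝕜 n r d 𝓜.toRhoSheaf) :
    vol₁.ratio vol₂ x ∈ 𝓜.deg x.dom 0 := by
  have h := SetLike.mul_mem_graded (ringInverse_mem_zero (vol₁.deg_zero x) (vol₁.isUnit x))
    (vol₂.deg_zero x)
  rwa [zero_add] at h

theorem VolumeForm.isUnit_ratio (vol₁ vol₂ : VolumeForm 𝓜) (x : Coord 𝕜 n r d 𝓜.toRhoSheaf) :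
    IsUnit (vol₁.ratio vol₂ x) :=
  (isUnit_ringInverse.2 (vol₁.isUnit x)).mul (vol₂.isUnit x)

theorem VolumeForm.res_ratio (vol₁ vol₂ : VolumeForm 𝓜) (x y : Coord 𝕜 n r d 𝓜.toRhoSheaf) :
    𝓜.res (inf_le_left : x.dom ⊓ y.dom ≤ x.dom) (vol₁.ratio vol₂ x) =
      𝓜.res (inf_le_right : x.dom ⊓ y.dom ≤ y.dom) (vol₁.ratio vol₂ y) := by
  have hx := (vol₁.isUnit x).map (𝓜.res (inf_le_left : x.dom ⊓ y.dom ≤ x.dom))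
  rw [← hx.mul_right_inj, ← map_mul, mul_ratio, vol₁.transition x y, vol₂.transition x y, mul_assoc,
    ← map_mul, mul_ratio]

theorem VolumeForm.logDeriv_ratio (vol₁ vol₂ : VolumeForm 𝓜) (X : VectorField 𝓜.toRhoSheaf)
    (x : Coord 𝕜 n r d 𝓜.toRhoSheaf) : logDeriv (X.app x.dom) (vol₂.val x) =
      logDeriv (X.app x.dom) (vol₁.val x) + logDeriv (X.app x.dom) (vol₁.ratio vol₂ x) := by
  rw [← logDeriv_mul (𝓜.isRhoComm _) (X.leibniz _) (vol₁.deg_zero x) (vol₁.ratio_mem vol₂ x)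
    (vol₁.isUnit x) (vol₁.isUnit_ratio vol₂ x), mul_ratio]

/-- Equivalent volume forms have the same modular class. -/
theorem IsModularClass.of_equivalent {Q : VectorField 𝓜.toRhoSheaf} (hQ : Q.IsHomological)
    {vol₁ vol₂ : VolumeForm 𝓜} (h : vol₁.Equivalent vol₂) {c : Cohomology Q 1}
    (hc : IsModularClass Q vol₁ c) : IsModularClass Q vol₂ c := by
  obtain ⟨f, hf, hv⟩ := h
  refine hc.of_logDeriv hQ hf fun x => ?_
  have hratio : vol₁.ratio vol₂ x =
      x.exp x.dom le_rfl (𝓜.res le_top f) (𝓜.res_mem le_top 0 f hf) := by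
    rw [← (vol₁.isUnit x).mul_right_inj, vol₁.mul_ratio, hv]
  rw [vol₁.logDeriv_ratio vol₂]
  congr 1
  rw [logDeriv_eq_iff _ (vol₁.isUnit_ratio vol₂ x), hratio]
  exact Coord.app_exp (Q.local x.dom) _

/-- In the real category the quotient of two volume forms has a global logarithm of its absolute
value. -/
theorem VolumeForm.exists_log_ratio (hK : IsRealCategory K) (vol₁ vol₂ : VolumeForm 𝓜) :
    ∃ f ∈ 𝓜.deg ⊤ 0, ∀ (X : VectorField 𝓜.toRhoSheaf) (x : Coord 𝕜 n r d 𝓜.toRhoSheaf),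
      X.app x.dom (𝓜.res le_top f) = logDeriv (X.app x.dom) (vol₁.ratio vol₂ x) := by
  choose L hL hL0 hLD using fun x : Coord 𝕜 n r d 𝓜.toRhoSheaf =>
    x.exists_log (V := x.dom) (hV := le_rfl) hK (vol₁.ratio_mem vol₂ x) (vol₁.isUnit_ratio vol₂ x)
  -- On an overlap the logarithm in one of the coordinate systems is compared with the restrictions
  -- of both.
  have hres : ∀ (x z : Coord 𝕜 n r d 𝓜.toRhoSheaf) (V : Opens M) (hx : V ≤ x.dom) (hz : V ≤ z.dom)
      (F : 𝓜.sec V), F ∈ 𝓜.deg V 0 →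
      (∀ p, (z.coeff V hz F 0).1 p = absLog ((z.coeff V hz (𝓜.res hx (vol₁.ratio vol₂ x)) 0).1 p)) →
      (∀ (q : G) (D : LocalDer 𝓜.toRhoSheaf V q), D.app V le_rfl F =
        logDeriv (D.app V le_rfl) (𝓜.res hx (vol₁.ratio vol₂ x))) → 𝓜.res hx (L x) = F := by
    intro x z V hx hz F hF hF0 hFD
    refine Coord.ext_partialDeriv (x := x) (hV := hx) (fun b => ?_) fun p => ?_
    · rw [x.partialDeriv_res x.dom le_rfl hx]
      refine (congrArg (𝓜.res hx) (hLD x _ (x.partialDer x.dom le_rfl (Fin.natAdd n b)))).trans ?_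
      refine (𝓜.res_logDeriv hx ?_ (vol₁.isUnit_ratio vol₂ x)).trans
        (hFD _ (x.partialDer V hx (Fin.natAdd n b))).symm
      exact fun f => x.partialDeriv_res x.dom le_rfl hx _ f
    · rw [Coord.coeff_zero_eq (x := x) (hV := hx) z hz hF, hF0,
        ← Coord.coeff_zero_eq (x := x) (hV := hx) z hz
          (𝓜.res_mem hx _ _ (vol₁.ratio_mem vol₂ x)),
        x.coeff_res_apply le_rfl hx _ _ p.1 p.2, x.coeff_res_apply le_rfl hx _ _ p.1 p.2, hL0]
  obtain ⟨f, hf, hfL⟩ := 𝓜.exists_glue L hL fun x y => by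
    obtain ⟨F, hF, hF0, hFD⟩ := x.exists_log (V := x.dom ⊓ y.dom) (hV := inf_le_left) hK
      (𝓜.res_mem inf_le_left _ _ (vol₁.ratio_mem vol₂ x))
      ((vol₁.isUnit_ratio vol₂ x).map (𝓜.res (inf_le_left : x.dom ⊓ y.dom ≤ x.dom)))
    rw [hres x x _ inf_le_left inf_le_left F hF hF0 hFD]
    rw [vol₁.res_ratio] at hF0 hFD
    exact (hres y x _ inf_le_right inf_le_left F hF hF0 hFD).symm
  refine ⟨f, hf, fun X x => ?_⟩
  rw [hfL]
  exact hLD x _ (X.local x.dom)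

theorem IsModularClass.of_isRealCategory (hK : IsRealCategory K) {Q : VectorField 𝓜.toRhoSheaf}
    (hQ : Q.IsHomological) (vol₁ vol₂ : VolumeForm 𝓜) {c : Cohomology Q 1}
    (hc : IsModularClass Q vol₁ c) : IsModularClass Q vol₂ c := by
  obtain ⟨f, hf, h⟩ := vol₁.exists_log_ratio hK vol₂
  exact hc.of_logDeriv hQ hf fun x => by rw [h, vol₁.logDeriv_ratio vol₂]

end Coordinates

end RhoGeometry

end

theorem mainTheorem1 {𝕜 : Type*} [RCLike 𝕜] {K : Type*} [RCLike K] [NormedAlgebra 𝕜 K]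
    {n m : ℕ} {r : RhoGeometry.Regularity} {M : Type*} [TopologicalSpace M] [T2Space M]
    [SecondCountableTopology M] [ConnectedSpace M] [ChartedSpace (EuclideanSpace 𝕜 (Fin n)) M]
    [IsManifold 𝓘(𝕜, EuclideanSpace 𝕜 (Fin n)) r.order M]
    {G : Type*} [AddCommGroup G] [DecidableEq G] {ρ : RhoGeometry.CommutationFactor K G}
    {d : Fin m → G} (𝓜 : RhoGeometry.RhoManifold 𝕜 n r M ρ d)
    (Q : RhoGeometry.VectorField 𝓜.toRhoSheaf) (hQ : Q.IsHomological) (hM : 𝓜.Orientable) :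
    (∀ vol : RhoGeometry.VolumeForm 𝓜, ∃! c, RhoGeometry.IsModularClass Q vol c) ∧
    (∀ vol₁ vol₂ : RhoGeometry.VolumeForm 𝓜, vol₁.Equivalent vol₂ →
      ∀ c, RhoGeometry.IsModularClass Q vol₁ c ↔ RhoGeometry.IsModularClass Q vol₂ c) ∧
    (RhoGeometry.IsRealCategory K →
      ∃! c, ∀ vol : RhoGeometry.VolumeForm 𝓜, RhoGeometry.IsModularClass Q vol c) := by
  refine ⟨fun vol => RhoGeometry.exists_unique_isModularClass hQ vol,
    fun vol₁ vol₂ h c => ⟨fun hc => hc.of_equivalent hQ h, fun hc => ?_⟩, fun hK => ?_⟩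
  · obtain ⟨c', hc', -⟩ := RhoGeometry.exists_unique_isModularClass hQ vol₁
    obtain ⟨_, -, hu⟩ := RhoGeometry.exists_unique_isModularClass hQ vol₂
    rwa [hu c hc, ← hu c' (hc'.of_equivalent hQ h)]
  · obtain ⟨vol₀⟩ := hM
    obtain ⟨c, hc, hu⟩ := RhoGeometry.exists_unique_isModularClass hQ vol₀
    exact ⟨c, fun vol => hc.of_isRealCategory hK hQ vol₀ vol, fun c' hc' => hu c' (hc' vol₀)⟩
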